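/- Conventions: $T_{[ab]}=T_{ab}-T_{ba}$ (no factor $\tfrac12$); the Riemann tensor is normalised by $\nabla_{\mu}\nabla_{\nu}V^\sigma-\nabla_\nu\nabla_\mu V^\sigma=R^\sigma{}_{\rho\mu\nu}V^\rho$, the Ricci tensor is $R_{\mu\nu}=R^\sigma{}_{\mu\sigma\nu}$, and in spacetime dimension four the Schouten tensor is $S_{\mu\nu}=R_{\mu\nu}-\tfrac16 R\,g_{\mu\nu}$. **Setting.** Let $(\hat{\mathcal M},\hat g)$ and $(\mathcal M,g)$ be smooth four-dimensional manifolds with smooth metrics of signature $(-,+,+,+)$, let $\Psi:\hat{\mathcal M}\to\mathcal M$ be a smooth embedding and $\Omega:\mathcal M\to\mathbb R$ a smooth function such that, with $I$ denoting the boundary of $\Psi(\hat{\mathcal M})$ in $\mathcal M$: 1. $\Psi^*g=(\Omega\circ\Psi)^2\,\hat g$ on $\hat{\mathcal M}$; 2. $\Omega=0$ and $d\Omega\neq0$ on $I$; 3. there is an open neighbourhood $U$ of $I$ in $\mathcal M$ such that $\hat g$ is Ricci-flat on $\Psi^{-1}(U)$; 4. with $n^\mu=g^{\mu\nu}\partial_\nu\Omega$,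 the gauge condition $\nabla_\nu n^\mu=0$ holds on $I$. Let $\Phi:\mathbb R\times\mathbb S^2\to\mathcal M$ be a smooth embedding with image $I$ (null infinity) and $d\Phi(\partial_{\xi^1})=n$, where $\xi^1\in\mathbb R$ is the null coordinate. For local coordinates $\xi^M$ on $\mathbb S^2$ put $e_M=d\Phi(\partial_{\xi^M})$, and let $q_{MN}=g(e_M,e_N)$ be the induced metric on the sections $\xi^1=\text{const}$ and $D$ its Levi-Civita connection. Let $\ell$ be the smooth vector field along $I$ determined by $g(\ell,\ell)=0$, $g(\ell,n)=1$, $g(\ell,e_M)=0$, and write $S_{MN}=S(e_M,e_N)$, $S_{n\ell}=S(n,\ell)$, $S_{M\ell}=S(e_M,\ell)$ for the components on $I$ of the Schouten tensor $S$ of $g$. **Proposition.** Let $\Xi_{MN}(\xi^1,\cdot)$ be a $(0,2)$ tensor field on $\mathbb S^2$, depending smoothly on $(\xi^1,\xi^M)\in\mathbb R\times\mathbb S^2$, that solves the null-infinity evolution equation $$\partial_n\Xi_{MN}=-\tfrac12\left(S_{MN}+S_{n\ell}\,q_{MN}\right),\qquad \partial_n=\partial_{\xi^1},$$ on all of $\mathbb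 R\times\mathbb S^2$. If the relation $$D_{[M}\Xi_{N]P}=\tfrac12\,q_{P[M}S_{N]\ell}$$ holds on the whole section $\xi^1=\xi^1_0$ for one value $\xi^1_0\in\mathbb R$, then it holds on the section $\xi^1=t$ for every $t\in\mathbb R$. -/

import Mathlib

open scoped Manifold ContDiff

noncomputable section

namespace NullInfinity

/-! ### Tensor calculus in a coordinate patch -/

/-- Coordinate space `ℝⁿ`. -/
abbrev Coord (n : ℕ) : Type := EuclideanSpace ℝ (Fin n)

/-- The partial derivative `∂ᵢ f` at `y`. -/
def pd {n : ℕ} (i : Fin n) (f : Coord n → ℝ) (y : Coord n) : ℝ :=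
  fderiv ℝ f y (EuclideanSpace.single i 1)

/-- Christoffel symbols `Γᵏᵢⱼ = ½ gᵏˡ (∂ᵢ gⱼₗ + ∂ⱼ gᵢₗ - ∂ₗ gᵢⱼ)` of the metric components `G`. -/
def christoffel {n : ℕ} (G : Coord n → Matrix (Fin n) (Fin n) ℝ) (y : Coord n)
    (k i j : Fin n) : ℝ :=
  (1 / 2) * ∑ l, (G y)⁻¹ k l *
    (pd i (fun z => G z j l) y + pd j (fun z => G z i l) y - pd l (fun z => G z i j) y)

/-- Riemann tensor `R^σ_{ρμν}`, normalised by `∇_μ ∇_ν V^σ - ∇_ν ∇_μ V^σ = R^σ_{ρμν} V^ρ`. -/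
def riemann {n : ℕ} (G : Coord n → Matrix (Fin n) (Fin n) ℝ) (y : Coord n)
    (σ ρ μ ν : Fin n) : ℝ :=
  pd μ (fun z => christoffel G z σ ν ρ) y - pd ν (fun z => christoffel G z σ μ ρ) y
    + ∑ τ, (christoffel G y σ μ τ * christoffel G y τ ν ρ
      - christoffel G y σ ν τ * christoffel G y τ μ ρ)

/-- Ricci tensor `R_{μν} = R^σ_{μσν}`. -/
def ricci {n : ℕ} (G : Coord n → Matrix (Fin n) (Fin n) ℝ) (y : Coord n) (μ ν : Fin n) : ℝ :=
  ∑ σ, riemann G y σ μ σ ν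

/-- Scalar curvature `R = g^{μν} R_{μν}`. -/
def scalarCurvature {n : ℕ} (G : Coord n → Matrix (Fin n) (Fin n) ℝ) (y : Coord n) : ℝ :=
  ∑ μ, ∑ ν, (G y)⁻¹ μ ν * ricci G y μ ν

/-- Schouten tensor in spacetime dimension four, `S_{μν} = R_{μν} - (1/6) R g_{μν}`. -/
def schouten (G : Coord 4 → Matrix (Fin 4) (Fin 4) ℝ) (y : Coord 4) (μ ν : Fin 4) : ℝ :=
  ricci G y μ ν - (1 / 6) * scalarCurvature G y * G y μ ν

/-- Covariant derivative `D_i T_{jk} = ∂ᵢ T_{jk} - Γˡᵢⱼ T_{lk} - Γˡᵢₖ T_{jl}` for the Levi-Civita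
connection of `G`. -/
def covDeriv {n : ℕ} (G : Coord n → Matrix (Fin n) (Fin n) ℝ)
    (T : Coord n → Fin n → Fin n → ℝ) (y : Coord n) (i j k : Fin n) : ℝ :=
  pd i (fun z => T z j k) y - ∑ l, christoffel G y l i j * T y l k
    - ∑ l, christoffel G y l i k * T y j l

/-- The gradient `n^μ = g^{μν} ∂_ν f`. -/
def gradient {n : ℕ} (G : Coord n → Matrix (Fin n) (Fin n) ℝ) (f : Coord n → ℝ)
    (y : Coord n) (μ : Fin n) : ℝ :=
  ∑ ν, (G y)⁻¹ μ ν * pd ν f y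

/-- Covariant derivative `∇_ν V^μ = ∂_ν V^μ + Γ^μ_{νρ} V^ρ` of a vector field. -/
def covDerivVec {n : ℕ} (G : Coord n → Matrix (Fin n) (Fin n) ℝ) (V : Coord n → Fin n → ℝ)
    (y : Coord n) (ν μ : Fin n) : ℝ :=
  pd ν (fun z => V z μ) y + ∑ ρ, christoffel G y μ ν ρ * V y ρ

/-! ### Charts of a manifold -/

section Charts

variable {n : ℕ} {X : Type*} [TopologicalSpace X] [ChartedSpace (Coord n) X]

/-- The coordinate vector `∂ᵢ` of the chart `φ`, at the point with coordinates `y`. -/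
def coordVec (φ : OpenPartialHomeomorph X (Coord n)) (y : Coord n) (i : Fin n) :
    TangentSpace (𝓡 n) (φ.symm y) :=
  mfderiv (𝓡 n) (𝓡 n) φ.symm y (EuclideanSpace.single i (1 : ℝ))

/-- The `i`-th component, in the chart `φ`, of the tangent vector `u` at `x`. -/
def coordComp (φ : OpenPartialHomeomorph X (Coord n)) (x : X) (u : TangentSpace (𝓡 n) x)
    (i : Fin n) : ℝ :=
  (show Coord n from mfderiv (𝓡 n) (𝓡 n) φ x u) i

end Charts

/-! ### Lorentzian metrics -/

/-- A smooth metric of signature `(-,+,+,+)` on a four-dimensional manifold. -/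
structure LorentzMetric (X : Type*) [TopologicalSpace X] [ChartedSpace (Coord 4) X] where
  /-- The bilinear form on each tangent space. -/
  form (x : X) : TangentSpace (𝓡 4) x →L[ℝ] TangentSpace (𝓡 4) x →L[ℝ] ℝ
  symm (x : X) (u v : TangentSpace (𝓡 4) x) : form x u v = form x v u
  signature (x : X) : ∃ b : Module.Basis (Fin 4) ℝ (TangentSpace (𝓡 4) x),
    ∀ i j, form x (b i) (b j) = if i = j then (if i = 0 then -1 else 1) else 0
  smooth : ∀ φ ∈ IsManifold.maximalAtlas (𝓡 4) ∞ X, ∀ i j : Fin 4,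
    ContDiffOn ℝ ∞ (fun y => form (φ.symm y) (coordVec φ y i) (coordVec φ y j)) φ.target

section Lorentz

variable {X : Type*} [TopologicalSpace X] [ChartedSpace (Coord 4) X]

/-- The components `g_{μν}` of the metric in the chart `φ`. -/
def LorentzMetric.inChart (g : LorentzMetric X) (φ : OpenPartialHomeomorph X (Coord 4)) :
    Coord 4 → Matrix (Fin 4) (Fin 4) ℝ :=
  fun y => Matrix.of fun i j => g.form (φ.symm y) (coordVec φ y i) (coordVec φ y j)

/-- The Schouten tensor of `g` at `x`, as a function of two tangent vectors. It is computed in the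
preferred chart at `x`; being a tensor, it does not depend on the chart. -/
def LorentzMetric.schoutenAt (g : LorentzMetric X) (x : X) (u v : TangentSpace (𝓡 4) x) : ℝ :=
  ∑ μ, ∑ ν, schouten (g.inChart (chartAt (Coord 4) x)) (chartAt (Coord 4) x x) μ ν
    * coordComp (chartAt (Coord 4) x) x u μ * coordComp (chartAt (Coord 4) x) x v ν

/-- The gauge condition `∇_ν n^μ = 0` on the set `I`, for `n^μ = g^{μν} ∂_ν Ω`. -/
def DivergenceFreeGauge (g : LorentzMetric X) (Ω : X → ℝ) (I : Set X) : Prop :=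
  ∀ φ ∈ IsManifold.maximalAtlas (𝓡 4) ∞ X, ∀ x ∈ φ.source, x ∈ I → ∀ ν μ : Fin 4,
    covDerivVec (g.inChart φ) (gradient (g.inChart φ) (Ω ∘ φ.symm)) (φ x) ν μ = 0

end Lorentz

/-! ### Asymptotically flat spacetimes and null infinity -/

/-- The unphysical spacetime `(X, g)`, with the embedding `Ψ` and the conformal factor `Ω`, is a
conformal completion of the physical spacetime `(Y, g')` whose null infinity, the boundary of the
image of `Ψ`, lies at `Ω = 0`; `dΩ` does not vanish there, and `g'` solves the vacuum Einstein
equations near it. -/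
structure IsConformalCompletion
    {Y : Type*} [TopologicalSpace Y] [ChartedSpace (Coord 4) Y]
    {X : Type*} [TopologicalSpace X] [ChartedSpace (Coord 4) X]
    (g' : LorentzMetric Y) (g : LorentzMetric X) (Ψ : Y → X) (Ω : X → ℝ) : Prop where
  embedding : Manifold.IsSmoothEmbedding (𝓡 4) (𝓡 4) ∞ Ψ
  smooth_factor : ContMDiff (𝓡 4) 𝓘(ℝ, ℝ) ∞ Ω
  conformal : ∀ (y : Y) (u v : TangentSpace (𝓡 4) y),
    g.form (Ψ y) (mfderiv (𝓡 4) (𝓡 4) Ψ y u) (mfderiv (𝓡 4) (𝓡 4) Ψ y v)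
      = Ω (Ψ y) ^ 2 * g'.form y u v
  factor_eq_zero : ∀ x ∈ frontier (Set.range Ψ), Ω x = 0
  normal_ne_zero : ∀ x ∈ frontier (Set.range Ψ), mfderiv (𝓡 4) 𝓘(ℝ, ℝ) Ω x ≠ 0
  vacuum : ∃ U : Set X, IsOpen U ∧ frontier (Set.range Ψ) ⊆ U ∧
    ∀ φ ∈ IsManifold.maximalAtlas (𝓡 4) ∞ Y, ∀ y ∈ φ.source, Ψ y ∈ U →
      ∀ μ ν : Fin 4, ricci (g'.inChart φ) (φ y) μ ν = 0

/-- The unit sphere `𝕊²`. -/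
abbrev Sphere2 : Type := Metric.sphere (0 : EuclideanSpace ℝ (Fin (2 + 1))) 1

section Frame

variable {X : Type*} [TopologicalSpace X] [ChartedSpace (Coord 4) X]

/-- The tangent vector `e₁ = dΦ(∂_{ξ¹})` at the point `(t, p)`. -/
def nullVec (Φ : ℝ × Sphere2 → X) (t : ℝ) (p : Sphere2) : TangentSpace (𝓡 4) (Φ (t, p)) :=
  mfderiv (𝓘(ℝ, ℝ).prod (𝓡 2)) (𝓡 4) Φ (t, p) ((1 : ℝ), (0 : Coord 2))

/-- The push-forward under `Φ` of a vector `u` tangent to the section `ξ¹ = t`; it is `e_M` when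
`u` is the coordinate vector `∂_M`. -/
def sectionVec (Φ : ℝ × Sphere2 → X) (t : ℝ) (p : Sphere2) (u : TangentSpace (𝓡 2) p) :
    TangentSpace (𝓡 4) (Φ (t, p)) :=
  mfderiv (𝓘(ℝ, ℝ).prod (𝓡 2)) (𝓡 4) Φ (t, p) ((0 : ℝ), (u : Coord 2))

/-- `Φ` parametrises the hypersurface `I` by `ℝ × 𝕊²`, with `e₁ = n` the gradient of `Ω`, and `ℓ` is
the smooth rigging along `I`: null, with `g(ℓ, n) = 1` and orthogonal to the sections. -/
structure IsAdaptedFrame (g : LorentzMetric X) (Ω : X → ℝ) (I : Set X) (Φ : ℝ × Sphere2 → X)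
    (ℓ : ∀ (t : ℝ) (p : Sphere2), TangentSpace (𝓡 4) (Φ (t, p))) : Prop where
  embedding : Manifold.IsSmoothEmbedding (𝓘(ℝ, ℝ).prod (𝓡 2)) (𝓡 4) ∞ Φ
  range_eq : Set.range Φ = I
  nullVec_eq : ∀ t p (w : TangentSpace (𝓡 4) (Φ (t, p))),
    g.form (Φ (t, p)) (nullVec Φ t p) w = mfderiv (𝓡 4) 𝓘(ℝ, ℝ) Ω (Φ (t, p)) w
  rigging_smooth : ∀ φ ∈ IsManifold.maximalAtlas (𝓡 4) ∞ X, ∀ μ : Fin 4,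
    ContMDiffOn (𝓘(ℝ, ℝ).prod (𝓡 2)) 𝓘(ℝ, ℝ) ∞
      (fun ξ : ℝ × Sphere2 => coordComp φ (Φ (ξ.1, ξ.2)) (ℓ ξ.1 ξ.2) μ) (Φ ⁻¹' φ.source)
  rigging_null : ∀ t p, g.form (Φ (t, p)) (ℓ t p) (ℓ t p) = 0
  rigging_nullVec : ∀ t p, g.form (Φ (t, p)) (ℓ t p) (nullVec Φ t p) = 1
  rigging_section : ∀ t p (u : TangentSpace (𝓡 2) p),
    g.form (Φ (t, p)) (ℓ t p) (sectionVec Φ t p u) = 0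

/-- The induced metric `q` on the section `ξ¹ = t`. -/
def sectionMetric (g : LorentzMetric X) (Φ : ℝ × Sphere2 → X) (t : ℝ) (p : Sphere2)
    (u v : TangentSpace (𝓡 2) p) : ℝ :=
  g.form (Φ (t, p)) (sectionVec Φ t p u) (sectionVec Φ t p v)

/-- The components `q_{MN}` in the chart `c` of the sphere. -/
def sectionMetricInChart (g : LorentzMetric X) (Φ : ℝ × Sphere2 → X) (t : ℝ)
    (c : OpenPartialHomeomorph Sphere2 (Coord 2)) : Coord 2 → Matrix (Fin 2) (Fin 2) ℝ :=
  fun y => Matrix.of fun M N =>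
    sectionMetric g Φ t (c.symm y) (coordVec c y M) (coordVec c y N)

/-- A tensor field of type `(0,2)` on the sections `𝕊²`, depending on the null coordinate. -/
abbrev SectionTensor : Type :=
  ℝ → ∀ p : Sphere2, TangentSpace (𝓡 2) p →L[ℝ] TangentSpace (𝓡 2) p →L[ℝ] ℝ

/-- The components `Ξ_{MN}` in the chart `c` of the sphere, at the value `t` of `ξ¹`. -/
def SectionTensor.inChart (Ξ : SectionTensor) (t : ℝ)
    (c : OpenPartialHomeomorph Sphere2 (Coord 2)) : Coord 2 → Fin 2 → Fin 2 → ℝ :=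
  fun y M N => Ξ t (c.symm y) (coordVec c y M) (coordVec c y N)

/-- The components of `Ξ` are smooth functions of `(ξ¹, ξ^M)`. -/
def SectionTensor.IsSmooth (Ξ : SectionTensor) : Prop :=
  ∀ c ∈ IsManifold.maximalAtlas (𝓡 2) ∞ Sphere2, ∀ M N : Fin 2,
    ContDiffOn ℝ ∞ (fun z : ℝ × Coord 2 => Ξ.inChart z.1 c z.2 M N) (Set.univ ×ˢ c.target)

/-- The evolution equation `∂ₙ Ξ_{MN} = -½ (S_{MN} + S_{nℓ} q_{MN})`. -/
def EvolutionEquation (g : LorentzMetric X) (Φ : ℝ × Sphere2 → X)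
    (ℓ : ∀ (t : ℝ) (p : Sphere2), TangentSpace (𝓡 4) (Φ (t, p))) (Ξ : SectionTensor) : Prop :=
  ∀ (t : ℝ) (p : Sphere2) (u v : TangentSpace (𝓡 2) p),
    HasDerivAt (fun s => Ξ s p u v)
      (-(1 / 2) * (g.schoutenAt (Φ (t, p)) (sectionVec Φ t p u) (sectionVec Φ t p v)
        + g.schoutenAt (Φ (t, p)) (nullVec Φ t p) (ℓ t p) * sectionMetric g Φ t p u v)) t

/-- The relation `D_M Ξ_{NP} - D_N Ξ_{MP} = ½ (q_{PM} S_{Nℓ} - q_{PN} S_{Mℓ})` on the whole section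
`ξ¹ = t`, where `D` is the Levi-Civita connection of `q`. -/
def ConstraintOnSection (g : LorentzMetric X) (Φ : ℝ × Sphere2 → X)
    (ℓ : ∀ (t : ℝ) (p : Sphere2), TangentSpace (𝓡 4) (Φ (t, p))) (Ξ : SectionTensor)
    (t : ℝ) : Prop :=
  ∀ c ∈ IsManifold.maximalAtlas (𝓡 2) ∞ Sphere2, ∀ y ∈ c.target, ∀ M N P : Fin 2,
    covDeriv (sectionMetricInChart g Φ t c) (Ξ.inChart t c) y M N P
        - covDeriv (sectionMetricInChart g Φ t c) (Ξ.inChart t c) y N M P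
      = (1 / 2) *
        (sectionMetricInChart g Φ t c y P M
            * g.schoutenAt (Φ (t, c.symm y)) (sectionVec Φ t (c.symm y) (coordVec c y N))
              (ℓ t (c.symm y))
          - sectionMetricInChart g Φ t c y P N
            * g.schoutenAt (Φ (t, c.symm y)) (sectionVec Φ t (c.symm y) (coordVec c y M))
              (ℓ t (c.symm y)))

end Frame

end NullInfinity

end

/-! Write `W` for the conformal factor in a chart, `N` for its gradient, `S` for the Schouten tensor
and `Y(u,v,w) = (∇_u S)(v,w) - (∇_v S)(u,w)` for the Cotton tensor.

In the bulk `W ≠ 0` and the physical metric is Ricci flat, so the conformal change of the Ricci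
tensor gives `W S = f g - 2 Hess W` with `W f = |dW|²` (`schouten_of_conformal_ricciFlat`).
Differentiating `W f = |dW|²` gives `df = -S(N,·)`. The symmetry of the second derivative of `f`
then gives `Y(·,·,N) = 0` (`cotton_gradient`). Differentiating the equation for `S` and applying the
Ricci identity to `N` expresses the curvature acting on `N` through `f`, `W`, `S` and `W Y`; its
trace gives `tr Y = 0` (`trace_cotton`), without the second Bianchi identity. None of these
identities divides by `W`, so they extend by continuity from the bulk to null infinity
(`isVacuumBoundaryPoint`).

On null infinity `W = 0` and `∇N = 0`. Pairing the equation with `ℓ` and `n` gives `f = 0` there,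
hence `S(n,·) = 0` on tangent vectors. The gauge also makes `n`, `e_M` and `ℓ` parallel along `n`,
so `q` does not depend on `ξ¹`. The Cotton tensor is antisymmetric in its first two slots, is killed
by `n` in the last one and is trace free. Since the sections are two-dimensional, this leaves
`Y_{MNP} = q_{MP} Y_{Nnℓ} - q_{NP} Y_{Mnℓ}` (`cotton_tangential`). In the adapted frame the left
side is `D_{[M} S_{N]P}`, and `Y_{Mnℓ} = ∂_M S_{nℓ} - ∂_n S_{Mℓ}` (`propagation`).

By the evolution equation and `D q = 0`, the `ξ¹`-derivative of the defect of the constraint is `-½`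
times the expression that `propagation` shows to vanish (`hasDerivAt_constraint`). Each component of
the defect is therefore constant along each generator, and it is zero at `ξ¹_0`.

The Schouten tensor is evaluated in preferred charts, so its chart independence is also needed. It
is obtained from the same equation (`schoutenForm_chart_change`): in the bulk `S` is determined by
`g`, `W` and the Hessian of `W`, so the transformation law of the curvature is not required. -/

noncomputable section

namespace NullInfinity

/-! ### Metrics and Levi-Civita connections on an open set of a vector space -/

section VectorSpace

variable {E : Type*} [NormedAddCommGroup E] [NormedSpace ℝ E]

/-- The metric `g` and its Levi-Civita connection `Γ` (as a bilinear map) on the open set `V`. -/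
structure IsLeviCivitaOn (g : E → E →L[ℝ] E →L[ℝ] ℝ) (Γ : E → E →L[ℝ] E →L[ℝ] E)
    (V : Set E) : Prop where
  isOpen : IsOpen V
  smooth_metric : ContDiffOn ℝ ∞ g V
  smooth_connection : ContDiffOn ℝ ∞ Γ V
  metric_symm : ∀ z ∈ V, ∀ u v, g z u v = g z v u
  nondegenerate : ∀ z ∈ V, ∀ u, (∀ v, g z u v = 0) → u = 0
  torsion_free : ∀ z ∈ V, ∀ u v, Γ z u v = Γ z v u
  compatible : ∀ z ∈ V, ∀ w u v, fderiv ℝ g z w u v = g z (Γ z w u) v + g z u (Γ z w v)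

/-- The curvature operator `R(u, v) w`. -/
def curv (Γ : E → E →L[ℝ] E →L[ℝ] E) (z u v w : E) : E :=
  fderiv ℝ Γ z u v w - fderiv ℝ Γ z v u w + Γ z u (Γ z v w) - Γ z v (Γ z u w)

/-- The linear map `u ↦ R(u, v) w`. -/
def curvLin (Γ : E → E →L[ℝ] E →L[ℝ] E) (z v w : E) : E →ₗ[ℝ] E where
  toFun u := curv Γ z u v w
  map_add' a b := by simp [curv]; abel
  map_smul' c a := by simp [curv, smul_sub]

/-- The Ricci tensor `Ric(w, v) = tr (u ↦ R(u, v) w)`. -/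
def ric (Γ : E → E →L[ℝ] E →L[ℝ] E) (z w v : E) : ℝ := LinearMap.trace ℝ E (curvLin Γ z v w)

/-- The covariant derivative `∇_u N` of a vector field. -/
def nabla (Γ : E → E →L[ℝ] E →L[ℝ] E) (N : E → E) (z u : E) : E := fderiv ℝ N z u + Γ z u (N z)

/-- The linear map `u ↦ ∇_u N`. -/
def nablaLin (Γ : E → E →L[ℝ] E →L[ℝ] E) (N : E → E) (z : E) : E →ₗ[ℝ] E where
  toFun u := nabla Γ N z u
  map_add' a b := by simp [nabla]; abel
  map_smul' c a := by simp [nabla]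

@[simp] lemma curvLin_apply (Γ : E → E →L[ℝ] E →L[ℝ] E) (z v w u : E) :
    curvLin Γ z v w u = curv Γ z u v w := rfl

@[simp] lemma nablaLin_apply (Γ : E → E →L[ℝ] E →L[ℝ] E) (N : E → E) (z u : E) :
    nablaLin Γ N z u = nabla Γ N z u := rfl

/-- The covariant derivative `(∇_u S)(v, w)` of a bilinear form. -/
def nablaForm (Γ : E → E →L[ℝ] E →L[ℝ] E) (S : E → E →L[ℝ] E →L[ℝ] ℝ) (z u v w : E) : ℝ :=
  fderiv ℝ S z u v w - S z (Γ z u v) w - S z v (Γ z u w)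

/-- The antisymmetrised derivative `(∇_u S)(v, w) - (∇_v S)(u, w)`. -/
def cotton (Γ : E → E →L[ℝ] E →L[ℝ] E) (S : E → E →L[ℝ] E →L[ℝ] ℝ) (z u v w : E) : ℝ :=
  nablaForm Γ S z u v w - nablaForm Γ S z v u w

lemma hasFDerivAt_bilin_const {F : Type*} [NormedAddCommGroup F] [NormedSpace ℝ F]
    {B : E → E →L[ℝ] E →L[ℝ] F} {z : E} (h : DifferentiableAt ℝ B z) (v w : E) :
    ∃ L : E →L[ℝ] F, HasFDerivAt (fun y => B y v w) L z ∧ ∀ u, L u = fderiv ℝ B z u v w := by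
  refine ⟨_, ((h.hasFDerivAt.clm_apply (hasFDerivAt_const v z)).clm_apply
    (hasFDerivAt_const w z)), fun u => by simp⟩

lemma fderiv_bilin {F : Type*} [NormedAddCommGroup F] [NormedSpace ℝ F]
    {B : E → E →L[ℝ] E →L[ℝ] F} {z : E} (h : DifferentiableAt ℝ B z) {a b : E → E}
    (ha : DifferentiableAt ℝ a z) (hb : DifferentiableAt ℝ b z) (u : E) :
    fderiv ℝ (fun y => B y (a y) (b y)) z u =
      fderiv ℝ B z u (a z) (b z) + B z (fderiv ℝ a z u) (b z) + B z (a z) (fderiv ℝ b z u) := by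
  have := ((h.hasFDerivAt.clm_apply ha.hasFDerivAt).clm_apply hb.hasFDerivAt).fderiv
  rw [this]; simp; abel

lemma differentiableAt_bilin {F : Type*} [NormedAddCommGroup F] [NormedSpace ℝ F]
    {B : E → E →L[ℝ] E →L[ℝ] F} {z : E} (h : DifferentiableAt ℝ B z) {a b : E → E}
    (ha : DifferentiableAt ℝ a z) (hb : DifferentiableAt ℝ b z) :
    DifferentiableAt ℝ (fun y => B y (a y) (b y)) z :=
  (h.clm_apply ha).clm_apply hb

lemma fderiv_fderiv_symm {f : E → ℝ} {V : Set E} (hV : IsOpen V) (hf : ContDiffOn ℝ ∞ f V)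
    {z : E} (hz : z ∈ V) (u v : E) :
    fderiv ℝ (fun y => fderiv ℝ f y v) z u = fderiv ℝ (fun y => fderiv ℝ f y u) z v := by
  have h1 : ContDiffAt ℝ ∞ f z := hf.contDiffAt (hV.mem_nhds hz)
  have h2 : DifferentiableAt ℝ (fderiv ℝ f) z :=
    (h1.fderiv_right (m := ∞) (by simp)).differentiableAt (by simp)
  have h3 := h1.isSymmSndFDerivAt (by simpa using (by exact_mod_cast le_top : ((2 : ℕ∞) : WithTop ℕ∞) ≤ ∞))
  rw [fderiv_clm_apply h2 (differentiableAt_const _), fderiv_clm_apply h2 (differentiableAt_const _)]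
  simpa using h3 u v

namespace IsLeviCivitaOn

variable {g : E → E →L[ℝ] E →L[ℝ] ℝ} {Γ : E → E →L[ℝ] E →L[ℝ] E} {V : Set E}

lemma mono (h : IsLeviCivitaOn g Γ V) {B : Set E} (hB : IsOpen B) (hBV : B ⊆ V) :
    IsLeviCivitaOn g Γ B :=
  ⟨hB, h.smooth_metric.mono hBV, h.smooth_connection.mono hBV, fun z hz => h.metric_symm z (hBV hz),
    fun z hz => h.nondegenerate z (hBV hz), fun z hz => h.torsion_free z (hBV hz),
    fun z hz => h.compatible z (hBV hz)⟩

lemma differentiableAt_of_mem (h : IsLeviCivitaOn g Γ V) {F : Type*} [NormedAddCommGroup F]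
    [NormedSpace ℝ F] {f : E → F} (hf : ContDiffOn ℝ ∞ f V) {z : E} (hz : z ∈ V) :
    DifferentiableAt ℝ f z :=
  (hf.contDiffAt (h.isOpen.mem_nhds hz)).differentiableAt (by simp)

lemma fderiv_metric (h : IsLeviCivitaOn g Γ V) {z : E} (hz : z ∈ V) {a b : E → E}
    (ha : DifferentiableAt ℝ a z) (hb : DifferentiableAt ℝ b z) (u : E) :
    fderiv ℝ (fun y => g y (a y) (b y)) z u =
      g z (nabla Γ a z u) (b z) + g z (a z) (nabla Γ b z u) := by
  rw [fderiv_bilin (h.differentiableAt_of_mem h.smooth_metric hz) ha hb, h.compatible z hz]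
  simp [nabla]; ring

lemma ext_metric (h : IsLeviCivitaOn g Γ V) {z : E} (hz : z ∈ V) {a b : E}
    (hab : ∀ v, g z a v = g z b v) : a = b :=
  sub_eq_zero.1 <| h.nondegenerate z hz _ fun v => by simp [hab v]

/-- The Koszul formula. -/
lemma koszul (h : IsLeviCivitaOn g Γ V) {z : E} (hz : z ∈ V) (u v w : E) :
    2 * g z (Γ z u v) w =
      fderiv ℝ g z u v w + fderiv ℝ g z v u w - fderiv ℝ g z w u v := by
  rw [h.compatible z hz, h.compatible z hz, h.compatible z hz, h.torsion_free z hz v u,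
    h.torsion_free z hz w u, h.torsion_free z hz w v, h.metric_symm z hz (Γ z u w) v,
    h.metric_symm z hz u]
  ring

variable [FiniteDimensional ℝ E]

/-- Raising an index. -/
lemma exists_sharp (h : IsLeviCivitaOn g Γ V) {z : E} (hz : z ∈ V) (β : E →ₗ[ℝ] E →ₗ[ℝ] ℝ) :
    ∃ T : E →ₗ[ℝ] E, ∀ u v, g z (T u) v = β u v := by
  let gl : E →ₗ[ℝ] Module.Dual ℝ E :=
    { toFun := fun u => (g z u : E →ₗ[ℝ] ℝ)
      map_add' := fun a b => by ext; simp
      map_smul' := fun a b => by ext; simp }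
  have hinj : Function.Injective gl := by
    rw [← LinearMap.ker_eq_bot, LinearMap.ker_eq_bot']
    intro u hu
    exact h.nondegenerate z hz u fun v => by simpa [gl] using LinearMap.congr_fun hu v
  let e := LinearEquiv.ofInjectiveOfFinrankEq gl hinj (Subspace.dual_finrank_eq).symm
  refine ⟨e.symm.toLinearMap ∘ₗ β, fun u v => ?_⟩
  have h1 : gl (e.symm (β u)) = β u := e.apply_symm_apply (β u)
  simpa [gl] using LinearMap.congr_fun h1 v

end IsLeviCivitaOn

end VectorSpace

section VectorSpace

variable {E : Type*} [NormedAddCommGroup E] [NormedSpace ℝ E]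
  {g : E → E →L[ℝ] E →L[ℝ] ℝ} {Γ : E → E →L[ℝ] E →L[ℝ] E} {V : Set E}

/-! ### Conformal change of the Ricci tensor -/

/-- Compare the Koszul formulas of `g = W² g'` and `g'`; the difference comes from `d(W²)`. The
field `m` is the gradient of `log |W|`. -/
lemma IsLeviCivitaOn.connection_eq_of_conformal {g' : E → E →L[ℝ] E →L[ℝ] ℝ}
    {Γ' : E → E →L[ℝ] E →L[ℝ] E} {W : E → ℝ} {m : E → E}
    (h : IsLeviCivitaOn g Γ V) (h' : IsLeviCivitaOn g' Γ' V)
    (hW : ContDiffOn ℝ ∞ W V) (hW0 : ∀ z ∈ V, W z ≠ 0)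
    (hconf : ∀ z ∈ V, g z = W z ^ 2 • g' z)
    (hm : ∀ z ∈ V, ∀ u, W z * g z (m z) u = fderiv ℝ W z u) {z : E} (hz : z ∈ V) (u v : E) :
    Γ' z u v = Γ z u v - g z (m z) u • v - g z (m z) v • u + g z u v • m z := by
  refine h'.ext_metric hz fun w => ?_
  have hV := h.isOpen.mem_nhds hz
  have hd : ∀ a b c, fderiv ℝ g z a b c =
      2 * W z * fderiv ℝ W z a * g' z b c + W z ^ 2 * fderiv ℝ g' z a b c := by
    intro a b c
    obtain ⟨L, hL, hLa⟩ := hasFDerivAt_bilin_const (h.differentiableAt_of_mem h.smooth_metric hz) b c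
    obtain ⟨M, hM, hMa⟩ :=
      hasFDerivAt_bilin_const (h.differentiableAt_of_mem h'.smooth_metric hz) b c
    have h2 := (h.differentiableAt_of_mem hW hz).hasFDerivAt
    have e1 : HasFDerivAt (fun y => g y b c) _ z := ((h2.pow 2).mul hM).congr_of_eventuallyEq
      (by filter_upwards [hV] with y hy; simp [hconf y hy])
    rw [← hLa a, hL.unique e1]
    simp [hMa]; ring
  have k := h.koszul hz u v w
  have k' := h'.koszul hz u v w
  simp only [hd, ← hm z hz] at k
  simp only [map_add, map_sub, map_smul, add_apply,
    sub_apply, smul_apply, smul_eq_mul]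
  simp only [hconf z hz, smul_apply, smul_eq_mul] at k ⊢
  have hw := hW0 z hz
  have key : W z ^ 2 * (2 * g' z (Γ' z u v) w) = W z ^ 2 *
      (2 * (g' z (Γ z u v) w - W z ^ 2 * g' z (m z) u * g' z v w
        - W z ^ 2 * g' z (m z) v * g' z u w + W z ^ 2 * g' z u v * g' z (m z) w)) := by
    rw [k']
    linear_combination -k
  have := mul_left_cancel₀ (pow_ne_zero 2 hw) key
  linarith

/-- Substitute the difference of the two connections into the curvature operator. The closedness of
`m` removes the multiples of `w` that would otherwise appear. -/
lemma IsLeviCivitaOn.curv_eq_of_conformal {g' : E → E →L[ℝ] E →L[ℝ] ℝ}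
    {Γ' : E → E →L[ℝ] E →L[ℝ] E} {m : E → E}
    (h : IsLeviCivitaOn g Γ V) (h' : IsLeviCivitaOn g' Γ' V) (hms : ContDiffOn ℝ ∞ m V)
    (hΓ : ∀ z ∈ V, ∀ u v,
      Γ' z u v = Γ z u v - g z (m z) u • v - g z (m z) v • u + g z u v • m z)
    (hclosed : ∀ z ∈ V, ∀ u v, g z (nabla Γ m z u) v = g z (nabla Γ m z v) u)
    {z : E} (hz : z ∈ V) (u v w : E) :
    curv Γ' z u v w = curv Γ z u v w - g z (nabla Γ m z u) w • v + g z v w • nabla Γ m z u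
      + g z (nabla Γ m z v) w • u - g z u w • nabla Γ m z v
      + (g z (m z) v * g z (m z) w) • u - (g z (m z) v * g z u w) • m z
      - (g z v w * g z (m z) (m z)) • u - (g z (m z) u * g z (m z) w) • v
      + (g z (m z) u * g z v w) • m z + (g z u w * g z (m z) (m z)) • v := by
  have hV := h.isOpen.mem_nhds hz
  have dm := h.differentiableAt_of_mem hms hz
  have dΓ := h.differentiableAt_of_mem h.smooth_connection hz
  have dΓ' := h.differentiableAt_of_mem h'.smooth_connection hz
  have dg := h.differentiableAt_of_mem h.smooth_metric hz
  -- Derivatives of the metric are rewritten at once by compatibility, so only `∇m` and `Γ` remain.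
  have hd : ∀ a b c, fderiv ℝ Γ' z a b c = fderiv ℝ Γ z a b c
      - (g z (nabla Γ m z a) b + g z (m z) (Γ z a b)) • c
      - (g z (nabla Γ m z a) c + g z (m z) (Γ z a c)) • b
      + (g z b c • fderiv ℝ m z a + (g z (Γ z a b) c + g z b (Γ z a c)) • m z) := by
    intro a b c
    obtain ⟨L, hL, hLa⟩ := hasFDerivAt_bilin_const dΓ' b c
    obtain ⟨M, hM, hMa⟩ := hasFDerivAt_bilin_const dΓ b c
    have hs : ∀ b, DifferentiableAt ℝ (fun y => g y (m y) b) z := fun b =>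
      differentiableAt_bilin dg dm (differentiableAt_const b)
    have hs2 : DifferentiableAt ℝ (fun y => g y b c) z :=
      differentiableAt_bilin dg (differentiableAt_const b) (differentiableAt_const c)
    have e1 : HasFDerivAt (fun y => Γ' y b c) _ z :=
      (((hM.sub ((hs b).hasFDerivAt.smul (hasFDerivAt_const c z))).sub
        ((hs c).hasFDerivAt.smul (hasFDerivAt_const b z))).add
          (hs2.hasFDerivAt.smul dm.hasFDerivAt)).congr_of_eventuallyEq
            (by filter_upwards [hV] with y hy using hΓ y hy b c)
    rw [← hLa a, hL.unique e1]
    have f1 : ∀ b, fderiv ℝ (fun y => g y (m y) b) z a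
        = g z (nabla Γ m z a) b + g z (m z) (Γ z a b) := by
      intro b
      rw [h.fderiv_metric hz dm (differentiableAt_const b)]
      simp [nabla]
    have f2 : fderiv ℝ (fun y => g y b c) z a = g z (Γ z a b) c + g z b (Γ z a c) := by
      rw [h.fderiv_metric hz (differentiableAt_const b) (differentiableAt_const c)]
      simp [nabla]
    simp [f1, f2, hMa]
  have hna : ∀ a, fderiv ℝ m z a = nabla Γ m z a - Γ z a (m z) := fun a => by simp [nabla]
  have c1 := hclosed z hz v u
  simp only [curv, hd, hna, hΓ z hz, map_add, map_sub, map_smul, smul_eq_mul,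
    h.torsion_free z hz v u, c1, h.metric_symm z hz v u, h.metric_symm z hz u (m z),
    h.metric_symm z hz v (m z)]
  rw [h.metric_symm z hz v (Γ z u w), h.metric_symm z hz u (Γ z v w)]
  module

/-- The Hessian `(u, v) ↦ g(∇_u N, v)` of a function with gradient `N` is symmetric. -/
lemma IsLeviCivitaOn.hessian_symm {W : E → ℝ} {N : E → E} (h : IsLeviCivitaOn g Γ V)
    (hW : ContDiffOn ℝ ∞ W V) (hNs : ContDiffOn ℝ ∞ N V)
    (hN : ∀ z ∈ V, ∀ u, g z (N z) u = fderiv ℝ W z u) {z : E} (hz : z ∈ V) (u v : E) :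
    g z (nabla Γ N z u) v = g z (nabla Γ N z v) u := by
  have key : ∀ a b, fderiv ℝ (fun y => fderiv ℝ W y b) z a =
      g z (nabla Γ N z a) b + g z (N z) (Γ z a b) := by
    intro a b
    have e : (fun y => fderiv ℝ W y b) =ᶠ[nhds z] fun y => g y (N y) b := by
      filter_upwards [h.isOpen.mem_nhds hz] with y hy using (hN y hy b).symm
    rw [e.fderiv_eq, h.fderiv_metric hz (h.differentiableAt_of_mem hNs hz)
      (differentiableAt_const b)]
    simp [nabla]
  have := fderiv_fderiv_symm h.isOpen hW hz u v
  rw [key, key, h.torsion_free z hz v u] at this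
  linarith

variable [FiniteDimensional ℝ E]

/-- Contract `curv_eq_of_conformal`. The coefficients `2` are `n - 2` with `n = 4`. -/
lemma IsLeviCivitaOn.ric_eq_of_conformal {g' : E → E →L[ℝ] E →L[ℝ] ℝ}
    {Γ' : E → E →L[ℝ] E →L[ℝ] E} {m : E → E} (hE : Module.finrank ℝ E = 4)
    (h : IsLeviCivitaOn g Γ V) (h' : IsLeviCivitaOn g' Γ' V) (hms : ContDiffOn ℝ ∞ m V)
    (hΓ : ∀ z ∈ V, ∀ u v,
      Γ' z u v = Γ z u v - g z (m z) u • v - g z (m z) v • u + g z u v • m z)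
    (hclosed : ∀ z ∈ V, ∀ u v, g z (nabla Γ m z u) v = g z (nabla Γ m z v) u)
    {z : E} (hz : z ∈ V) (w v : E) :
    ric Γ' z w v = ric Γ z w v + 2 * g z (nabla Γ m z v) w
      + g z w v * LinearMap.trace ℝ E (nablaLin Γ m z)
      + 2 * g z (m z) w * g z (m z) v - 2 * g z w v * g z (m z) (m z) := by
  -- Beyond `curvLin Γ`, only multiples of the identity, multiples of `∇m` and rank-one maps occur,
  -- and each of their traces is explicit.
  have key : curvLin Γ' z v w = curvLin Γ z v w
      - (((g z).flip w : E →ₗ[ℝ] ℝ) ∘ₗ nablaLin Γ m z).smulRight v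
      + g z v w • nablaLin Γ m z
      + (g z (nabla Γ m z v) w + g z (m z) v * g z (m z) w - g z v w * g z (m z) (m z)) •
        LinearMap.id
      - ((g z).flip w : E →ₗ[ℝ] ℝ).smulRight
          (nabla Γ m z v + g z (m z) v • m z - g z (m z) (m z) • v)
      + (g z (m z) : E →ₗ[ℝ] ℝ).smulRight (g z v w • m z - g z (m z) w • v) := by
    ext u
    have := h.curv_eq_of_conformal h' hms hΓ hclosed hz u v w
    simp only [curvLin_apply, this, LinearMap.add_apply,
      LinearMap.sub_apply, LinearMap.smul_apply, LinearMap.smulRight_apply, LinearMap.comp_apply,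
      LinearMap.id_apply, ContinuousLinearMap.coe_coe, ContinuousLinearMap.flip_apply,
      nablaLin_apply]
    module
  rw [ric, key]
  simp only [map_add, map_sub, map_smul, LinearMap.trace_smulRight, LinearMap.comp_apply,
    LinearMap.trace_id, hE, smul_eq_mul, ContinuousLinearMap.coe_coe,
    ContinuousLinearMap.flip_apply, nablaLin_apply]
  rw [h.metric_symm z hz w v, ric]
  push_cast
  ring

/-- The Schouten tensor of a metric conformal to a Ricci flat one. -/
lemma IsLeviCivitaOn.schouten_of_conformal_ricciFlat {g' : E → E →L[ℝ] E →L[ℝ] ℝ}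
    {Γ' : E → E →L[ℝ] E →L[ℝ] E} {W : E → ℝ} {N : E → E} (hE : Module.finrank ℝ E = 4)
    (h : IsLeviCivitaOn g Γ V) (h' : IsLeviCivitaOn g' Γ' V)
    (hW : ContDiffOn ℝ ∞ W V) (hW0 : ∀ z ∈ V, W z ≠ 0)
    (hconf : ∀ z ∈ V, g z = W z ^ 2 • g' z) (hNs : ContDiffOn ℝ ∞ N V)
    (hN : ∀ z ∈ V, ∀ u, g z (N z) u = fderiv ℝ W z u) {z : E} (hz : z ∈ V)
    (hric : ∀ w v, ric Γ' z w v = 0) {r : E →ₗ[ℝ] E} (hr : ∀ u v, g z (r u) v = ric Γ z u v)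
    (w v : E) :
    W z * (ric Γ z w v - 1 / 6 * LinearMap.trace ℝ E r * g z w v) =
      g z (N z) (N z) / W z * g z w v - 2 * g z (nabla Γ N z w) v := by
  have hinv : ContDiffOn ℝ ∞ (fun y => (W y)⁻¹) V := hW.inv hW0
  have hms : ContDiffOn ℝ ∞ (fun y => (W y)⁻¹ • N y) V := hinv.smul hNs
  have dW := fun {y} (hy : y ∈ V) => h.differentiableAt_of_mem hW hy
  have dN := fun {y} (hy : y ∈ V) => h.differentiableAt_of_mem hNs hy
  have hnm : ∀ y ∈ V, ∀ u, nabla Γ (fun y => (W y)⁻¹ • N y) y u =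
      (W y)⁻¹ • nabla Γ N y u - ((W y)⁻¹ ^ 2 * fderiv ℝ W y u) • N y := by
    intro y hy u
    have h1 := (((hasDerivAt_inv (hW0 y hy)).comp_hasFDerivAt y (dW hy).hasFDerivAt).smul
      (dN hy).hasFDerivAt).fderiv
    have h2 : fderiv ℝ (fun y => (W y)⁻¹ • N y) y = _ := h1
    rw [nabla, h2]
    simp [nabla]
    module
  have hclosed : ∀ z ∈ V, ∀ u v, g z (nabla Γ (fun y => (W y)⁻¹ • N y) z u) v
      = g z (nabla Γ (fun y => (W y)⁻¹ • N y) z v) u := by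
    intro y hy u v
    simp only [hnm y hy, map_sub, map_smul, sub_apply, smul_apply, smul_eq_mul,
      hN y hy, h.hessian_symm hW hNs hN hy u v]
    ring
  have hΓ := fun y (hy : y ∈ V) => h.connection_eq_of_conformal h' (m := fun y => (W y)⁻¹ • N y)
    hW hW0 hconf (fun y hy u => by simp [hN y hy, hW0 y hy]) hy
  have key := fun w v => h.ric_eq_of_conformal hE h' hms hΓ hclosed hz w v
  have hw := hW0 z hz
  have htr : LinearMap.trace ℝ E (nablaLin Γ (fun y => (W y)⁻¹ • N y) z) =
      (W z)⁻¹ * LinearMap.trace ℝ E (nablaLin Γ N z) - (W z)⁻¹ ^ 2 * g z (N z) (N z) := by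
    have : nablaLin Γ (fun y => (W y)⁻¹ • N y) z = (W z)⁻¹ • nablaLin Γ N z
        - (W z)⁻¹ ^ 2 • (g z (N z) : E →ₗ[ℝ] ℝ).smulRight (N z) := by
      ext u
      simp [hnm z hz, hN z hz, smul_smul]
    rw [this]
    simp [LinearMap.trace_smulRight]
  simp only [hric, htr, hnm z hz, map_sub, map_smul, sub_apply, smul_apply, smul_eq_mul,
    ← hN z hz] at key
  -- Setting `Ric' = 0` in the transformation law and raising an index solves for the Ricci
  -- endomorphism; its trace is the scalar curvature, which the Schouten tensor also needs.
  have hrl : r = -(2 * (W z)⁻¹) • nablaLin Γ N z - ((W z)⁻¹ * LinearMap.trace ℝ E (nablaLin Γ N z)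
      - 3 * (W z)⁻¹ ^ 2 * g z (N z) (N z)) • LinearMap.id := by
    ext u
    refine h.ext_metric hz fun v => ?_
    rw [hr]
    simp only [LinearMap.sub_apply, LinearMap.smul_apply, nablaLin_apply, LinearMap.id_apply,
      map_sub, map_smul, sub_apply, smul_apply, smul_eq_mul]
    rw [h.hessian_symm hW hNs hN hz u v]
    linear_combination -(key u v)
  have htrr : LinearMap.trace ℝ E r = -6 * (W z)⁻¹ * LinearMap.trace ℝ E (nablaLin Γ N z)
      + 12 * (W z)⁻¹ ^ 2 * g z (N z) (N z) := by
    rw [hrl]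
    simp only [map_sub, map_smul, LinearMap.trace_id, hE, smul_eq_mul]
    push_cast
    ring
  rw [htrr, h.hessian_symm hW hNs hN hz w v]
  have k := key w v
  field_simp
  field_simp at k
  linear_combination -6 * k

end VectorSpace

section VectorSpace

variable {E : Type*} [NormedAddCommGroup E] [NormedSpace ℝ E]
  {g : E → E →L[ℝ] E →L[ℝ] ℝ} {Γ : E → E →L[ℝ] E →L[ℝ] E} {V : Set E}

/-! ### The conformal vacuum equation -/

/-- The equation `W S = f g - 2 Hess W`, `W f = |dW|²`, where `N` is the gradient of `W`. -/
structure IsConformalVacuumOn (g : E → E →L[ℝ] E →L[ℝ] ℝ) (Γ : E → E →L[ℝ] E →L[ℝ] E)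
    (W f : E → ℝ) (N : E → E) (S : E → E →L[ℝ] E →L[ℝ] ℝ) (V : Set E) : Prop where
  levi_civita : IsLeviCivitaOn g Γ V
  smooth_factor : ContDiffOn ℝ ∞ W V
  smooth_potential : ContDiffOn ℝ ∞ f V
  smooth_gradient : ContDiffOn ℝ ∞ N V
  smooth_schouten : ContDiffOn ℝ ∞ S V
  factor_ne_zero : ∀ z ∈ V, W z ≠ 0
  gradient_eq : ∀ z ∈ V, ∀ u, g z (N z) u = fderiv ℝ W z u
  potential_eq : ∀ z ∈ V, W z * f z = g z (N z) (N z)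
  schouten_eq : ∀ z ∈ V, ∀ u v, W z * S z u v = f z * g z u v - 2 * g z (nabla Γ N z u) v

namespace IsConformalVacuumOn

variable {W f : E → ℝ} {N : E → E} {S : E → E →L[ℝ] E →L[ℝ] ℝ}

lemma schouten_symm (H : IsConformalVacuumOn g Γ W f N S V) {z : E} (hz : z ∈ V) (u v : E) :
    S z u v = S z v u := by
  have h := H.levi_civita
  refine mul_left_cancel₀ (H.factor_ne_zero z hz) ?_
  rw [H.schouten_eq z hz, H.schouten_eq z hz, h.metric_symm z hz u v,
    h.hessian_symm H.smooth_factor H.smooth_gradient H.gradient_eq hz u v]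

/-- Differentiating `W f = |N|²` gives `W df + f dW = 2 Hess W(·,N)`, and the right side is `f dW -
W S(·,N)`. Cancel `f dW` and divide by `W`. -/
lemma fderiv_potential (H : IsConformalVacuumOn g Γ W f N S V) {z : E} (hz : z ∈ V) (u : E) :
    fderiv ℝ f z u = -S z (N z) u := by
  have h := H.levi_civita
  have dN := h.differentiableAt_of_mem H.smooth_gradient hz
  have df := h.differentiableAt_of_mem H.smooth_potential hz
  have dW := h.differentiableAt_of_mem H.smooth_factor hz
  have e : (fun y => W y * f y) =ᶠ[nhds z] fun y => g y (N y) (N y) := by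
    filter_upwards [h.isOpen.mem_nhds hz] with y hy using H.potential_eq y hy
  have h1 : fderiv ℝ (fun y => W y * f y) z u = W z * fderiv ℝ f z u + f z * fderiv ℝ W z u := by
    have := (dW.hasFDerivAt.mul df.hasFDerivAt).fderiv
    change fderiv ℝ (W * f) z u = _
    rw [this]; simp
  rw [e.fderiv_eq, h.fderiv_metric hz dN dN, h.metric_symm z hz (N z)] at h1
  have h2 := H.schouten_eq z hz u (N z)
  rw [h.metric_symm z hz u, H.gradient_eq z hz] at h2
  refine mul_left_cancel₀ (H.factor_ne_zero z hz) ?_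
  rw [H.schouten_symm hz]
  linarith

/-- With an index raised, `2 ∇N = f · id - W s`, where `s` is the endomorphism of `S`. So `∇N`
commutes with `s`, and both are self-adjoint. -/
lemma schouten_nabla (H : IsConformalVacuumOn g Γ W f N S V) [FiniteDimensional ℝ E] {z : E}
    (hz : z ∈ V) (u v : E) :
    S z (nabla Γ N z u) v = S z (nabla Γ N z v) u := by
  have h := H.levi_civita
  obtain ⟨s, hs⟩ := h.exists_sharp hz
    { toFun := fun u => (S z u : E →ₗ[ℝ] ℝ)
      map_add' := fun a b => by ext; simp
      map_smul' := fun a b => by ext; simp }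
  replace hs : ∀ u v, g z (s u) v = S z u v := hs
  have e : ∀ u, (2 : ℝ) • nabla Γ N z u = f z • u - W z • s u := fun u => by
    refine h.ext_metric hz fun v => ?_
    have := H.schouten_eq z hz u v
    simp only [map_sub, map_smul, sub_apply, smul_apply, smul_eq_mul, hs]
    linarith
  have k : ∀ u v, 2 * S z (nabla Γ N z u) v = f z * S z u v - W z * g z (s u) (s v) := by
    intro u v
    have : (2 : ℝ) * S z (nabla Γ N z u) v = S z ((2 : ℝ) • nabla Γ N z u) v := by simp
    rw [this, e, H.schouten_symm hz]
    simp only [map_sub, map_smul, smul_eq_mul]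
    rw [H.schouten_symm hz v u, ← hs v, h.metric_symm z hz]
  have := k u v
  rw [H.schouten_symm hz u, h.metric_symm z hz (s u), ← k v u] at this
  linarith

/-- The Cotton tensor annihilates the gradient of the conformal factor. -/
lemma cotton_gradient (H : IsConformalVacuumOn g Γ W f N S V) [FiniteDimensional ℝ E] {z : E}
    (hz : z ∈ V) (u v : E) : cotton Γ S z u v (N z) = 0 := by
  have h := H.levi_civita
  have dN := h.differentiableAt_of_mem H.smooth_gradient hz
  have dS := h.differentiableAt_of_mem H.smooth_schouten hz
  have key : ∀ a b, fderiv ℝ (fun y => fderiv ℝ f y b) z a =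
      -(fderiv ℝ S z a b (N z) + S z b (fderiv ℝ N z a)) := by
    intro a b
    have e : (fun y => fderiv ℝ f y b) =ᶠ[nhds z] fun y => -S y b (N y) := by
      filter_upwards [h.isOpen.mem_nhds hz] with y hy
      rw [H.fderiv_potential hy, H.schouten_symm hy]
    rw [e.fderiv_eq, fderiv_fun_neg, neg_apply,
      fderiv_bilin dS (differentiableAt_const b) dN]
    simp
  -- The curl of `df = -S(N,·)` vanishes. It consists of the Cotton term and of an antisymmetrised
  -- `S(·,∇N)`, which is zero by `schouten_nabla`.
  have h1 := fderiv_fderiv_symm h.isOpen H.smooth_potential hz u v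
  rw [key, key] at h1
  have h2 := H.schouten_nabla hz u v
  simp only [nabla, map_add, add_apply] at h2
  rw [H.schouten_symm hz _ v, H.schouten_symm hz _ v, H.schouten_symm hz _ u,
    H.schouten_symm hz _ u] at h2
  simp only [cotton, nablaForm, h.torsion_free z hz v u]
  linarith

/-- The Ricci identity, combined with the conformal vacuum equation. -/
lemma curv_gradient (H : IsConformalVacuumOn g Γ W f N S V) {z : E} (hz : z ∈ V) (u v w : E) :
    2 * g z (curv Γ z u v (N z)) w = fderiv ℝ f z u * g z v w - fderiv ℝ f z v * g z u w
      - fderiv ℝ W z u * S z v w + fderiv ℝ W z v * S z u w - W z * cotton Γ S z u v w := by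
  have h := H.levi_civita
  have dN := h.differentiableAt_of_mem H.smooth_gradient hz
  have dS := h.differentiableAt_of_mem H.smooth_schouten hz
  have df := h.differentiableAt_of_mem H.smooth_potential hz
  have dW := h.differentiableAt_of_mem H.smooth_factor hz
  have dΓ := h.differentiableAt_of_mem h.smooth_connection hz
  have dg := h.differentiableAt_of_mem h.smooth_metric hz
  have cN : ContDiffAt ℝ ∞ N z := H.smooth_gradient.contDiffAt (h.isOpen.mem_nhds hz)
  have dDN : DifferentiableAt ℝ (fderiv ℝ N) z :=
    (cN.fderiv_right (m := ∞) (by simp)).differentiableAt (by simp)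
  have hsymm : fderiv ℝ (fderiv ℝ N) z u v = fderiv ℝ (fderiv ℝ N) z v u :=
    cN.isSymmSndFDerivAt
      (by simpa using (by exact_mod_cast le_top : ((2 : ℕ∞) : WithTop ℕ∞) ≤ ∞)) u v
  have dna : ∀ b, DifferentiableAt ℝ (fun y => nabla Γ N y b) z := fun b =>
    (dDN.clm_apply (differentiableAt_const b)).add
      (differentiableAt_bilin dΓ (differentiableAt_const b) dN)
  have hna : ∀ a b, fderiv ℝ (fun y => nabla Γ N y b) z a = fderiv ℝ (fderiv ℝ N) z a b
      + fderiv ℝ Γ z a b (N z) + Γ z b (fderiv ℝ N z a) := by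
    intro a b
    have e : (fun y => nabla Γ N y b) = (fun y => fderiv ℝ N y b) + fun y => Γ y b (N y) := rfl
    rw [e, fderiv_add (dDN.clm_apply (differentiableAt_const b))
      (differentiableAt_bilin dΓ (differentiableAt_const b) dN)]
    rw [add_apply, fderiv_clm_apply dDN (differentiableAt_const b),
      fderiv_bilin dΓ (differentiableAt_const b) dN]
    simp [add_assoc]
  -- The equation `2 g(∇_b N, w) = f g(b,w) - W S(b,w)` is differentiated in the direction `a`, with
  -- `b` and `w` constant.
  have key : ∀ a b, 2 * (g z (fderiv ℝ (fun y => nabla Γ N y b) z a + Γ z a (nabla Γ N z b)) w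
        + g z (nabla Γ N z b) (Γ z a w)) =
      fderiv ℝ f z a * g z b w + f z * (g z (Γ z a b) w + g z b (Γ z a w))
      - (fderiv ℝ W z a * S z b w + W z * fderiv ℝ S z a b w) := by
    intro a b
    have e : (fun y => 2 * g y (nabla Γ N y b) w) =ᶠ[nhds z]
        fun y => f y * g y b w - W y * S y b w := by
      filter_upwards [h.isOpen.mem_nhds hz] with y hy
      linarith [H.schouten_eq y hy b w]
    have h1 := congrArg (fun L : E →L[ℝ] ℝ => L a) e.fderiv_eq
    have dgb : DifferentiableAt ℝ (fun y => g y b w) z :=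
      differentiableAt_bilin dg (differentiableAt_const b) (differentiableAt_const w)
    have dSb : DifferentiableAt ℝ (fun y => S y b w) z :=
      differentiableAt_bilin dS (differentiableAt_const b) (differentiableAt_const w)
    have dgn : DifferentiableAt ℝ (fun y => g y (nabla Γ N y b) w) z :=
      differentiableAt_bilin dg (dna b) (differentiableAt_const w)
    rw [fderiv_const_mul dgn, fderiv_fun_sub (df.fun_mul dgb) (dW.fun_mul dSb),
      fderiv_fun_mul df dgb, fderiv_fun_mul dW dSb] at h1
    simp only [smul_apply, sub_apply, add_apply, smul_eq_mul] at h1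
    rw [h.fderiv_metric hz (dna b) (differentiableAt_const w),
      h.fderiv_metric hz (differentiableAt_const b) (differentiableAt_const w),
      fderiv_bilin dS (differentiableAt_const b) (differentiableAt_const w)] at h1
    simp only [nabla, fderiv_fun_const, Pi.zero_apply, zero_apply, zero_add, map_zero,
      add_zero] at h1 ⊢
    linarith
  have k1 := key u v
  have k2 := key v u
  have s1 := H.schouten_eq z hz v (Γ z u w)
  have s2 := H.schouten_eq z hz u (Γ z v w)
  -- This is the Ricci identity for constant `u` and `v`; the second derivatives of `N` cancel by
  -- symmetry.
  have hc : curv Γ z u v (N z) = (fderiv ℝ (fun y => nabla Γ N y v) z u + Γ z u (nabla Γ N z v))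
      - (fderiv ℝ (fun y => nabla Γ N y u) z v + Γ z v (nabla Γ N z u)) := by
    rw [hna, hna, hsymm]
    simp only [curv, nabla, map_add]
    abel
  rw [hc]
  simp only [map_sub, sub_apply, cotton, nablaForm, h.torsion_free z hz v u] at *
  linear_combination k1 - k2 - s1 + s2

/-- The trace of the Cotton tensor vanishes. -/
lemma trace_cotton (H : IsConformalVacuumOn g Γ W f N S V) [FiniteDimensional ℝ E]
    (hE : Module.finrank ℝ E = 4) {z : E} (hz : z ∈ V)
    {s : E →ₗ[ℝ] E} (hs : ∀ u v, g z (s u) v = S z u v)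
    (hric : ∀ w v, ric Γ z w v = S z w v + 1 / 2 * LinearMap.trace ℝ E s * g z w v) (v : E)
    {T : E →ₗ[ℝ] E} (hT : ∀ u w, g z (T u) w = cotton Γ S z u v w) :
    LinearMap.trace ℝ E T = 0 := by
  have h := H.levi_civita
  have key : (2 : ℝ) • curvLin Γ z v (N z) = (fderiv ℝ f z : E →ₗ[ℝ] ℝ).smulRight v
      - fderiv ℝ f z v • LinearMap.id - (fderiv ℝ W z : E →ₗ[ℝ] ℝ).smulRight (s v)
      + fderiv ℝ W z v • s - W z • T := by
    ext u
    refine h.ext_metric hz fun w => ?_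
    simp only [LinearMap.add_apply, LinearMap.sub_apply, LinearMap.smul_apply, curvLin_apply,
      LinearMap.smulRight_apply, LinearMap.id_apply, ContinuousLinearMap.coe_coe, map_sub, map_add,
      map_smul, sub_apply, add_apply, smul_apply, smul_eq_mul, hs, hT]
    exact H.curv_gradient hz u v w
  -- The left side contracts to `2 Ric(N,v) = 2 S(N,v) + tr(s) g(N,v)`. On the right, `df(v) - 4
  -- df(v) = 3 S(N,v)`, the term `dW(s v)` removes one `S(N,v)`, and only `W tr T` is left over.
  have k := congrArg (LinearMap.trace ℝ E) key
  simp only [map_add, map_sub, map_smul, LinearMap.trace_smulRight, LinearMap.trace_id, hE,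
    smul_eq_mul, ContinuousLinearMap.coe_coe] at k
  have hr := hric (N z) v
  rw [ric] at hr
  rw [hr, ← H.gradient_eq z hz (s v), h.metric_symm z hz (N z) (s v), hs,
    H.fderiv_potential hz, ← H.gradient_eq z hz v, H.schouten_symm hz v] at k
  refine (mul_eq_zero.1 (?_ : W z * _ = 0)).resolve_left (H.factor_ne_zero z hz)
  push_cast at k
  linarith

end IsConformalVacuumOn

end VectorSpace

/-! ### Index-free form of the coordinate expressions -/

section Coordinates

variable {n : ℕ}

/-- The `i`-th coordinate vector. -/
abbrev cvec (i : Fin n) : Coord n := EuclideanSpace.single i 1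

lemma sum_smul_cvec (u : Coord n) : ∑ i, u i • cvec i = u := by
  simpa using (EuclideanSpace.basisFun (Fin n) ℝ).sum_repr u

/-- The bilinear form with components `A`. -/
def bilinForm (A : Fin n → Fin n → ℝ) : Coord n →L[ℝ] Coord n →L[ℝ] ℝ :=
  ∑ i, ∑ j, A i j •
    (EuclideanSpace.proj i : Coord n →L[ℝ] ℝ).smulRight (EuclideanSpace.proj j : Coord n →L[ℝ] ℝ)

/-- The vector-valued bilinear map with components `C`. -/
def bilinVec (C : Fin n → Fin n → Fin n → ℝ) : Coord n →L[ℝ] Coord n →L[ℝ] Coord n :=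
  ∑ k, ∑ i, ∑ j, C k i j • (EuclideanSpace.proj i : Coord n →L[ℝ] ℝ).smulRight
    ((EuclideanSpace.proj j : Coord n →L[ℝ] ℝ).smulRight (cvec k))

lemma bilinForm_apply (A : Fin n → Fin n → ℝ) (u v : Coord n) :
    bilinForm A u v = ∑ i, ∑ j, A i j * (u i * v j) := by
  simp [bilinForm]

@[simp] lemma bilinForm_cvec (A : Fin n → Fin n → ℝ) (i j : Fin n) :
    bilinForm A (cvec i) (cvec j) = A i j := by
  simp [bilinForm_apply]

lemma bilinVec_apply (C : Fin n → Fin n → Fin n → ℝ) (u v : Coord n) (k : Fin n) :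
    bilinVec C u v k = ∑ i, ∑ j, C k i j * (u i * v j) := by
  simp only [bilinVec, sum_apply, smul_apply,
    ContinuousLinearMap.smulRight_apply, PiLp.proj_apply, WithLp.ofLp_sum, Finset.sum_apply,
    WithLp.ofLp_smul, Pi.smul_apply, smul_eq_mul]
  rw [Finset.sum_eq_single k (by intro b _ hb; simp [hb.symm]) (by simp)]
  simp

@[simp] lemma bilinVec_cvec (C : Fin n → Fin n → Fin n → ℝ) (i j k : Fin n) :
    bilinVec C (cvec i) (cvec j) k = C k i j := by
  simp [bilinVec_apply]

lemma bilin_eq_sum (B : Coord n →L[ℝ] Coord n →L[ℝ] ℝ) (u v : Coord n) :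
    B u v = ∑ i, ∑ j, B (cvec i) (cvec j) * (u i * v j) := by
  conv_lhs => rw [← sum_smul_cvec u, ← sum_smul_cvec v]
  simp only [map_sum, map_smul, sum_apply, smul_apply, smul_eq_mul,
    Finset.mul_sum]
  rw [Finset.sum_comm]
  exact Finset.sum_congr rfl fun i _ => Finset.sum_congr rfl fun j _ => by ring

lemma bilin_ext {B C : Coord n →L[ℝ] Coord n →L[ℝ] ℝ}
    (h : ∀ i j, B (cvec i) (cvec j) = C (cvec i) (cvec j)) : B = C := by
  ext u v
  rw [bilin_eq_sum B, bilin_eq_sum C]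
  simp only [h]

lemma trace_eq_sum (T : Coord n →ₗ[ℝ] Coord n) :
    LinearMap.trace ℝ (Coord n) T = ∑ i, T (cvec i) i := by
  rw [LinearMap.trace_eq_matrix_trace ℝ (EuclideanSpace.basisFun (Fin n) ℝ).toBasis, Matrix.trace]
  refine Finset.sum_congr rfl fun i _ => ?_
  simp [LinearMap.toMatrix_apply]

/-! ### Smoothness of expressions built from components -/

section Smooth

variable {F : Type*} [NormedAddCommGroup F] [NormedSpace ℝ F] {V : Set F} {m : WithTop ℕ∞}

lemma contDiffOn_smul_const {H : Type*} [NormedAddCommGroup H] [NormedSpace ℝ H] {f : F → ℝ}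
    (hf : ContDiffOn ℝ m f V) (c : H) : ContDiffOn ℝ m (fun z => f z • c) V :=
  hf.smul contDiffOn_const

lemma contDiffOn_bilinForm {A : F → Fin n → Fin n → ℝ}
    (h : ∀ i j, ContDiffOn ℝ m (fun z => A z i j) V) :
    ContDiffOn ℝ m (fun z => bilinForm (A z)) V := by
  unfold bilinForm
  exact ContDiffOn.sum fun i _ => ContDiffOn.sum fun j _ => contDiffOn_smul_const (h i j) _

lemma contDiffOn_bilinVec {C : F → Fin n → Fin n → Fin n → ℝ}
    (h : ∀ k i j, ContDiffOn ℝ m (fun z => C z k i j) V) :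
    ContDiffOn ℝ m (fun z => bilinVec (C z)) V := by
  unfold bilinVec
  exact ContDiffOn.sum fun k _ => ContDiffOn.sum fun i _ => ContDiffOn.sum fun j _ =>
    contDiffOn_smul_const (h k i j) _

lemma contDiffOn_det {A : F → Matrix (Fin n) (Fin n) ℝ}
    (h : ∀ i j, ContDiffOn ℝ m (fun z => A z i j) V) : ContDiffOn ℝ m (fun z => (A z).det) V := by
  simp only [Matrix.det_apply']
  exact ContDiffOn.sum fun σ _ => contDiffOn_const.mul (contDiffOn_prod fun i _ => h _ _)

lemma contDiffOn_inv {A : F → Matrix (Fin n) (Fin n) ℝ}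
    (h : ∀ i j, ContDiffOn ℝ m (fun z => A z i j) V) (hA : ∀ z ∈ V, IsUnit (A z).det)
    (i j : Fin n) : ContDiffOn ℝ m (fun z => (A z)⁻¹ i j) V := by
  -- By Cramer's rule, smoothness of the inverse reduces to that of determinants.
  have e : ∀ z, (A z)⁻¹ i j = (A z).det⁻¹ * ((A z).updateRow j (Pi.single i 1)).det := fun z => by
    rw [Matrix.inv_def, Matrix.smul_apply, Matrix.adjugate_apply, Ring.inverse_eq_inv', smul_eq_mul]
  simp only [e]
  refine ((contDiffOn_det h).inv fun z hz => (hA z hz).ne_zero).mul (contDiffOn_det fun a b => ?_)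
  simp only [Matrix.updateRow_apply]
  split_ifs
  · exact contDiffOn_const
  · exact h a b

end Smooth

lemma contDiffOn_pd {f : Coord n → ℝ} {V : Set (Coord n)} (hV : IsOpen V)
    (hf : ContDiffOn ℝ ∞ f V) (i : Fin n) : ContDiffOn ℝ ∞ (pd i f) V :=
  (hf.fderiv_of_isOpen hV (by simp)).clm_apply contDiffOn_const

/-- `G` is the matrix of components of a smooth metric on the open set `V`. -/
structure IsMetricOn (G : Coord n → Matrix (Fin n) (Fin n) ℝ) (V : Set (Coord n)) : Prop where
  isOpen : IsOpen V
  smooth : ∀ i j, ContDiffOn ℝ ∞ (fun z => G z i j) V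
  symm : ∀ z ∈ V, ∀ i j, G z i j = G z j i
  isUnit_det : ∀ z ∈ V, IsUnit (G z).det

/-- The metric with components `G`. -/
def metricForm (G : Coord n → Matrix (Fin n) (Fin n) ℝ) (z : Coord n) :
    Coord n →L[ℝ] Coord n →L[ℝ] ℝ := bilinForm fun i j => G z i j

/-- The Levi-Civita connection with components the Christoffel symbols of `G`. -/
def connection (G : Coord n → Matrix (Fin n) (Fin n) ℝ) (z : Coord n) :
    Coord n →L[ℝ] Coord n →L[ℝ] Coord n := bilinVec (christoffel G z)

/-- The gradient as a vector of coordinate space. -/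
def gradVec (G : Coord n → Matrix (Fin n) (Fin n) ℝ) (f : Coord n → ℝ) (z : Coord n) : Coord n :=
  WithLp.toLp 2 (gradient G f z)

variable {G : Coord n → Matrix (Fin n) (Fin n) ℝ} {V : Set (Coord n)}

lemma christoffel_symm {y : Coord n} (hG : ∀ᶠ z in nhds y, ∀ i j, G z i j = G z j i)
    (k i j : Fin n) : christoffel G y k i j = christoffel G y k j i := by
  have : ∀ l a b, pd l (fun z => G z a b) y = pd l (fun z => G z b a) y := fun l a b => by
    have e : (fun z => G z a b) =ᶠ[nhds y] fun z => G z b a := by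
      filter_upwards [hG] with z hz using hz a b
    simp only [pd, e.fderiv_eq]
  simp only [christoffel]
  congr 1
  refine Finset.sum_congr rfl fun l _ => ?_
  rw [this l i j]
  ring

/-- Lowering the index cancels the inverse matrix and leaves the Christoffel symbols of the first
kind. Comparisons with Christoffel symbols below use this form, which contains no inverse. -/
lemma sum_mul_christoffel {y : Coord n} (hG : IsUnit (G y).det) (m i j : Fin n) :
    ∑ k, G y m k * christoffel G y k i j = (1 / 2) *
      (pd i (fun z => G z j m) y + pd j (fun z => G z i m) y - pd m (fun z => G z i j) y) := by
  have h1 : ∀ l, ∑ k, G y m k * (G y)⁻¹ k l = if m = l then 1 else 0 := fun l => by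
    rw [← Matrix.mul_apply, Matrix.mul_nonsing_inv _ hG, Matrix.one_apply]
  simp only [christoffel, Finset.mul_sum]
  rw [Finset.sum_comm]
  have : ∀ l, ∑ k, G y m k * (1 / 2 * ((G y)⁻¹ k l * (pd i (fun z => G z j l) y +
      pd j (fun z => G z i l) y - pd l (fun z => G z i j) y))) = (if m = l then 1 else 0) *
      (1 / 2 * (pd i (fun z => G z j l) y +
      pd j (fun z => G z i l) y - pd l (fun z => G z i j) y)) := fun l => by
    rw [← h1, Finset.sum_mul]
    exact Finset.sum_congr rfl fun k _ => by ring
  rw [Finset.sum_congr rfl fun l _ => this l]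
  simp

lemma metricForm_cvec_left (z : Coord n) (i : Fin n) (v : Coord n) :
    metricForm G z (cvec i) v = ∑ j, G z i j * v j := by
  rw [metricForm, bilinForm_apply, Finset.sum_eq_single i (by intro b _ hb; simp [hb])
    (by simp)]
  simp

lemma metricForm_cvec (z : Coord n) (i j : Fin n) :
    metricForm G z (cvec i) (cvec j) = G z i j := by simp [metricForm]

namespace IsMetricOn

lemma christoffel_smooth (h : IsMetricOn G V) (k i j : Fin n) :
    ContDiffOn ℝ ∞ (fun z => christoffel G z k i j) V := by
  unfold christoffel
  have hp := fun l a b => contDiffOn_pd h.isOpen (h.smooth a b) l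
  exact contDiffOn_const.mul (ContDiffOn.sum fun l _ =>
    (contDiffOn_inv h.smooth h.isUnit_det _ _).mul (((hp _ _ _).add (hp _ _ _)).sub (hp _ _ _)))

lemma metricForm_smooth (h : IsMetricOn G V) : ContDiffOn ℝ ∞ (metricForm G) V :=
  contDiffOn_bilinForm h.smooth

lemma connection_smooth (h : IsMetricOn G V) : ContDiffOn ℝ ∞ (connection G) V :=
  contDiffOn_bilinVec h.christoffel_smooth

lemma metricForm_symm (h : IsMetricOn G V) {z : Coord n} (hz : z ∈ V) (u v : Coord n) :
    metricForm G z u v = metricForm G z v u := by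
  have : metricForm G z = (metricForm G z).flip := bilin_ext fun i j => by
    simp only [ContinuousLinearMap.flip_apply, metricForm_cvec, h.symm z hz i j]
  conv_lhs => rw [this]
  rfl

lemma fderiv_metricForm (h : IsMetricOn G V) {z : Coord n} (hz : z ∈ V) (k i j : Fin n) :
    fderiv ℝ (metricForm G) z (cvec k) (cvec i) (cvec j) = pd k (fun z => G z i j) z := by
  obtain ⟨L, hL, hLa⟩ := hasFDerivAt_bilin_const
    ((h.metricForm_smooth.contDiffAt (h.isOpen.mem_nhds hz)).differentiableAt (by simp))
    (cvec i) (cvec j)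
  rw [← hLa, pd]
  simp only [metricForm_cvec] at hL
  rw [hL.fderiv]

lemma metricForm_connection (h : IsMetricOn G V) {z : Coord n} (hz : z ∈ V) (i j l : Fin n) :
    metricForm G z (connection G z (cvec i) (cvec j)) (cvec l) = (1 / 2) *
      (pd i (fun z => G z j l) z + pd j (fun z => G z i l) z - pd l (fun z => G z i j) z) := by
  rw [h.metricForm_symm hz, metricForm_cvec_left]
  simp only [connection, bilinVec_cvec]
  exact sum_mul_christoffel (h.isUnit_det z hz) l i j

/-- The Christoffel symbols define the Levi-Civita connection. -/
theorem isLeviCivitaOn (h : IsMetricOn G V) : IsLeviCivitaOn (metricForm G) (connection G) V where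
  isOpen := h.isOpen
  smooth_metric := h.metricForm_smooth
  smooth_connection := h.connection_smooth
  metric_symm z hz u v := h.metricForm_symm hz u v
  nondegenerate z hz u hu := by
    have h1 : (G z).mulVec u = 0 := by
      ext i
      have := hu (cvec i)
      rw [h.metricForm_symm hz, metricForm_cvec_left] at this
      simpa [Matrix.mulVec, dotProduct] using this
    have := Matrix.eq_zero_of_mulVec_eq_zero (h.isUnit_det z hz).ne_zero h1
    ext i
    exact congrFun this i
  torsion_free z hz u v := by
    have hs : ∀ᶠ y in nhds z, ∀ i j, G y i j = G y j i := by
      filter_upwards [h.isOpen.mem_nhds hz] with y hy using h.symm y hy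
    ext k
    rw [connection, bilinVec_apply, bilinVec_apply, Finset.sum_comm]
    refine Finset.sum_congr rfl fun i _ => Finset.sum_congr rfl fun j _ => ?_
    rw [christoffel_symm hs k i j]
    ring
  compatible z hz w u v := by
    -- Compatibility is linear in the direction `w`, so coordinate directions suffice; each case is
    -- an identity between symbols of the first kind.
    have key : ∀ k, fderiv ℝ (metricForm G) z (cvec k) =
        (metricForm G z).comp (connection G z (cvec k)) +
          ((metricForm G z).flip.comp (connection G z (cvec k))).flip := fun k => by
      refine bilin_ext fun i j => ?_
      simp only [add_apply, ContinuousLinearMap.comp_apply, ContinuousLinearMap.flip_apply]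
      rw [h.fderiv_metricForm hz, h.metricForm_symm hz (cvec i), h.metricForm_connection hz,
        h.metricForm_connection hz]
      have : ∀ l a b, pd l (fun z => G z a b) z = pd l (fun z => G z b a) z := fun l a b => by
        have e : (fun z => G z a b) =ᶠ[nhds z] fun z => G z b a := by
          filter_upwards [h.isOpen.mem_nhds hz] with y hy using h.symm y hy a b
        simp only [pd, e.fderiv_eq]
      rw [this k j i]
      ring
    conv_lhs => rw [← sum_smul_cvec w]
    conv_rhs => rw [← sum_smul_cvec w]
    simp only [map_sum, map_smul, sum_apply, smul_apply, smul_eq_mul, key,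
      add_apply, ContinuousLinearMap.comp_apply, ContinuousLinearMap.flip_apply,
      ← Finset.sum_add_distrib, mul_add]

lemma riemann_eq (h : IsMetricOn G V) {z : Coord n} (hz : z ∈ V) (σ ρ μ ν : Fin n) :
    riemann G z σ ρ μ ν = curv (connection G) z (cvec μ) (cvec ν) (cvec ρ) σ := by
  have hd : ∀ a b c d : Fin n, fderiv ℝ (connection G) z (cvec a) (cvec b) (cvec c) d =
      pd a (fun y => christoffel G y d b c) z := fun a b c d => by
    obtain ⟨L, hL, hLa⟩ := hasFDerivAt_bilin_const
      ((h.connection_smooth.contDiffAt (h.isOpen.mem_nhds hz)).differentiableAt (by simp))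
      (cvec b) (cvec c)
    have h1 := (EuclideanSpace.proj d : Coord n →L[ℝ] ℝ).hasFDerivAt.comp z hL
    have h2 : (fun y => christoffel G y d b c) =
        (EuclideanSpace.proj d : Coord n →L[ℝ] ℝ) ∘ fun y => connection G y (cvec b) (cvec c) := by
      ext y; simp [connection]
    rw [← hLa, pd, h2, h1.fderiv]
    simp
  have hc : ∀ a (x : Coord n) d, connection G z (cvec a) x d = ∑ τ, christoffel G z d a τ * x τ := by
    intro a x d
    rw [connection, bilinVec_apply, Finset.sum_eq_single a (by intro b _ hb; simp [hb]) (by simp)]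
    simp
  have hb : ∀ a b d, connection G z (cvec a) (cvec b) d = christoffel G z d a b := fun a b d => by
    simp [connection]
  simp only [riemann, curv, PiLp.add_apply, PiLp.sub_apply, hd, hc _ (connection G z _ _), hb,
    Finset.sum_sub_distrib]
  ring

lemma ricci_eq (h : IsMetricOn G V) {z : Coord n} (hz : z ∈ V) (μ ν : Fin n) :
    ricci G z μ ν = ric (connection G) z (cvec μ) (cvec ν) := by
  simp only [ricci, ric, trace_eq_sum, curvLin_apply, h.riemann_eq hz]

/-- The trace of an endomorphism, computed from the bilinear form obtained by lowering an index. -/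
lemma trace_eq (h : IsMetricOn G V) {z : Coord n} (hz : z ∈ V) (T : Coord n →ₗ[ℝ] Coord n) :
    LinearMap.trace ℝ (Coord n) T =
      ∑ i, ∑ j, (G z)⁻¹ i j * metricForm G z (T (cvec i)) (cvec j) := by
  rw [trace_eq_sum]
  refine Finset.sum_congr rfl fun i _ => ?_
  simp_rw [h.metricForm_symm hz _ (cvec _), metricForm_cvec_left, Finset.mul_sum]
  rw [Finset.sum_comm]
  have h1 : ∀ l, ∑ k, (G z)⁻¹ i k * G z k l = if i = l then 1 else 0 := fun l => by
    rw [← Matrix.mul_apply, Matrix.nonsing_inv_mul _ (h.isUnit_det z hz), Matrix.one_apply]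
  simp_rw [← mul_assoc, ← Finset.sum_mul, h1]
  simp

lemma metricForm_gradVec (h : IsMetricOn G V) {z : Coord n} (hz : z ∈ V) (f : Coord n → ℝ)
    (u : Coord n) : metricForm G z (gradVec G f z) u = fderiv ℝ f z u := by
  have h1 : ∀ i l, ∑ k, G z i k * (G z)⁻¹ k l = if i = l then 1 else 0 := fun i l => by
    rw [← Matrix.mul_apply, Matrix.mul_nonsing_inv _ (h.isUnit_det z hz), Matrix.one_apply]
  have key : ∀ i, metricForm G z (cvec i) (gradVec G f z) = fderiv ℝ f z (cvec i) := fun i => by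
    rw [metricForm_cvec_left]
    simp only [gradVec, gradient, Finset.mul_sum]
    rw [Finset.sum_comm]
    simp_rw [← mul_assoc, ← Finset.sum_mul, h1]
    simp [pd]
  rw [h.metricForm_symm hz, ← sum_smul_cvec u]
  simp only [map_sum, map_smul, sum_apply, smul_apply, key]

lemma gradVec_smooth (h : IsMetricOn G V) {f : Coord n → ℝ} (hf : ContDiffOn ℝ ∞ f V) :
    ContDiffOn ℝ ∞ (gradVec G f) V := by
  rw [contDiffOn_euclidean]
  intro i
  simp only [gradVec, gradient]
  exact ContDiffOn.sum fun j _ =>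
    (contDiffOn_inv h.smooth h.isUnit_det _ _).mul (contDiffOn_pd h.isOpen hf j)

lemma nabla_gradVec (h : IsMetricOn G V) {f : Coord n → ℝ} (hf : ContDiffOn ℝ ∞ f V)
    {z : Coord n} (hz : z ∈ V) (ν μ : Fin n) :
    nabla (connection G) (gradVec G f) z (cvec ν) μ = covDerivVec G (gradient G f) z ν μ := by
  have h0 := ((h.gradVec_smooth hf).contDiffAt (h.isOpen.mem_nhds hz)).differentiableAt (by simp)
  have h1 := (EuclideanSpace.proj μ : Coord n →L[ℝ] ℝ).hasFDerivAt.comp z h0.hasFDerivAt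
  have h2 : (fun y => gradient G f y μ) =
      (EuclideanSpace.proj μ : Coord n →L[ℝ] ℝ) ∘ gradVec G f := by
    ext y; simp [gradVec]
  rw [nabla, covDerivVec, pd, h2, h1.fderiv, connection, PiLp.add_apply, bilinVec_apply,
    Finset.sum_eq_single ν (by intro b _ hb; simp [hb]) (by simp)]
  simp [gradVec]

lemma riemann_smooth (h : IsMetricOn G V) (σ ρ μ ν : Fin n) :
    ContDiffOn ℝ ∞ (fun z => riemann G z σ ρ μ ν) V := by
  have hc := h.christoffel_smooth
  unfold riemann
  exact ((contDiffOn_pd h.isOpen (hc _ _ _) _).sub (contDiffOn_pd h.isOpen (hc _ _ _) _)).add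
    (ContDiffOn.sum fun τ _ => ((hc _ _ _).mul (hc _ _ _)).sub ((hc _ _ _).mul (hc _ _ _)))

lemma ricci_smooth (h : IsMetricOn G V) (μ ν : Fin n) :
    ContDiffOn ℝ ∞ (fun z => ricci G z μ ν) V :=
  ContDiffOn.sum fun _ _ => h.riemann_smooth _ _ _ _

lemma scalarCurvature_smooth (h : IsMetricOn G V) : ContDiffOn ℝ ∞ (scalarCurvature G) V :=
  ContDiffOn.sum fun _ _ => ContDiffOn.sum fun _ _ =>
    (contDiffOn_inv h.smooth h.isUnit_det _ _).mul (h.ricci_smooth _ _)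

end IsMetricOn

/-- The Schouten tensor as a bilinear form. -/
def schoutenForm (G : Coord 4 → Matrix (Fin 4) (Fin 4) ℝ) (z : Coord 4) :
    Coord 4 →L[ℝ] Coord 4 →L[ℝ] ℝ := bilinForm (schouten G z)

lemma IsMetricOn.schoutenForm_smooth {G : Coord 4 → Matrix (Fin 4) (Fin 4) ℝ}
    {V : Set (Coord 4)} (h : IsMetricOn G V) : ContDiffOn ℝ ∞ (schoutenForm G) V :=
  contDiffOn_bilinForm fun i j => (h.ricci_smooth i j).sub
    ((contDiffOn_const.mul h.scalarCurvature_smooth).mul (h.smooth i j))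

end Coordinates

/-! ### The conformal vacuum equation in coordinates -/

section Boundary

variable {G : Coord 4 → Matrix (Fin 4) (Fin 4) ℝ} {V B : Set (Coord 4)} {W : Coord 4 → ℝ}

lemma finrank_coord (n : ℕ) : Module.finrank ℝ (Coord n) = n := by simp

lemma IsMetricOn.exists_sharp {n : ℕ} {G : Coord n → Matrix (Fin n) (Fin n) ℝ} {V : Set (Coord n)}
    (h : IsMetricOn G V) {z : Coord n} (hz : z ∈ V)
    (β : Coord n →L[ℝ] Coord n →L[ℝ] ℝ) :
    ∃ T : Coord n →ₗ[ℝ] Coord n, ∀ u v, metricForm G z (T u) v = β u v :=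
  h.isLeviCivitaOn.exists_sharp hz
    { toFun := fun u => (β u : Coord n →ₗ[ℝ] ℝ)
      map_add' := fun a b => by ext; simp
      map_smul' := fun a b => by ext; simp }

/-- The Ricci tensor as a bilinear form. -/
def ricciForm {n : ℕ} (G : Coord n → Matrix (Fin n) (Fin n) ℝ) (z : Coord n) :
    Coord n →L[ℝ] Coord n →L[ℝ] ℝ := bilinForm (ricci G z)

lemma ric_add_left {n : ℕ} (Γ : Coord n → Coord n →L[ℝ] Coord n →L[ℝ] Coord n) (z a b v : Coord n) :
    ric Γ z (a + b) v = ric Γ z a v + ric Γ z b v := by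
  have : curvLin Γ z v (a + b) = curvLin Γ z v a + curvLin Γ z v b := by
    ext u; simp [curv]; ring
  rw [ric, this, map_add, ric, ric]

lemma ric_smul_left {n : ℕ} (Γ : Coord n → Coord n →L[ℝ] Coord n →L[ℝ] Coord n) (z : Coord n)
    (c : ℝ) (a v : Coord n) : ric Γ z (c • a) v = c * ric Γ z a v := by
  have : curvLin Γ z v (c • a) = c • curvLin Γ z v a := by
    ext u; simp [curv]; ring
  rw [ric, this, map_smul, ric, smul_eq_mul]

lemma ric_add_right {n : ℕ} (Γ : Coord n → Coord n →L[ℝ] Coord n →L[ℝ] Coord n) (z w a b : Coord n) :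
    ric Γ z w (a + b) = ric Γ z w a + ric Γ z w b := by
  have : curvLin Γ z (a + b) w = curvLin Γ z a w + curvLin Γ z b w := by
    ext u; simp [curv]; ring
  rw [ric, this, map_add, ric, ric]

lemma ric_smul_right {n : ℕ} (Γ : Coord n → Coord n →L[ℝ] Coord n →L[ℝ] Coord n) (z : Coord n)
    (c : ℝ) (w a : Coord n) : ric Γ z w (c • a) = c * ric Γ z w a := by
  have : curvLin Γ z (c • a) w = c • curvLin Γ z a w := by
    ext u; simp [curv]; ring
  rw [ric, this, map_smul, ric, smul_eq_mul]

lemma IsMetricOn.ricciForm_eq {n : ℕ} {G : Coord n → Matrix (Fin n) (Fin n) ℝ}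
    {V : Set (Coord n)} (h : IsMetricOn G V) {z : Coord n} (hz : z ∈ V) (u v : Coord n) :
    ricciForm G z u v = ric (connection G) z u v := by
  let L : Coord n →ₗ[ℝ] Coord n →ₗ[ℝ] ℝ := LinearMap.mk₂ ℝ (ric (connection G) z)
    (ric_add_left _ z) (ric_smul_left _ z) (ric_add_right _ z) (ric_smul_right _ z)
  change _ = L u v
  rw [ricciForm, bilinForm_apply]
  conv_rhs => rw [← sum_smul_cvec u, ← sum_smul_cvec v]
  simp only [map_sum, map_smul, LinearMap.sum_apply, LinearMap.smul_apply, smul_eq_mul,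
    Finset.mul_sum]
  rw [Finset.sum_comm]
  refine Finset.sum_congr rfl fun i _ => Finset.sum_congr rfl fun j _ => ?_
  rw [h.ricci_eq hz]
  simp only [L, LinearMap.mk₂_apply]
  ring

lemma schoutenForm_eq (z u v : Coord 4) :
    schoutenForm G z u v = ricciForm G z u v - 1 / 6 * scalarCurvature G z * metricForm G z u v := by
  have : schoutenForm G z = ricciForm G z - (1 / 6 * scalarCurvature G z) • metricForm G z :=
    bilin_ext fun i j => by
      simp [schoutenForm, ricciForm, metricForm, schouten]
  simp [this]

lemma IsMetricOn.trace_ricci {n : ℕ} {G : Coord n → Matrix (Fin n) (Fin n) ℝ}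
    {V : Set (Coord n)} (h : IsMetricOn G V) {z : Coord n} (hz : z ∈ V)
    {r : Coord n →ₗ[ℝ] Coord n} (hr : ∀ u v, metricForm G z (r u) v = ricciForm G z u v) :
    LinearMap.trace ℝ (Coord n) r = scalarCurvature G z := by
  rw [h.trace_eq hz]
  simp only [hr, ricciForm, bilinForm_cvec, scalarCurvature]

/-- In dimension four the trace of `Ric - (R/6) g` is `R/3`, so the term `R/6` removed from the
Ricci tensor is half of that trace. -/
lemma IsMetricOn.ric_eq_schouten (h : IsMetricOn G V) {z : Coord 4} (hz : z ∈ V)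
    {s : Coord 4 →ₗ[ℝ] Coord 4} (hs : ∀ u v, metricForm G z (s u) v = schoutenForm G z u v)
    (u v : Coord 4) : ric (connection G) z u v =
      schoutenForm G z u v + 1 / 2 * LinearMap.trace ℝ (Coord 4) s * metricForm G z u v := by
  obtain ⟨r, hr⟩ := h.exists_sharp hz (ricciForm G z)
  have e : s = r - (1 / 6 * scalarCurvature G z) • LinearMap.id := by
    ext1 u
    refine h.isLeviCivitaOn.ext_metric hz fun v => ?_
    simp [hs, hr, schoutenForm_eq]
  have ht : LinearMap.trace ℝ (Coord 4) s = 1 / 3 * scalarCurvature G z := by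
    rw [e, map_sub, map_smul, h.trace_ricci hz hr, LinearMap.trace_id, finrank_coord, smul_eq_mul]
    push_cast
    ring
  rw [ht, schoutenForm_eq, h.ricciForm_eq hz]
  ring

/-- Near `z`, the metric is `W²` times a metric which is Ricci flat at `z`. -/
def IsConformallyRicciFlatAt (G : Coord 4 → Matrix (Fin 4) (Fin 4) ℝ) (W : Coord 4 → ℝ)
    (z : Coord 4) : Prop :=
  ∃ (G' : Coord 4 → Matrix (Fin 4) (Fin 4) ℝ) (V' : Set (Coord 4)), z ∈ V' ∧ IsMetricOn G' V' ∧
    (∀ y ∈ V', G y = W y ^ 2 • G' y) ∧ ∀ μ ν, ricci G' z μ ν = 0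

/-- A zero of the factor would make the nondegenerate matrix `G z` vanish. -/
lemma IsMetricOn.factor_ne_zero (h : IsMetricOn G V) {G' : Coord 4 → Matrix (Fin 4) (Fin 4) ℝ}
    {z : Coord 4} (hz : z ∈ V) (hG : G z = W z ^ 2 • G' z) : W z ≠ 0 := by
  intro h0
  have := h.isUnit_det z hz
  rw [hG, h0] at this
  simp at this

/-- The conformal relation has to hold on a neighbourhood because it is differentiated, whereas
Ricci flatness is used at the point `z` only. -/
lemma IsMetricOn.schouten_eq (h : IsMetricOn G V) (hW : ContDiffOn ℝ ∞ W V) {z : Coord 4}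
    (hz : z ∈ V) (hflat : IsConformallyRicciFlatAt G W z) (u v : Coord 4) :
    W z * schoutenForm G z u v =
      metricForm G z (gradVec G W z) (gradVec G W z) / W z * metricForm G z u v
        - 2 * metricForm G z (nabla (connection G) (gradVec G W) z u) v := by
  obtain ⟨G', V', hzV', h', hconf, hric⟩ := hflat
  have hL := h.isLeviCivitaOn
  have hL' := h'.isLeviCivitaOn
  have hO : IsOpen (V ∩ V') := h.isOpen.inter h'.isOpen
  obtain ⟨r, hr⟩ := h.exists_sharp hz (ricciForm G z)
  have hc : ∀ y ∈ V ∩ V', metricForm G y = W y ^ 2 • metricForm G' y := fun y hy =>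
    bilin_ext fun i j => by simp [metricForm_cvec, hconf y hy.2]
  have := (hL.mono hO Set.inter_subset_left).schouten_of_conformal_ricciFlat (finrank_coord 4)
    (hL'.mono hO Set.inter_subset_right) (hW.mono Set.inter_subset_left)
    (fun y hy => h.factor_ne_zero hy.1 (hconf y hy.2)) hc
    ((h.gradVec_smooth hW).mono Set.inter_subset_left)
    (fun y hy => h.metricForm_gradVec hy.1 W) ⟨hz, hzV'⟩
    (fun w v => by
      rw [← h'.ricciForm_eq hzV', ricciForm, bilinForm_apply]
      simp [hric])
    (fun u v => (hr u v).trans (h.ricciForm_eq hz u v)) u v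
  rw [← this, schoutenForm_eq, h.trace_ricci hz hr, h.ricciForm_eq hz]

/-- The function `f` with `W S = f g - 2 Hess W`. -/
def potential (G : Coord 4 → Matrix (Fin 4) (Fin 4) ℝ) (W : Coord 4 → ℝ) (z : Coord 4) : ℝ :=
  1 / 4 * ∑ i, ∑ j, (G z)⁻¹ i j * (W z * schoutenForm G z (cvec i) (cvec j)
    + 2 * metricForm G z (nabla (connection G) (gradVec G W) z (cvec i)) (cvec j))

lemma IsMetricOn.nabla_smooth (h : IsMetricOn G V) (hW : ContDiffOn ℝ ∞ W V) (u : Coord 4) :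
    ContDiffOn ℝ ∞ (fun z => nabla (connection G) (gradVec G W) z u) V :=
  (((h.gradVec_smooth hW).fderiv_of_isOpen h.isOpen (by simp)).clm_apply contDiffOn_const).add
    ((h.connection_smooth.clm_apply contDiffOn_const).clm_apply (h.gradVec_smooth hW))

/-- The trace formula for the potential stays smooth across `W = 0`, which the quotient `|dW|² / W`
does not show. This is what lets the bulk identities be continued to the boundary. -/
lemma IsMetricOn.potential_smooth (h : IsMetricOn G V) (hW : ContDiffOn ℝ ∞ W V) :
    ContDiffOn ℝ ∞ (potential G W) V :=
  contDiffOn_const.mul <| ContDiffOn.sum fun _ _ => ContDiffOn.sum fun _ _ =>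
    (contDiffOn_inv h.smooth h.isUnit_det _ _).mul <|
      (hW.mul ((h.schoutenForm_smooth.clm_apply contDiffOn_const).clm_apply contDiffOn_const)).add
        (contDiffOn_const.mul ((h.metricForm_smooth.clm_apply (h.nabla_smooth hW _)).clm_apply
          contDiffOn_const))

/-- Trace of `schouten_eq`: the factor `1/4` compensates the trace of the identity. -/
lemma IsMetricOn.potential_eq (h : IsMetricOn G V) (hW : ContDiffOn ℝ ∞ W V) {z : Coord 4}
    (hz : z ∈ V) (hflat : IsConformallyRicciFlatAt G W z) :
    potential G W z = metricForm G z (gradVec G W z) (gradVec G W z) / W z := by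
  have h1 := h.trace_eq hz LinearMap.id
  rw [LinearMap.trace_id, finrank_coord] at h1
  simp only [potential, h.schouten_eq hW hz hflat, sub_add_cancel]
  simp only [LinearMap.id_apply] at h1
  simp_rw [mul_left_comm _ (_ / _), ← Finset.mul_sum, ← h1]
  push_cast
  ring

theorem IsMetricOn.isConformalVacuumOn (h : IsMetricOn G V) (hW : ContDiffOn ℝ ∞ W V)
    (hB : IsOpen B) (hBV : B ⊆ V) (hflat : ∀ z ∈ B, IsConformallyRicciFlatAt G W z) :
    IsConformalVacuumOn (metricForm G) (connection G) W (potential G W) (gradVec G W)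
      (schoutenForm G) B := by
  have h0 : ∀ z ∈ B, W z ≠ 0 := fun z hz => by
    obtain ⟨G', V', hzV', -, hconf, -⟩ := hflat z hz
    exact h.factor_ne_zero (hBV hz) (hconf z hzV')
  exact
  { levi_civita := h.isLeviCivitaOn.mono hB hBV
    smooth_factor := hW.mono hBV
    smooth_potential := (h.potential_smooth hW).mono hBV
    smooth_gradient := (h.gradVec_smooth hW).mono hBV
    smooth_schouten := h.schoutenForm_smooth.mono hBV
    factor_ne_zero := h0
    gradient_eq := fun z hz => h.metricForm_gradVec (hBV hz) W
    potential_eq := fun z hz => by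
      rw [h.potential_eq hW (hBV hz) (hflat z hz), mul_div_cancel₀ _ (h0 z hz)]
    schouten_eq := fun z hz u v => by
      rw [h.potential_eq hW (hBV hz) (hflat z hz), h.schouten_eq hW (hBV hz) (hflat z hz)] }

/-! ### Boundary values -/

/-- Continuity carries equalities from the bulk `B` to its boundary points. Differentiability across
the boundary comes from smoothness on the larger open set `V`. -/
lemma eq_of_mem_closure {F : Type*} [NormedAddCommGroup F] [NormedSpace ℝ F] {V B : Set F}
    {f₁ f₂ : F → ℝ} (hV : IsOpen V) (h₁ : ContDiffOn ℝ ∞ f₁ V) (h₂ : ContDiffOn ℝ ∞ f₂ V)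
    (h : ∀ z ∈ B, f₁ z = f₂ z) {z : F} (hz : z ∈ V) (hzB : z ∈ closure B) : f₁ z = f₂ z := by
  have c1 := (h₁.continuousOn.continuousAt (hV.mem_nhds hz)).continuousWithinAt (s := B)
  have c2 := (h₂.continuousOn.continuousAt (hV.mem_nhds hz)).continuousWithinAt (s := B)
  have : (nhdsWithin z B).NeBot := mem_closure_iff_nhdsWithin_neBot.1 hzB
  refine tendsto_nhds_unique c1 (c2.congr' ?_)
  filter_upwards [self_mem_nhdsWithin] with y hy using (h y hy).symm

lemma contDiffOn_cotton {Γ : Coord 4 → Coord 4 →L[ℝ] Coord 4 →L[ℝ] Coord 4}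
    {S : Coord 4 → Coord 4 →L[ℝ] Coord 4 →L[ℝ] ℝ} (hV : IsOpen V) (hΓ : ContDiffOn ℝ ∞ Γ V)
    (hS : ContDiffOn ℝ ∞ S V) (u v : Coord 4) {w : Coord 4 → Coord 4} (hw : ContDiffOn ℝ ∞ w V) :
    ContDiffOn ℝ ∞ (fun z => cotton Γ S z u v (w z)) V := by
  have hd := hS.fderiv_of_isOpen (m := ∞) hV (by simp)
  have hn : ∀ u v, ContDiffOn ℝ ∞ (fun z => nablaForm Γ S z u v (w z)) V := fun u v =>
    ((((hd.clm_apply contDiffOn_const).clm_apply contDiffOn_const).clm_apply hw).sub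
      ((hS.clm_apply ((hΓ.clm_apply contDiffOn_const).clm_apply contDiffOn_const)).clm_apply
        hw)).sub
      ((hS.clm_apply contDiffOn_const).clm_apply ((hΓ.clm_apply contDiffOn_const).clm_apply hw))
  exact (hn u v).sub (hn v u)

/-- The Cotton tensor with its second argument fixed, as a bilinear form. -/
def cottonForm (Γ : Coord 4 → Coord 4 →L[ℝ] Coord 4 →L[ℝ] Coord 4)
    (S : Coord 4 → Coord 4 →L[ℝ] Coord 4 →L[ℝ] ℝ) (z v : Coord 4) :
    Coord 4 →L[ℝ] Coord 4 →L[ℝ] ℝ :=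
  bilinForm fun i j => cotton Γ S z (cvec i) v (cvec j)

lemma cottonForm_apply (Γ : Coord 4 → Coord 4 →L[ℝ] Coord 4 →L[ℝ] Coord 4)
    (S : Coord 4 → Coord 4 →L[ℝ] Coord 4 →L[ℝ] ℝ) (z v u w : Coord 4) :
    cottonForm Γ S z v u w = cotton Γ S z u v w := by
  let L : Coord 4 →ₗ[ℝ] Coord 4 →ₗ[ℝ] ℝ := LinearMap.mk₂ ℝ (fun u w => cotton Γ S z u v w)
    (fun a b c => by simp [cotton, nablaForm]; ring) (fun a b c => by simp [cotton, nablaForm]; ring)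
    (fun a b c => by simp [cotton, nablaForm]; ring) (fun a b c => by simp [cotton, nablaForm]; ring)
  change _ = L u w
  rw [cottonForm, bilinForm_apply]
  conv_rhs => rw [← sum_smul_cvec u, ← sum_smul_cvec w]
  simp only [map_sum, map_smul, LinearMap.sum_apply, LinearMap.smul_apply, smul_eq_mul,
    Finset.mul_sum]
  rw [Finset.sum_comm]
  refine Finset.sum_congr rfl fun i _ => Finset.sum_congr rfl fun j _ => ?_
  simp only [L, LinearMap.mk₂_apply]
  ring

/-- The consequences of the conformal vacuum equation at a boundary point. -/
structure IsVacuumBoundaryPoint (G : Coord 4 → Matrix (Fin 4) (Fin 4) ℝ) (W : Coord 4 → ℝ)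
    (z : Coord 4) : Prop where
  schouten_eq : ∀ u v, W z * schoutenForm G z u v = potential G W z * metricForm G z u v
    - 2 * metricForm G z (nabla (connection G) (gradVec G W) z u) v
  schouten_symm : ∀ u v, schoutenForm G z u v = schoutenForm G z v u
  fderiv_potential : ∀ u, fderiv ℝ (potential G W) z u = -schoutenForm G z (gradVec G W z) u
  cotton_gradient : ∀ u v, cotton (connection G) (schoutenForm G) z u v (gradVec G W z) = 0
  trace_cotton : ∀ (v : Coord 4) (T : Coord 4 →ₗ[ℝ] Coord 4),
    (∀ u w, metricForm G z (T u) w = cotton (connection G) (schoutenForm G) z u v w) →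
      LinearMap.trace ℝ (Coord 4) T = 0

theorem IsMetricOn.isVacuumBoundaryPoint (h : IsMetricOn G V) (hW : ContDiffOn ℝ ∞ W V)
    (hB : IsOpen B) (hBV : B ⊆ V) (hflat : ∀ z ∈ B, IsConformallyRicciFlatAt G W z)
    {z : Coord 4} (hz : z ∈ V) (hzB : z ∈ closure B) : IsVacuumBoundaryPoint G W z := by
  have H := h.isConformalVacuumOn hW hB hBV hflat
  have hS := h.schoutenForm_smooth
  have hS2 : ∀ u v, ContDiffOn ℝ ∞ (fun z => schoutenForm G z u v) V := fun u v =>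
    (hS.clm_apply contDiffOn_const).clm_apply contDiffOn_const
  have hg := h.metricForm_smooth
  have hf := h.potential_smooth hW
  have hN := h.gradVec_smooth hW
  refine ⟨fun u v => ?_, fun u v => ?_, fun u => ?_, fun u v => ?_, fun v T hT => ?_⟩
  · refine eq_of_mem_closure h.isOpen (f₁ := fun z => W z * schoutenForm G z u v)
      (f₂ := fun z => potential G W z * metricForm G z u v
        - 2 * metricForm G z (nabla (connection G) (gradVec G W) z u) v) ?_ ?_
      (fun y hy => H.schouten_eq y hy u v) hz hzB
    · exact hW.mul (hS2 u v)
    · exact (hf.mul ((hg.clm_apply contDiffOn_const).clm_apply contDiffOn_const)).sub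
        (contDiffOn_const.mul ((hg.clm_apply (h.nabla_smooth hW u)).clm_apply contDiffOn_const))
  · exact eq_of_mem_closure h.isOpen (hS2 u v) (hS2 v u)
      (fun y hy => H.schouten_symm hy u v) hz hzB
  · exact eq_of_mem_closure h.isOpen
      (f₁ := fun z => fderiv ℝ (potential G W) z u)
      (f₂ := fun z => -schoutenForm G z (gradVec G W z) u)
      ((hf.fderiv_of_isOpen h.isOpen (by simp)).clm_apply contDiffOn_const)
      ((hS.clm_apply hN).clm_apply contDiffOn_const).neg
      (fun y hy => H.fderiv_potential hy u) hz hzB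
  · exact eq_of_mem_closure h.isOpen (contDiffOn_cotton h.isOpen h.connection_smooth hS u v hN)
      contDiffOn_const (fun y hy => H.cotton_gradient hy u v) hz hzB
  -- The endomorphism `T` is given at `z` only, so the trace is first written as the contraction of
  -- the Cotton tensor with the inverse metric, which is a smooth function near `z`.
  · rw [h.trace_eq hz]
    simp only [hT]
    refine eq_of_mem_closure h.isOpen (f₁ := fun z => ∑ i, ∑ j, (G z)⁻¹ i j *
        cotton (connection G) (schoutenForm G) z (cvec i) v (cvec j)) (ContDiffOn.sum fun i _ =>
      ContDiffOn.sum fun j _ => (contDiffOn_inv h.smooth h.isUnit_det _ _).mul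
        (contDiffOn_cotton h.isOpen h.connection_smooth hS _ v contDiffOn_const)) contDiffOn_const
      (fun y hy => ?_) hz hzB
    obtain ⟨s, hs⟩ := h.exists_sharp (hBV hy) (schoutenForm G y)
    obtain ⟨T, hT⟩ := h.exists_sharp (hBV hy) (cottonForm (connection G) (schoutenForm G) y v)
    replace hT : ∀ u w, metricForm G y (T u) w =
      cotton (connection G) (schoutenForm G) y u v w := fun u w => by rw [hT, cottonForm_apply]
    rw [← H.trace_cotton (finrank_coord 4) hy hs (h.ric_eq_schouten (hBV hy) hs) v hT,
      h.trace_eq (hBV hy)]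
    simp only [hT]

end Boundary

/-! ### Charts -/

section ChartCalculus

variable {n : ℕ} {X : Type*} [TopologicalSpace X] [ChartedSpace (Coord n) X]
  {φ : OpenPartialHomeomorph X (Coord n)}

lemma chart_mdifferentiableAt (hφ : φ ∈ IsManifold.maximalAtlas (𝓡 n) ∞ X) {x : X}
    (hx : x ∈ φ.source) : MDifferentiableAt (𝓡 n) (𝓡 n) φ x :=
  (contMDiffAt_of_mem_maximalAtlas hφ hx).mdifferentiableAt (by simp)

lemma chart_symm_mdifferentiableAt (hφ : φ ∈ IsManifold.maximalAtlas (𝓡 n) ∞ X) {y : Coord n}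
    (hy : y ∈ φ.target) : MDifferentiableAt (𝓡 n) (𝓡 n) φ.symm y :=
  (contMDiffAt_symm_of_mem_maximalAtlas hφ hy).mdifferentiableAt (by simp)

/-- The derivative of a chart, with values in coordinate space. -/
def dchart (φ : OpenPartialHomeomorph X (Coord n)) (x : X) : Coord n →L[ℝ] Coord n :=
  mfderiv (𝓡 n) (𝓡 n) φ x

/-- The derivative of the inverse of a chart. -/
def dchartSymm (φ : OpenPartialHomeomorph X (Coord n)) (y : Coord n) :
    Coord n →L[ℝ] Coord n :=
  mfderiv (𝓡 n) (𝓡 n) φ.symm y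

lemma dchart_dchartSymm (hφ : φ ∈ IsManifold.maximalAtlas (𝓡 n) ∞ X) {y : Coord n}
    (hy : y ∈ φ.target) (a : Coord n) : dchart φ (φ.symm y) (dchartSymm φ y a) = a := by
  have h1 := mfderiv_comp y (chart_mdifferentiableAt hφ (φ.map_target hy))
    (chart_symm_mdifferentiableAt hφ hy)
  have h2 : mfderiv (𝓡 n) (𝓡 n) (φ ∘ φ.symm) y = mfderiv (𝓡 n) (𝓡 n) id y := by
    refine Filter.EventuallyEq.mfderiv_eq ?_
    filter_upwards [φ.open_target.mem_nhds hy] with z hz using φ.right_inv hz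
  rw [h1, mfderiv_id] at h2
  exact congrArg (fun L : Coord n →L[ℝ] Coord n => L a) h2

/-- In finite dimension a one-sided inverse of an endomorphism is two-sided. -/
lemma dchartSymm_dchart (hφ : φ ∈ IsManifold.maximalAtlas (𝓡 n) ∞ X) {y : Coord n}
    (hy : y ∈ φ.target) (u : Coord n) : dchartSymm φ y (dchart φ (φ.symm y) u) = u := by
  have hl : Function.LeftInverse (dchart φ (φ.symm y)) (dchartSymm φ y) := dchart_dchartSymm hφ hy
  have hinj : Function.Injective (dchartSymm φ y : Coord n →ₗ[ℝ] Coord n) := hl.injective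
  obtain ⟨a, rfl⟩ := (LinearMap.injective_iff_surjective.1 hinj) u
  exact congrArg (dchartSymm φ y) (dchart_dchartSymm hφ hy a)

lemma dchartSymm_dchart_of_mem (hφ : φ ∈ IsManifold.maximalAtlas (𝓡 n) ∞ X) {x : X}
    (hx : x ∈ φ.source) (u : Coord n) : dchartSymm φ (φ x) (dchart φ x u) = u := by
  have := dchartSymm_dchart hφ (φ.map_source hx) u
  rwa [φ.left_inv hx] at this

end ChartCalculus

/-! ### Lorentzian metrics and the Schouten tensor in charts -/

section Lorentz

variable {X : Type*} [TopologicalSpace X] [ChartedSpace (Coord 4) X]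
  {φ : OpenPartialHomeomorph X (Coord 4)}

/-- The metric as a bilinear form on coordinate space. -/
def LorentzMetric.formAt (g : LorentzMetric X) (x : X) : Coord 4 →L[ℝ] Coord 4 →L[ℝ] ℝ := g.form x

lemma LorentzMetric.formAt_symm (g : LorentzMetric X) (x : X) (u v : Coord 4) :
    g.formAt x u v = g.formAt x v u := g.symm x u v

lemma metricForm_inChart (g : LorentzMetric X) (φ : OpenPartialHomeomorph X (Coord 4))
    (y a b : Coord 4) :
    metricForm (g.inChart φ) y a b = g.formAt (φ.symm y) (dchartSymm φ y a) (dchartSymm φ y b) := by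
  rw [metricForm, bilinForm_apply]
  conv_rhs => rw [← sum_smul_cvec a, ← sum_smul_cvec b]
  simp only [map_sum, map_smul, sum_apply, smul_apply, smul_eq_mul, Finset.mul_sum]
  rw [Finset.sum_comm]
  refine Finset.sum_congr rfl fun i _ => Finset.sum_congr rfl fun j _ => ?_
  change g.formAt (φ.symm y) (dchartSymm φ y (cvec j)) (dchartSymm φ y (cvec i)) * _ = _
  ring

/-- Pairing with an orthonormal basis returns the coefficients of `u` up to sign. -/
lemma LorentzMetric.nondegenerate (g : LorentzMetric X) (x : X) {u : Coord 4}
    (hu : ∀ v, g.formAt x u v = 0) : u = 0 := by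
  obtain ⟨b, hb⟩ := g.signature x
  refine b.ext_elem fun i => ?_
  have h1 : g.form x u (b i) = 0 := hu (b i)
  rw [← b.sum_repr u] at h1
  simp only [map_sum, map_smul, sum_apply, smul_apply, hb, smul_eq_mul, mul_ite, mul_zero,
    Finset.sum_ite_eq', Finset.mem_univ, if_true] at h1
  have h2 : b.repr u i = 0 := by split_ifs at h1 <;> simpa using h1
  exact h2.trans (DFunLike.congr_fun (map_zero b.repr) i).symm

lemma LorentzMetric.isMetricOn (g : LorentzMetric X)
    (hφ : φ ∈ IsManifold.maximalAtlas (𝓡 4) ∞ X) : IsMetricOn (g.inChart φ) φ.target where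
  isOpen := φ.open_target
  smooth i j := g.smooth φ hφ i j
  symm z hz i j := g.symm _ _ _
  isUnit_det z hz := by
    rw [isUnit_iff_ne_zero]
    intro h0
    obtain ⟨v, hv0, hv⟩ := Matrix.exists_mulVec_eq_zero_iff.2 h0
    refine hv0 ?_
    -- A kernel vector of the Gram matrix is orthogonal to every tangent vector, because the
    -- coordinate vectors span.
    have h1 : dchartSymm φ z (WithLp.toLp 2 v) = 0 := by
      refine g.nondegenerate (φ.symm z) fun w => ?_
      rw [← dchartSymm_dchart hφ hz w, g.formAt_symm, ← metricForm_inChart,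
        ← sum_smul_cvec (dchart φ (φ.symm z) w)]
      simp only [map_sum, map_smul, sum_apply, smul_apply, metricForm_cvec_left]
      refine Finset.sum_eq_zero fun i _ => ?_
      have := congrFun hv i
      simp only [Matrix.mulVec, dotProduct, Pi.zero_apply] at this
      simp [this]
    have h2 := dchart_dchartSymm hφ hz (WithLp.toLp 2 v)
    rw [h1, map_zero] at h2
    ext i
    exact (congrArg (fun a : Coord 4 => a i) h2).symm

lemma metricForm_dchart (g : LorentzMetric X)
    (hφ : φ ∈ IsManifold.maximalAtlas (𝓡 4) ∞ X) {x : X} (hx : x ∈ φ.source) (u v : Coord 4) :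
    metricForm (g.inChart φ) (φ x) (dchart φ x u) (dchart φ x v) = g.formAt x u v := by
  rw [metricForm_inChart, dchartSymm_dchart_of_mem hφ hx, dchartSymm_dchart_of_mem hφ hx,
    φ.left_inv hx]

/-- The Schouten tensor in terms of its components in the preferred chart. -/
lemma schoutenAt_eq (g : LorentzMetric X) (x : X) (u v : Coord 4) :
    g.schoutenAt x u v = schoutenForm (g.inChart (chartAt (Coord 4) x)) (chartAt (Coord 4) x x)
      (dchart (chartAt (Coord 4) x) x u) (dchart (chartAt (Coord 4) x) x v) := by
  rw [schoutenForm, bilinForm_apply]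
  simp only [LorentzMetric.schoutenAt, mul_assoc]
  rfl

end Lorentz

/-! ### Immersions between manifolds of equal dimension -/

section Physical

variable {Y : Type*} [TopologicalSpace Y] [ChartedSpace (Coord 4) Y] [IsManifold (𝓡 4) ∞ Y]
  {X : Type*} [TopologicalSpace X] [ChartedSpace (Coord 4) X]
  {φ : OpenPartialHomeomorph X (Coord 4)}

/-- An immersion between manifolds of dimension four is, in suitable charts, the identity. -/
lemma exists_chart_of_isImmersion {Ψ : Y → X} (hΨ : Manifold.IsImmersion (𝓡 4) (𝓡 4) ∞ Ψ)
    (hφ : φ ∈ IsManifold.maximalAtlas (𝓡 4) ∞ X) {y₀ : Y} (hy₀ : Ψ y₀ ∈ φ.source) :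
    ∃ ψ ∈ IsManifold.maximalAtlas (𝓡 4) ∞ Y, y₀ ∈ ψ.source ∧ ψ.target ⊆ φ.target ∧
      ∀ y ∈ ψ.source, Ψ y ∈ φ.source ∧ ψ y = φ (Ψ y) := by
  have h := hΨ.isImmersionAt y₀
  -- Equal dimensions leave no room for the complement in the local normal form, so `h.equiv`
  -- restricts to a linear automorphism `L`.
  have hfin : Module.finrank ℝ h.complement = 0 ∧ Subsingleton h.complement := by
    have : FiniteDimensional ℝ (Coord 4 × h.complement) :=
      h.equiv.symm.toLinearEquiv.finiteDimensional
    have : FiniteDimensional ℝ h.complement :=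
      FiniteDimensional.of_surjective (LinearMap.snd ℝ (Coord 4) h.complement)
        LinearMap.snd_surjective
    have h1 := h.equiv.toLinearEquiv.finrank_eq
    rw [Module.finrank_prod, finrank_coord] at h1
    have h2 : Module.finrank ℝ h.complement = 0 := by omega
    exact ⟨h2, Module.finrank_zero_iff.1 h2⟩
  have := hfin.2
  let L : Coord 4 ≃L[ℝ] Coord 4 :=
    { toFun := fun u => h.equiv (u, 0)
      invFun := fun v => (h.equiv.symm v).1
      map_add' := fun a b => by rw [← map_add]; simp
      map_smul' := fun c a => by simp [← map_smul]
      left_inv := fun u => by simp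
      right_inv := fun v => by
        have : ((h.equiv.symm v).1, (0 : h.complement)) = h.equiv.symm v :=
          Prod.ext rfl (Subsingleton.elim _ _)
        simp [this]
      continuous_toFun := by
        exact h.equiv.continuous.comp (continuous_id.prodMk continuous_const)
      continuous_invFun := continuous_fst.comp h.equiv.symm.continuous }
  have hL : ∀ y ∈ h.domChart.source, L (h.domChart y) = h.codChart (Ψ y) := by
    intro y hy
    have hmem : h.domChart y ∈ (h.domChart.extend (𝓡 4)).target := by
      simpa using h.domChart.map_source hy
    have h1 := h.writtenInCharts hmem
    simp only [Function.comp_apply, OpenPartialHomeomorph.extend_coe,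
      OpenPartialHomeomorph.extend_coe_symm, modelWithCornersSelf_coe,
      modelWithCornersSelf_coe_symm, id_eq, h.domChart.left_inv hy] at h1
    exact h1.symm
  -- This chart is `φ ∘ Ψ` near `y₀`: in the immersion charts `Ψ` is `L`, and the last factor passes
  -- from the immersion chart of the target to `φ`.
  let e : OpenPartialHomeomorph Y (Coord 4) :=
    (h.domChart.trans L.toHomeomorph.toOpenPartialHomeomorph).trans (h.codChart.symm.trans φ)
  have hsub : ∀ y ∈ h.domChart.source, Ψ y ∈ h.codChart.source := h.source_subset_preimage_source
  have hsrc : ∀ y ∈ e.source, y ∈ h.domChart.source ∧ Ψ y ∈ φ.source := by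
    intro y hy
    have : y ∈ h.domChart.source := by
      simp only [e, OpenPartialHomeomorph.trans_source] at hy; exact hy.1.1
    refine ⟨this, ?_⟩
    have h2 := hy
    simp only [e, mfld_simps] at h2
    have h3 := h2.2.2
    change h.codChart.symm (L (h.domChart y)) ∈ φ.source at h3
    rwa [hL y this, h.codChart.left_inv (hsub y this)] at h3
  have hval : ∀ y ∈ h.domChart.source, e y = φ (Ψ y) := by
    intro y hy
    change φ (h.codChart.symm (L (h.domChart y))) = _
    rw [hL y hy, h.codChart.left_inv (hsub y hy)]
  have hLs : ContMDiff (𝓡 4) (𝓡 4) ∞ L := L.contDiff.contMDiff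
  have hLs' : ContMDiff (𝓡 4) (𝓡 4) ∞ L.symm := L.symm.contDiff.contMDiff
  refine ⟨e, OpenPartialHomeomorph.mem_maximalAtlas_of_contMDiffOn e ?_ ?_, ?_, ?_, fun y hy =>
    ⟨(hsrc y hy).2, hval y (hsrc y hy).1⟩⟩
  · have h1 : ContMDiffOn (𝓡 4) (𝓡 4) ∞ (φ ∘ Ψ) e.source :=
      (contMDiffOn_of_mem_maximalAtlas hφ).comp hΨ.contMDiff.contMDiffOn fun y hy => (hsrc y hy).2
    exact h1.congr fun y hy => hval y (hsrc y hy).1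
  · have h1 : ContMDiffOn (𝓡 4) (𝓡 4) ∞ (h.domChart.symm ∘ L.symm ∘ h.codChart ∘ φ.symm)
        e.target := by
      refine (contMDiffOn_symm_of_mem_maximalAtlas h.domChart_mem_maximalAtlas).comp
        (hLs'.comp_contMDiffOn ((contMDiffOn_of_mem_maximalAtlas h.codChart_mem_maximalAtlas).comp
          ((contMDiffOn_symm_of_mem_maximalAtlas hφ).mono ?_) ?_)) ?_
      · intro y hy
        simp only [e, mfld_simps] at hy
        exact hy.1.1
      · intro y hy
        simp only [e, mfld_simps] at hy
        exact hy.1.2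
      · intro y hy
        simp only [e, mfld_simps] at hy
        exact hy.2
    exact h1
  · have h0 := h.mem_domChart_source
    simp only [e, mfld_simps]
    change y₀ ∈ h.domChart.source ∧ L (h.domChart y₀) ∈ _ ∧
      h.codChart.symm (L (h.domChart y₀)) ∈ φ.source
    rw [hL y₀ h0, h.codChart.left_inv (hsub y₀ h0)]
    exact ⟨h0, h.codChart.map_source (hsub y₀ h0), hy₀⟩
  · intro y hy
    simp only [e, mfld_simps] at hy
    exact hy.1.1

end Physical

/-! ### Tensoriality of the Schouten tensor -/

section VectorSpace

variable {E : Type*} [NormedAddCommGroup E] [NormedSpace ℝ E]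
  {g g' : E → E →L[ℝ] E →L[ℝ] ℝ} {Γ Γ' : E → E →L[ℝ] E →L[ℝ] E} {B B' : Set E}
  {W W' f f' : E → ℝ} {N N' : E → E} {S S' : E → E →L[ℝ] E →L[ℝ] ℝ}

/-- Twice the Hessian is the Lie derivative of `g` along the gradient. Written this way it contains
no connection, so its behaviour under a change of coordinates follows from the chain rule. -/
lemma IsLeviCivitaOn.two_mul_hessian (h : IsLeviCivitaOn g Γ B)
    (hW : ContDiffOn ℝ ∞ W B) (hNs : ContDiffOn ℝ ∞ N B)
    (hN : ∀ z ∈ B, ∀ u, g z (N z) u = fderiv ℝ W z u) {z : E} (hz : z ∈ B) (a b : E) :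
    2 * g z (nabla Γ N z a) b =
      fderiv ℝ g z (N z) a b + g z (fderiv ℝ N z a) b + g z a (fderiv ℝ N z b) := by
  have h1 := h.hessian_symm hW hNs hN hz a b
  rw [h.metric_symm z hz _ a] at h1
  have h2 : 2 * g z (nabla Γ N z a) b = g z (nabla Γ N z a) b + g z a (nabla Γ N z b) := by
    linarith
  rw [h2, h.compatible z hz, h.torsion_free z hz (N z) a, h.torsion_free z hz (N z) b]
  simp [nabla]
  ring

/-- Where `W ≠ 0`, the conformal vacuum equation determines `S` from `g`, `W`, `f` and the Hessian
of `W`. It suffices that these four are carried along by `F`. -/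
lemma IsConformalVacuumOn.schouten_eq_of_isometry (H : IsConformalVacuumOn g Γ W f N S B)
    (H' : IsConformalVacuumOn g' Γ' W' f' N' S' B') {F : E → E} {V : Set E} (hV : IsOpen V)
    (hF : ContDiffOn ℝ ∞ F V) (hVB : V ⊆ B) (hVB' : Set.MapsTo F V B')
    (hg : ∀ y ∈ V, ∀ a b, g y a b = g' (F y) (fderiv ℝ F y a) (fderiv ℝ F y b))
    (hW : ∀ y ∈ V, W y = W' (F y))
    (hs : ∀ y ∈ V, Function.Surjective (fderiv ℝ F y)) {z : E} (hz : z ∈ V) (a b : E) :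
    S z a b = S' (F z) (fderiv ℝ F z a) (fderiv ℝ F z b) := by
  have h := H.levi_civita
  have h' := H'.levi_civita
  have cF : ∀ y ∈ V, ContDiffAt ℝ ∞ F y := fun y hy => hF.contDiffAt (hV.mem_nhds hy)
  have dF : ∀ y ∈ V, DifferentiableAt ℝ F y := fun y hy => (cF y hy).differentiableAt (by simp)
  have hN : ∀ y ∈ V, N' (F y) = fderiv ℝ F y (N y) := by
    intro y hy
    refine h'.ext_metric (hVB' hy) fun w => ?_
    obtain ⟨b, rfl⟩ := hs y hy w
    rw [← hg y hy, H.gradient_eq y (hVB hy), H'.gradient_eq _ (hVB' hy)]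
    have e : W =ᶠ[nhds y] W' ∘ F := by filter_upwards [hV.mem_nhds hy] with x hx using hW x hx
    rw [e.fderiv_eq, fderiv_comp y (h'.differentiableAt_of_mem H'.smooth_factor (hVB' hy)) (dF y hy)]
    rfl
  have hf : f z = f' (F z) := by
    have h1 := H.potential_eq z (hVB hz)
    rw [hg z hz, ← hN z hz, ← H'.potential_eq _ (hVB' hz), hW z hz] at h1
    exact mul_left_cancel₀ (H'.factor_ne_zero _ (hVB' hz)) h1
  have ddF : DifferentiableAt ℝ (fderiv ℝ F) z :=
    ((cF z hz).fderiv_right (m := ∞) (by simp)).differentiableAt (by simp)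
  have hsymm : ∀ u v, fderiv ℝ (fderiv ℝ F) z u v = fderiv ℝ (fderiv ℝ F) z v u :=
    (cF z hz).isSymmSndFDerivAt
      (by simpa using (by exact_mod_cast le_top : ((2 : ℕ∞) : WithTop ℕ∞) ≤ ∞))
  have dN := h.differentiableAt_of_mem H.smooth_gradient (hVB hz)
  have dN' := h'.differentiableAt_of_mem H'.smooth_gradient (hVB' hz)
  have dg := h.differentiableAt_of_mem h.smooth_metric (hVB hz)
  have dg' := h'.differentiableAt_of_mem h'.smooth_metric (hVB' hz)
  have hDN : ∀ a, fderiv ℝ F z (fderiv ℝ N z a) =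
      fderiv ℝ N' (F z) (fderiv ℝ F z a) - fderiv ℝ (fderiv ℝ F) z a (N z) := by
    intro a
    have e : N' ∘ F =ᶠ[nhds z] fun y => fderiv ℝ F y (N y) := by
      filter_upwards [hV.mem_nhds hz] with y hy using hN y hy
    have h1 := congrArg (fun L : E →L[ℝ] E => L a) e.fderiv_eq
    rw [fderiv_comp z dN' (dF z hz), fderiv_clm_apply ddF dN] at h1
    simp only [ContinuousLinearMap.comp_apply, add_apply, ContinuousLinearMap.flip_apply] at h1
    rw [h1]
    abel
  have hDg : fderiv ℝ g z (N z) a b =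
      fderiv ℝ g' (F z) (fderiv ℝ F z (N z)) (fderiv ℝ F z a) (fderiv ℝ F z b)
        + g' (F z) (fderiv ℝ (fderiv ℝ F) z (N z) a) (fderiv ℝ F z b)
        + g' (F z) (fderiv ℝ F z a) (fderiv ℝ (fderiv ℝ F) z (N z) b) := by
    obtain ⟨L, hL, hLa⟩ := hasFDerivAt_bilin_const dg a b
    have e : (fun y => g y a b) =ᶠ[nhds z]
        fun y => (g' ∘ F) y (fderiv ℝ F y a) (fderiv ℝ F y b) := by
      filter_upwards [hV.mem_nhds hz] with y hy using hg y hy a b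
    have hd : ∀ a, DifferentiableAt ℝ (fun y => fderiv ℝ F y a) z := fun a =>
      ddF.clm_apply (differentiableAt_const a)
    rw [← hLa, ← hL.fderiv, e.fderiv_eq, fderiv_bilin (dg'.comp z (dF z hz)) (hd a) (hd b),
      fderiv_comp z dg' (dF z hz), fderiv_clm_apply ddF (differentiableAt_const a),
      fderiv_clm_apply ddF (differentiableAt_const b)]
    simp
  have k := H.schouten_eq z (hVB hz) a b
  have k' := H'.schouten_eq (F z) (hVB' hz) (fderiv ℝ F z a) (fderiv ℝ F z b)
  -- The second derivatives of `F` from the metric (`hDg`) cancel those from the gradient (`hDN`).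
  rw [h.two_mul_hessian H.smooth_factor H.smooth_gradient H.gradient_eq (hVB hz), hDg,
    hg z hz (fderiv ℝ N z a), hg z hz a (fderiv ℝ N z b), hDN, hDN, hg z hz a b, hf, hW z hz,
    hsymm a, hsymm b] at k
  rw [h'.two_mul_hessian H'.smooth_factor H'.smooth_gradient H'.gradient_eq (hVB' hz),
    hN z hz] at k'
  refine mul_left_cancel₀ (H'.factor_ne_zero _ (hVB' hz)) ?_
  rw [k, k']
  simp only [map_sub, sub_apply]
  ring

end VectorSpace

/-! ### The image of the physical spacetime -/

section Completion

variable {Y : Type*} [TopologicalSpace Y] [ChartedSpace (Coord 4) Y] [IsManifold (𝓡 4) ∞ Y]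
  {X : Type*} [TopologicalSpace X] [ChartedSpace (Coord 4) X]
  {φ : OpenPartialHomeomorph X (Coord 4)} {g' : LorentzMetric Y} {g : LorentzMetric X}
  {Ψ : Y → X} {Ω : X → ℝ}

/-- In the chart of `Y` adapted to `φ` the embedding is the identity of coordinates, so the
conformal relation becomes one between component matrices on the same open set. -/
lemma IsConformalCompletion.isConformallyRicciFlatAt (h : IsConformalCompletion g' g Ψ Ω)
    {U : Set X} (hU : ∀ ψ ∈ IsManifold.maximalAtlas (𝓡 4) ∞ Y, ∀ y ∈ ψ.source, Ψ y ∈ U →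
      ∀ μ ν : Fin 4, ricci (g'.inChart ψ) (ψ y) μ ν = 0)
    (hφ : φ ∈ IsManifold.maximalAtlas (𝓡 4) ∞ X) {y₀ : Y} (hy₀ : Ψ y₀ ∈ φ.source)
    (hyU : Ψ y₀ ∈ U) :
    IsConformallyRicciFlatAt (g.inChart φ) (Ω ∘ φ.symm) (φ (Ψ y₀)) := by
  obtain ⟨ψ, hψ, hyψ, -, hΨ⟩ := exists_chart_of_isImmersion h.embedding.isImmersion hφ hy₀
  have hval := fun y (hy : y ∈ ψ.target) => hΨ (ψ.symm y) (ψ.map_target hy)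
  have hsymm : ∀ y ∈ ψ.target, φ.symm y = Ψ (ψ.symm y) := by
    intro y hy
    have h1 := (hval y hy).2
    rw [ψ.right_inv hy] at h1
    conv_lhs => rw [h1]
    exact φ.left_inv (hval y hy).1
  refine ⟨g'.inChart ψ, ψ.target, ?_, g'.isMetricOn hψ, fun y hy => ?_, fun μ ν => ?_⟩
  · rw [← (hΨ y₀ hyψ).2]
    exact ψ.map_source hyψ
  · have e : φ.symm =ᶠ[nhds y] Ψ ∘ ψ.symm := by
      filter_upwards [ψ.open_target.mem_nhds hy] with x hx using hsymm x hx
    have hd : mfderiv (𝓡 4) (𝓡 4) (Ψ ∘ ψ.symm) y =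
        (mfderiv (𝓡 4) (𝓡 4) Ψ (ψ.symm y)).comp (mfderiv (𝓡 4) (𝓡 4) ψ.symm y) :=
      mfderiv_comp y (h.embedding.contMDiff.mdifferentiableAt (by simp))
        (chart_symm_mdifferentiableAt hψ hy)
    have hv : ∀ i, dchartSymm φ y (cvec i) =
        (mfderiv (𝓡 4) (𝓡 4) Ψ (ψ.symm y) (coordVec ψ y i) : Coord 4) := fun i => by
      have h1 : mfderiv (𝓡 4) (𝓡 4) φ.symm y = mfderiv (𝓡 4) (𝓡 4) (Ψ ∘ ψ.symm) y := e.mfderiv_eq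
      exact (congrArg (fun L : Coord 4 →L[ℝ] Coord 4 => L (cvec i)) h1).trans
        (congrArg (fun L : Coord 4 →L[ℝ] Coord 4 => L (cvec i)) hd)
    ext i j
    have h2 : g.inChart φ y i j = g.formAt (φ.symm y) (dchartSymm φ y (cvec i))
      (dchartSymm φ y (cvec j)) := rfl
    rw [h2, hv, hv, hsymm y hy, Matrix.smul_apply, Function.comp_apply, hsymm y hy]
    exact h.conformal (ψ.symm y) (coordVec ψ y i) (coordVec ψ y j)
  · rw [← (hΨ y₀ hyψ).2]
    exact hU ψ hψ y₀ hyψ hyU μ ν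

variable [IsManifold (𝓡 4) ∞ X]

/-- In adapted charts the map is the identity, so the image contains a whole chart neighbourhood of
each of its points. -/
lemma isOpen_range_of_isImmersion (hΨ : Manifold.IsImmersion (𝓡 4) (𝓡 4) ∞ Ψ) :
    IsOpen (Set.range Ψ) := by
  rw [isOpen_iff_mem_nhds]
  rintro _ ⟨y₀, rfl⟩
  obtain ⟨ψ, hψ, hyψ, -, hv⟩ := exists_chart_of_isImmersion hΨ
    (IsManifold.chart_mem_maximalAtlas (I := 𝓡 4) (n := ∞) (Ψ y₀)) (mem_chart_source (Coord 4) (Ψ y₀))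
  set φ := chartAt (Coord 4) (Ψ y₀)
  have hO : IsOpen (φ.source ∩ φ ⁻¹' ψ.target) := φ.isOpen_inter_preimage ψ.open_target
  refine Filter.mem_of_superset (hO.mem_nhds ⟨(hv y₀ hyψ).1, ?_⟩) ?_
  · rw [Set.mem_preimage, ← (hv y₀ hyψ).2]
    exact ψ.map_source hyψ
  · rintro x ⟨hx, hxψ⟩
    have h1 := hv (ψ.symm (φ x)) (ψ.map_target hxψ)
    rw [ψ.right_inv hxψ] at h1
    exact ⟨ψ.symm (φ x), φ.injOn h1.1 hx h1.2.symm⟩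

/-- In every chart, the physical spacetime near infinity is an open set, conformally Ricci flat,
accumulating at null infinity. -/
lemma IsConformalCompletion.exists_bulk (h : IsConformalCompletion g' g Ψ Ω) :
    ∃ O : Set X, IsOpen O ∧ frontier (Set.range Ψ) ⊆ closure O ∧
      ∀ φ ∈ IsManifold.maximalAtlas (𝓡 4) ∞ X, ∀ z ∈ φ.target ∩ φ.symm ⁻¹' O,
        IsConformallyRicciFlatAt (g.inChart φ) (Ω ∘ φ.symm) z := by
  obtain ⟨U, hUo, hIU, hU⟩ := h.vacuum
  -- Intersecting with the open neighbourhood `U` of the frontier keeps the frontier in the closure.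
  refine ⟨U ∩ Set.range Ψ, hUo.inter (isOpen_range_of_isImmersion h.embedding.isImmersion),
    fun x hx => hUo.inter_closure ⟨hIU hx, frontier_subset_closure hx⟩, ?_⟩
  rintro φ hφ z ⟨hz, hzU, y₀, hy₀⟩
  have := h.isConformallyRicciFlatAt hU hφ (y₀ := y₀) (hy₀ ▸ φ.map_target hz) (hy₀ ▸ hzU)
  rwa [hy₀, φ.right_inv hz] at this

end Completion

/-! ### The bulk as an open set of coordinate space -/

section Bulk

variable {X : Type*} [TopologicalSpace X] {φ : OpenPartialHomeomorph X (Coord 4)} {O : Set X}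

lemma isOpen_bulk (hO : IsOpen O) : IsOpen (φ.target ∩ φ.symm ⁻¹' O) :=
  φ.symm.isOpen_inter_preimage hO

lemma mem_closure_bulk {x : X} (hx : x ∈ φ.source) (hxO : x ∈ closure O) :
    φ x ∈ closure (φ.target ∩ φ.symm ⁻¹' O) := by
  refine φ.open_target.inter_closure ⟨φ.map_source hx, ?_⟩
  have h1 : φ x ∈ φ.symm.source ∩ φ.symm ⁻¹' closure O :=
    ⟨φ.map_source hx, by rwa [Set.mem_preimage, φ.left_inv hx]⟩
  rw [φ.symm.preimage_closure] at h1
  exact h1.2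

end Bulk

/-! ### Change of chart in the unphysical spacetime -/

section ChartChange

variable {X : Type*} [TopologicalSpace X] [ChartedSpace (Coord 4) X]
  {φ φ' : OpenPartialHomeomorph X (Coord 4)} {g : LorentzMetric X} {Ω : X → ℝ} {O : Set X}

lemma contDiffOn_factor (hΩ : ContMDiff (𝓡 4) 𝓘(ℝ, ℝ) ∞ Ω)
    (hφ : φ ∈ IsManifold.maximalAtlas (𝓡 4) ∞ X) : ContDiffOn ℝ ∞ (Ω ∘ φ.symm) φ.target :=
  contMDiffOn_iff_contDiffOn.1
    (hΩ.comp_contMDiffOn (contMDiffOn_symm_of_mem_maximalAtlas hφ))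

lemma isVacuumBoundaryPoint (hΩ : ContMDiff (𝓡 4) 𝓘(ℝ, ℝ) ∞ Ω)
    (hO : IsOpen O) (hflat : ∀ φ ∈ IsManifold.maximalAtlas (𝓡 4) ∞ X,
      ∀ z ∈ φ.target ∩ φ.symm ⁻¹' O, IsConformallyRicciFlatAt (g.inChart φ) (Ω ∘ φ.symm) z)
    (hφ : φ ∈ IsManifold.maximalAtlas (𝓡 4) ∞ X) {x : X} (hx : x ∈ φ.source)
    (hxO : x ∈ closure O) : IsVacuumBoundaryPoint (g.inChart φ) (Ω ∘ φ.symm) (φ x) :=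
  (g.isMetricOn hφ).isVacuumBoundaryPoint (contDiffOn_factor hΩ hφ) (isOpen_bulk hO)
    Set.inter_subset_left (hflat φ hφ) (φ.map_source hx) (mem_closure_bulk hx hxO)

lemma fderiv_chart_change (hφ : φ ∈ IsManifold.maximalAtlas (𝓡 4) ∞ X)
    (hφ' : φ' ∈ IsManifold.maximalAtlas (𝓡 4) ∞ X) {y : Coord 4} (hy : y ∈ φ.target)
    (hy' : φ.symm y ∈ φ'.source) (a : Coord 4) :
    fderiv ℝ (φ' ∘ φ.symm) y a = dchart φ' (φ.symm y) (dchartSymm φ y a) := by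
  have h1 := mfderiv_comp y (chart_mdifferentiableAt hφ' hy') (chart_symm_mdifferentiableAt hφ hy)
  rw [mfderiv_eq_fderiv] at h1
  exact congrArg (fun L : Coord 4 →L[ℝ] Coord 4 => L a) h1

/-- At null infinity the Schouten tensor does not depend on the chart. -/
theorem schoutenForm_chart_change (hΩ : ContMDiff (𝓡 4) 𝓘(ℝ, ℝ) ∞ Ω)
    (hO : IsOpen O) (hflat : ∀ φ ∈ IsManifold.maximalAtlas (𝓡 4) ∞ X,
      ∀ z ∈ φ.target ∩ φ.symm ⁻¹' O, IsConformallyRicciFlatAt (g.inChart φ) (Ω ∘ φ.symm) z)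
    (hφ : φ ∈ IsManifold.maximalAtlas (𝓡 4) ∞ X) (hφ' : φ' ∈ IsManifold.maximalAtlas (𝓡 4) ∞ X)
    {x : X} (hx : x ∈ φ.source) (hx' : x ∈ φ'.source) (hxO : x ∈ closure O) (u v : Coord 4) :
    schoutenForm (g.inChart φ) (φ x) (dchart φ x u) (dchart φ x v) =
      schoutenForm (g.inChart φ') (φ' x) (dchart φ' x u) (dchart φ' x v) := by
  set F := φ' ∘ φ.symm
  have hmet := g.isMetricOn hφ
  have hmet' := g.isMetricOn hφ'
  set V := φ.target ∩ φ.symm ⁻¹' φ'.source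
  have hV : IsOpen V := φ.symm.isOpen_inter_preimage φ'.open_source
  have hFs : ContDiffOn ℝ ∞ F V := contMDiffOn_iff_contDiffOn.1
    ((contMDiffOn_of_mem_maximalAtlas hφ').comp
      ((contMDiffOn_symm_of_mem_maximalAtlas hφ).mono Set.inter_subset_left) fun y hy => hy.2)
  have hFV : Set.MapsTo F V φ'.target := fun y hy => φ'.map_source hy.2
  have hDF := fun y (hy : y ∈ V) => fderiv_chart_change hφ hφ' hy.1 hy.2
  have H := hmet.isConformalVacuumOn (contDiffOn_factor hΩ hφ) (isOpen_bulk hO)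
    Set.inter_subset_left (hflat φ hφ)
  have H' := hmet'.isConformalVacuumOn (contDiffOn_factor hΩ hφ') (isOpen_bulk hO)
    Set.inter_subset_left (hflat φ' hφ')
  have hVO : IsOpen (V ∩ (φ.target ∩ φ.symm ⁻¹' O)) := hV.inter (isOpen_bulk hO)
  have hFinv : ∀ y ∈ V, φ'.symm (F y) = φ.symm y := fun y hy => φ'.left_inv hy.2
  -- The transition map is an isometry preserving the factor, so the bulk case is
  -- `schouten_eq_of_isometry`; the point `x`, in the closure of the bulk, is then reached by
  -- continuity.
  have key : ∀ a b, ∀ y ∈ V ∩ (φ.target ∩ φ.symm ⁻¹' O), schoutenForm (g.inChart φ) y a b =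
      schoutenForm (g.inChart φ') (F y) (fderiv ℝ F y a) (fderiv ℝ F y b) := by
    intro a b y hy
    refine H.schouten_eq_of_isometry H' hVO (hFs.mono Set.inter_subset_left)
      Set.inter_subset_right (fun y hy => ⟨hFV hy.1, ?_⟩) (fun y hy a b => ?_) (fun y hy => ?_)
      (fun y hy b => ?_) hy a b
    · rw [Set.mem_preimage, hFinv y hy.1]; exact hy.2.2
    · rw [hDF y hy.1, hDF y hy.1, metricForm_inChart]
      exact (metricForm_dchart g hφ' hy.1.2 _ _).symm
    · simp only [Function.comp_apply, hFinv y hy.1]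
    · refine ⟨dchart φ (φ.symm y) (dchartSymm φ' (F y) b), ?_⟩
      rw [hDF y hy.1, dchartSymm_dchart hφ hy.1.1, ← hFinv y hy.1,
        dchart_dchartSymm hφ' (hFV hy.1)]
  have hxV : φ x ∈ V := ⟨φ.map_source hx, by rwa [Set.mem_preimage, φ.left_inv hx]⟩
  have hxc : φ x ∈ closure (V ∩ (φ.target ∩ φ.symm ⁻¹' O)) :=
    hV.inter_closure ⟨hxV, mem_closure_bulk hx hxO⟩
  have hS' : ContDiffOn ℝ ∞ (fun y => schoutenForm (g.inChart φ') (F y)) V :=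
    hmet'.schoutenForm_smooth.comp hFs hFV
  have hd : ∀ a, ContDiffOn ℝ ∞ (fun y => fderiv ℝ F y a) V := fun a =>
    (hFs.fderiv_of_isOpen hV (by simp)).clm_apply contDiffOn_const
  have := eq_of_mem_closure hV
    (((hmet.schoutenForm_smooth.mono Set.inter_subset_left).clm_apply contDiffOn_const).clm_apply
      contDiffOn_const) ((hS'.clm_apply (hd (dchart φ x u))).clm_apply (hd (dchart φ x v)))
    (key _ _) hxV hxc
  rw [this, hDF _ hxV, hDF _ hxV]
  simp only [F, Function.comp_apply, φ.left_inv hx, dchartSymm_dchart_of_mem hφ hx]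

lemma schoutenAt_eq_schoutenForm [IsManifold (𝓡 4) ∞ X] (hΩ : ContMDiff (𝓡 4) 𝓘(ℝ, ℝ) ∞ Ω)
    (hO : IsOpen O) (hflat : ∀ φ ∈ IsManifold.maximalAtlas (𝓡 4) ∞ X,
      ∀ z ∈ φ.target ∩ φ.symm ⁻¹' O, IsConformallyRicciFlatAt (g.inChart φ) (Ω ∘ φ.symm) z)
    (hφ : φ ∈ IsManifold.maximalAtlas (𝓡 4) ∞ X)
    {x : X} (hx : x ∈ φ.source) (hxO : x ∈ closure O) (u v : Coord 4) :
    g.schoutenAt x u v = schoutenForm (g.inChart φ) (φ x) (dchart φ x u) (dchart φ x v) := by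
  rw [schoutenAt_eq]
  exact schoutenForm_chart_change hΩ hO hflat (IsManifold.chart_mem_maximalAtlas x) hφ
    (mem_chart_source _ x) hx hxO u v

end ChartChange

/-! ### Vector fields along a map -/

section Along

variable {Q E : Type*} [NormedAddCommGroup Q] [NormedSpace ℝ Q] [NormedAddCommGroup E]
  [NormedSpace ℝ E]

/-- The covariant derivative `∇_a Z` of a vector field `Z` along the map `ι`. -/
def nablaAlong (Γ : E → E →L[ℝ] E →L[ℝ] E) (ι Z : Q → E) (ξ a : Q) : E :=
  fderiv ℝ Z ξ a + Γ (ι ξ) (fderiv ℝ ι ξ a) (Z ξ)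

lemma fderiv_bilin_along {B : E → E →L[ℝ] E →L[ℝ] ℝ} {ι A C : Q → E} {ξ : Q}
    (hB : DifferentiableAt ℝ B (ι ξ)) (hι : DifferentiableAt ℝ ι ξ)
    (hA : DifferentiableAt ℝ A ξ) (hC : DifferentiableAt ℝ C ξ) (a : Q) :
    fderiv ℝ (fun x => B (ι x) (A x) (C x)) ξ a = fderiv ℝ B (ι ξ) (fderiv ℝ ι ξ a) (A ξ) (C ξ)
      + B (ι ξ) (fderiv ℝ A ξ a) (C ξ) + B (ι ξ) (A ξ) (fderiv ℝ C ξ a) := by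
  have h1 : HasFDerivAt (fun x => B (ι x)) ((fderiv ℝ B (ι ξ)).comp (fderiv ℝ ι ξ)) ξ :=
    HasFDerivAt.comp (g := B) ξ hB.hasFDerivAt hι.hasFDerivAt
  have := ((h1.clm_apply hA.hasFDerivAt).clm_apply hC.hasFDerivAt).fderiv
  rw [this]; simp; abel

/-- The Leibniz rule for a bilinear form evaluated on vector fields along a map. -/
lemma fderiv_form_along {S : E → E →L[ℝ] E →L[ℝ] ℝ} (Γ : E → E →L[ℝ] E →L[ℝ] E) {ι A C : Q → E}
    {ξ : Q} (hS : DifferentiableAt ℝ S (ι ξ)) (hι : DifferentiableAt ℝ ι ξ)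
    (hA : DifferentiableAt ℝ A ξ) (hC : DifferentiableAt ℝ C ξ) (a : Q) :
    fderiv ℝ (fun x => S (ι x) (A x) (C x)) ξ a =
      nablaForm Γ S (ι ξ) (fderiv ℝ ι ξ a) (A ξ) (C ξ)
      + S (ι ξ) (nablaAlong Γ ι A ξ a) (C ξ) + S (ι ξ) (A ξ) (nablaAlong Γ ι C ξ a) := by
  rw [fderiv_bilin_along hS hι hA hC]
  simp only [nablaForm, nablaAlong, map_add, add_apply]
  ring

lemma IsLeviCivitaOn.nablaForm_metric {g : E → E →L[ℝ] E →L[ℝ] ℝ} {Γ : E → E →L[ℝ] E →L[ℝ] E}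
    {V : Set E} (h : IsLeviCivitaOn g Γ V) {z : E} (hz : z ∈ V) (u v w : E) :
    nablaForm Γ g z u v w = 0 := by
  rw [nablaForm, h.compatible z hz]; ring

/-- Coordinate vector fields commute and the connection has no torsion. -/
lemma nablaAlong_tangent_symm {g : E → E →L[ℝ] E →L[ℝ] ℝ} {Γ : E → E →L[ℝ] E →L[ℝ] E}
    {V : Set E} (h : IsLeviCivitaOn g Γ V) {O : Set Q} (hO : IsOpen O) {ι : Q → E}
    (hι : ContDiffOn ℝ ∞ ι O) {ξ : Q} (hξ : ξ ∈ O) (hz : ι ξ ∈ V) (a b : Q) :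
    nablaAlong Γ ι (fun x => fderiv ℝ ι x b) ξ a = nablaAlong Γ ι (fun x => fderiv ℝ ι x a) ξ b := by
  have c := hι.contDiffAt (hO.mem_nhds hξ)
  have dd : DifferentiableAt ℝ (fderiv ℝ ι) ξ :=
    (c.fderiv_right (m := ∞) (by simp)).differentiableAt (by simp)
  have hs : fderiv ℝ (fderiv ℝ ι) ξ a b = fderiv ℝ (fderiv ℝ ι) ξ b a :=
    c.isSymmSndFDerivAt
      (by simpa using (by exact_mod_cast le_top : ((2 : ℕ∞) : WithTop ℕ∞) ≤ ∞)) a b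
  rw [nablaAlong, nablaAlong, fderiv_clm_apply dd (differentiableAt_const _),
    fderiv_clm_apply dd (differentiableAt_const _), h.torsion_free _ hz]
  simp [hs]

end Along

/-! ### Null infinity in a chart -/

/-- The parameter space `(ξ¹, ξ^M)`. -/
abbrev Param : Type := ℝ × Coord 2

/-- The null direction. -/
def tvec : Param := (1, 0)

/-- The coordinate directions of the sections. -/
def svec (M : Fin 2) : Param := (0, cvec M)

/-- Null infinity, parametrised by `ι` in a chart of the unphysical spacetime, with the rigging
`r`. -/
structure IsNullInfinityChart (G : Coord 4 → Matrix (Fin 4) (Fin 4) ℝ) (V : Set (Coord 4))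
    (W : Coord 4 → ℝ) (ι r : Param → Coord 4) (O : Set Param) : Prop where
  metric : IsMetricOn G V
  smooth_factor : ContDiffOn ℝ ∞ W V
  isOpen : IsOpen O
  smooth : ContDiffOn ℝ ∞ ι O
  rigging_smooth : ContDiffOn ℝ ∞ r O
  mapsTo : Set.MapsTo ι O V
  factor_eq_zero : ∀ ξ ∈ O, W (ι ξ) = 0
  gauge : ∀ ξ ∈ O, ∀ u, nabla (connection G) (gradVec G W) (ι ξ) u = 0
  boundary : ∀ ξ ∈ O, IsVacuumBoundaryPoint G W (ι ξ)
  null_eq : ∀ ξ ∈ O, fderiv ℝ ι ξ tvec = gradVec G W (ι ξ)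
  injective : ∀ ξ ∈ O, Function.Injective (fderiv ℝ ι ξ)
  rigging_null : ∀ ξ ∈ O, metricForm G (ι ξ) (r ξ) (r ξ) = 0
  rigging_normal : ∀ ξ ∈ O, metricForm G (ι ξ) (r ξ) (fderiv ℝ ι ξ tvec) = 1
  rigging_section : ∀ ξ ∈ O, ∀ M, metricForm G (ι ξ) (r ξ) (fderiv ℝ ι ξ (svec M)) = 0

/-- The induced metric on the sections. -/
def inducedMetric (G : Coord 4 → Matrix (Fin 4) (Fin 4) ℝ) (ι : Param → Coord 4) (ξ : Param) :
    Matrix (Fin 2) (Fin 2) ℝ :=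
  Matrix.of fun M N => metricForm G (ι ξ) (fderiv ℝ ι ξ (svec M)) (fderiv ℝ ι ξ (svec N))

lemma param_eq (c : Param) : c = c.1 • tvec + (c.2 0 • svec 0 + c.2 1 • svec 1) := by
  refine Prod.ext (by simp [tvec, svec]) ?_
  have := sum_smul_cvec c.2
  rw [Fin.sum_univ_two] at this
  simp [tvec, svec, this]

namespace IsNullInfinityChart

variable {G : Coord 4 → Matrix (Fin 4) (Fin 4) ℝ} {V : Set (Coord 4)}
    {W : Coord 4 → ℝ} {ι r : Param → Coord 4} {O : Set Param} {ξ : Param}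

lemma differentiableAt (H : IsNullInfinityChart G V W ι r O) (hξ : ξ ∈ O) :
    DifferentiableAt ℝ ι ξ :=
  (H.smooth.contDiffAt (H.isOpen.mem_nhds hξ)).differentiableAt (by simp)

lemma rigging_differentiableAt (H : IsNullInfinityChart G V W ι r O) (hξ : ξ ∈ O) :
    DifferentiableAt ℝ r ξ :=
  (H.rigging_smooth.contDiffAt (H.isOpen.mem_nhds hξ)).differentiableAt (by simp)

lemma tangent_smooth (H : IsNullInfinityChart G V W ι r O) (a : Param) :
    ContDiffOn ℝ ∞ (fun x => fderiv ℝ ι x a) O :=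
  (H.smooth.fderiv_of_isOpen H.isOpen (by simp)).clm_apply contDiffOn_const

lemma tangent_differentiableAt (H : IsNullInfinityChart G V W ι r O) (hξ : ξ ∈ O) (a : Param) :
    DifferentiableAt ℝ (fun x => fderiv ℝ ι x a) ξ :=
  ((H.tangent_smooth a).contDiffAt (H.isOpen.mem_nhds hξ)).differentiableAt (by simp)

lemma metric_differentiableAt (H : IsNullInfinityChart G V W ι r O) (hξ : ξ ∈ O) :
    DifferentiableAt ℝ (metricForm G) (ι ξ) :=
  (H.metric.metricForm_smooth.contDiffAt
    (H.metric.isOpen.mem_nhds (H.mapsTo hξ))).differentiableAt (by simp)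

lemma schouten_differentiableAt (H : IsNullInfinityChart G V W ι r O) (hξ : ξ ∈ O) :
    DifferentiableAt ℝ (schoutenForm G) (ι ξ) :=
  (H.metric.schoutenForm_smooth.contDiffAt
    (H.metric.isOpen.mem_nhds (H.mapsTo hξ))).differentiableAt (by simp)

lemma metricForm_symm (H : IsNullInfinityChart G V W ι r O) (hξ : ξ ∈ O) (u v : Coord 4) :
    metricForm G (ι ξ) u v = metricForm G (ι ξ) v u := H.metric.metricForm_symm (H.mapsTo hξ) u v

/-- The Leibniz rule for the metric along null infinity. -/
lemma fderiv_metric (H : IsNullInfinityChart G V W ι r O) (hξ : ξ ∈ O) {A C : Param → Coord 4}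
    (hA : DifferentiableAt ℝ A ξ) (hC : DifferentiableAt ℝ C ξ) (a : Param) :
    fderiv ℝ (fun x => metricForm G (ι x) (A x) (C x)) ξ a =
      metricForm G (ι ξ) (nablaAlong (connection G) ι A ξ a) (C ξ) +
        metricForm G (ι ξ) (A ξ) (nablaAlong (connection G) ι C ξ a) := by
  rw [fderiv_form_along (connection G) (H.metric_differentiableAt hξ) (H.differentiableAt hξ) hA hC,
    H.metric.isLeviCivitaOn.nablaForm_metric (H.mapsTo hξ), zero_add]

lemma fderiv_eq_zero_of_const (H : IsNullInfinityChart G V W ι r O) (hξ : ξ ∈ O)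
    {F : Param → ℝ} {c : ℝ} (hF : ∀ x ∈ O, F x = c) (a : Param) : fderiv ℝ F ξ a = 0 := by
  have e : F =ᶠ[nhds ξ] fun _ => c := by
    filter_upwards [H.isOpen.mem_nhds hξ] with x hx using hF x hx
  rw [e.fderiv_eq]
  simp

/-- The gradient `n` of `W` is orthogonal to the level set `W = 0`. The case `a = tvec` says that
`n` is null. -/
lemma normal_tangent (H : IsNullInfinityChart G V W ι r O) (hξ : ξ ∈ O) (a : Param) :
    metricForm G (ι ξ) (fderiv ℝ ι ξ tvec) (fderiv ℝ ι ξ a) = 0 := by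
  rw [H.null_eq ξ hξ, H.metric.metricForm_gradVec (H.mapsTo hξ)]
  have h1 := H.fderiv_eq_zero_of_const hξ (F := W ∘ ι) H.factor_eq_zero a
  rwa [fderiv_comp ξ ((H.smooth_factor.contDiffAt
    (H.metric.isOpen.mem_nhds (H.mapsTo hξ))).differentiableAt (by simp))
    (H.differentiableAt hξ)] at h1

/-- With `W = 0` and `∇N = 0`, the conformal vacuum equation paired with `(ℓ, n)` reduces to `f =
0`. Thus `f` is constant along null infinity, and `df = -S(n,·)` vanishes on tangent vectors. -/
lemma schouten_normal_tangent (H : IsNullInfinityChart G V W ι r O) (hξ : ξ ∈ O) (a : Param) :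
    schoutenForm G (ι ξ) (fderiv ℝ ι ξ tvec) (fderiv ℝ ι ξ a) = 0 := by
  have hf : ∀ x ∈ O, (potential G W ∘ ι) x = 0 := by
    intro x hx
    have h1 := (H.boundary x hx).schouten_eq (r x) (fderiv ℝ ι x tvec)
    rw [H.factor_eq_zero x hx, H.gauge x hx, H.rigging_normal x hx] at h1
    simpa using h1.symm
  have h1 := H.fderiv_eq_zero_of_const hξ hf a
  rw [fderiv_comp ξ (((H.metric.potential_smooth H.smooth_factor).contDiffAt
    (H.metric.isOpen.mem_nhds (H.mapsTo hξ))).differentiableAt (by simp))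
    (H.differentiableAt hξ), ContinuousLinearMap.comp_apply,
    (H.boundary ξ hξ).fderiv_potential] at h1
  rw [H.null_eq ξ hξ]
  linarith

lemma nablaAlong_normal (H : IsNullInfinityChart G V W ι r O) (hξ : ξ ∈ O) (a : Param) :
    nablaAlong (connection G) ι (fun x => fderiv ℝ ι x tvec) ξ a = 0 := by
  have e : (fun x => fderiv ℝ ι x tvec) =ᶠ[nhds ξ] gradVec G W ∘ ι := by
    filter_upwards [H.isOpen.mem_nhds hξ] with x hx using H.null_eq x hx
  rw [nablaAlong, e.fderiv_eq, fderiv_comp ξ (((H.metric.gradVec_smooth H.smooth_factor).contDiffAt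
    (H.metric.isOpen.mem_nhds (H.mapsTo hξ))).differentiableAt (by simp))
    (H.differentiableAt hξ), H.null_eq ξ hξ]
  exact H.gauge ξ hξ _

lemma nablaAlong_tangent_symm (H : IsNullInfinityChart G V W ι r O) (hξ : ξ ∈ O) (a b : Param) :
    nablaAlong (connection G) ι (fun x => fderiv ℝ ι x b) ξ a =
      nablaAlong (connection G) ι (fun x => fderiv ℝ ι x a) ξ b :=
  NullInfinity.nablaAlong_tangent_symm H.metric.isLeviCivitaOn H.isOpen H.smooth hξ (H.mapsTo hξ) a b

/-- Since `∂_a` commutes with `∂_{ξ¹}`, `∇_n e_a = ∇_a n`, which is zero by the gauge. -/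
lemma nablaAlong_tangent_null (H : IsNullInfinityChart G V W ι r O) (hξ : ξ ∈ O) (a : Param) :
    nablaAlong (connection G) ι (fun x => fderiv ℝ ι x a) ξ tvec = 0 := by
  rw [H.nablaAlong_tangent_symm hξ, H.nablaAlong_normal hξ]

/-- The decomposition of a vector with respect to the frame `(n, e_M, ℓ)`. -/
lemma exists_frame_repr (H : IsNullInfinityChart G V W ι r O) (hξ : ξ ∈ O) :
    ∃ C : Coord 4 →ₗ[ℝ] Param, ∀ v,
      v = fderiv ℝ ι ξ (C v) + metricForm G (ι ξ) (fderiv ℝ ι ξ tvec) v • r ξ := by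
  -- Three tangent directions and the rigging. Pairing with `n` isolates the coefficient of the
  -- rigging, which gives injectivity; the dimensions `3 + 1 = 4` do the rest.
  let Θ : Param × ℝ →ₗ[ℝ] Coord 4 :=
    (fderiv ℝ ι ξ : Param →ₗ[ℝ] Coord 4).coprod ((LinearMap.id : ℝ →ₗ[ℝ] ℝ).smulRight (r ξ))
  have hΘ : ∀ c b, Θ (c, b) = fderiv ℝ ι ξ c + b • r ξ := fun c b => by simp [Θ]
  have hn : ∀ c b, metricForm G (ι ξ) (fderiv ℝ ι ξ tvec) (Θ (c, b)) = b := by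
    intro c b
    rw [hΘ, map_add, map_smul, H.normal_tangent hξ, H.metricForm_symm hξ, H.rigging_normal ξ hξ]
    simp
  have hinj : Function.Injective Θ := by
    rw [← LinearMap.ker_eq_bot, LinearMap.ker_eq_bot']
    rintro ⟨c, b⟩ h0
    have hb : b = 0 := by rw [← hn c b, h0, map_zero]
    subst hb
    rw [hΘ, zero_smul, add_zero] at h0
    have : c = 0 := H.injective ξ hξ (by rw [h0, map_zero])
    rw [this]
    rfl
  let e := LinearEquiv.ofInjectiveOfFinrankEq Θ hinj (by simp)
  refine ⟨LinearMap.fst ℝ Param ℝ ∘ₗ e.symm.toLinearMap, fun v => ?_⟩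
  have h1 : Θ (e.symm v) = v := e.apply_symm_apply v
  have h2 := hn (e.symm v).1 (e.symm v).2
  rw [Prod.mk.eta, h1] at h2
  rw [h2]
  conv_lhs => rw [← h1, ← Prod.mk.eta (p := e.symm v), hΘ]
  rfl

/-- The tangent space of null infinity is all of the orthogonal complement of `n`. -/
lemma exists_tangent (H : IsNullInfinityChart G V W ι r O) (hξ : ξ ∈ O) {v : Coord 4}
    (hv : metricForm G (ι ξ) (fderiv ℝ ι ξ tvec) v = 0) : ∃ c, v = fderiv ℝ ι ξ c := by
  obtain ⟨C, hC⟩ := H.exists_frame_repr hξ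
  refine ⟨C v, ?_⟩
  conv_lhs => rw [hC v, hv, zero_smul, add_zero]

lemma eq_zero_of_frame (H : IsNullInfinityChart G V W ι r O) (hξ : ξ ∈ O) {v : Coord 4}
    (hn : metricForm G (ι ξ) v (fderiv ℝ ι ξ tvec) = 0) (hr : metricForm G (ι ξ) v (r ξ) = 0)
    (he : ∀ M, metricForm G (ι ξ) v (fderiv ℝ ι ξ (svec M)) = 0) : v = 0 := by
  obtain ⟨C, hC⟩ := H.exists_frame_repr hξ
  refine H.metric.isLeviCivitaOn.nondegenerate _ (H.mapsTo hξ) v fun w => ?_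
  rw [hC w, param_eq (C w)]
  simp [hn, hr, he]

/-- Differentiate the three normalisations of `ℓ` along `n`. As `n` and `e_M` are parallel along
`n`, `∇_n ℓ` is orthogonal to the whole frame. -/
lemma nablaAlong_rigging_null (H : IsNullInfinityChart G V W ι r O) (hξ : ξ ∈ O) :
    nablaAlong (connection G) ι r ξ tvec = 0 := by
  have dr := H.rigging_differentiableAt hξ
  refine H.eq_zero_of_frame hξ ?_ ?_ fun M => ?_
  · have h1 := H.fderiv_eq_zero_of_const hξ H.rigging_normal tvec
    rw [H.fderiv_metric hξ dr (H.tangent_differentiableAt hξ _), H.nablaAlong_normal hξ] at h1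
    simpa using h1
  · have h1 := H.fderiv_eq_zero_of_const hξ H.rigging_null tvec
    rw [H.fderiv_metric hξ dr dr, H.metricForm_symm hξ (r ξ)] at h1
    linarith
  · have h1 := H.fderiv_eq_zero_of_const hξ (fun x hx => H.rigging_section x hx M) tvec
    rw [H.fderiv_metric hξ dr (H.tangent_differentiableAt hξ _), H.nablaAlong_tangent_null hξ] at h1
    simpa using h1

/-- The induced metric does not depend on the null coordinate. -/
lemma fderiv_inducedMetric_null (H : IsNullInfinityChart G V W ι r O) (hξ : ξ ∈ O) (M N : Fin 2) :
    fderiv ℝ (fun x => inducedMetric G ι x M N) ξ tvec = 0 := by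
  simp only [inducedMetric, Matrix.of_apply]
  rw [H.fderiv_metric hξ (H.tangent_differentiableAt hξ _) (H.tangent_differentiableAt hξ _),
    H.nablaAlong_tangent_null hξ, H.nablaAlong_tangent_null hξ]
  simp

lemma inducedMetric_smooth (H : IsNullInfinityChart G V W ι r O) (M N : Fin 2) :
    ContDiffOn ℝ ∞ (fun x => inducedMetric G ι x M N) O :=
  ((H.metric.metricForm_smooth.comp H.smooth H.mapsTo).clm_apply (H.tangent_smooth _)).clm_apply
    (H.tangent_smooth _)

lemma inducedMetric_symm (H : IsNullInfinityChart G V W ι r O) (hξ : ξ ∈ O) (M N : Fin 2) :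
    inducedMetric G ι ξ M N = inducedMetric G ι ξ N M := H.metricForm_symm hξ _ _

/-- A combination of the `e_M` orthogonal to every `e_N` is also orthogonal to `n` and `ℓ`, hence
zero; the injectivity of the derivative of `ι` then kills its coefficients. -/
lemma isUnit_det_inducedMetric (H : IsNullInfinityChart G V W ι r O) (hξ : ξ ∈ O) :
    IsUnit (inducedMetric G ι ξ).det := by
  rw [isUnit_iff_ne_zero]
  intro h0
  obtain ⟨x, hx0, hx⟩ := Matrix.exists_mulVec_eq_zero_iff.2 h0
  refine hx0 ?_
  have h1 : fderiv ℝ ι ξ (x 0 • svec 0 + x 1 • svec 1) = 0 := by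
    refine H.eq_zero_of_frame hξ ?_ ?_ fun M => ?_
    · rw [H.metricForm_symm hξ, H.normal_tangent hξ]
    · rw [H.metricForm_symm hξ]
      simp [H.rigging_section ξ hξ]
    · have := congrFun hx M
      simp only [Matrix.mulVec, dotProduct, Fin.sum_univ_two, inducedMetric, Matrix.of_apply,
        Pi.zero_apply] at this
      rw [H.metricForm_symm hξ]
      simp only [map_add, map_smul, smul_eq_mul]
      linarith
  have h2 := H.injective ξ hξ (h1.trans (map_zero _).symm)
  have h3 : (x 0 • svec 0 + x 1 • svec 1 : Param).2 = 0 := by rw [h2]; rfl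
  ext i
  have h4 := congrArg (fun a : Coord 2 => a i) h3
  fin_cases i <;> simpa [svec] using h4

lemma hasFDerivAt_slice {F : Param → ℝ} {t : ℝ} {y : Coord 2} (hF : DifferentiableAt ℝ F (t, y))
    (M : Fin 2) : pd M (fun z => F (t, z)) y = fderiv ℝ F (t, y) (svec M) := by
  have h1 : HasFDerivAt (fun z => F (t, z)) _ y :=
    hF.hasFDerivAt.comp y ((hasFDerivAt_const t y).prodMk (hasFDerivAt_id y))
  rw [pd, h1.fderiv]
  simp [svec]

/-- The Gauss formula: contraction of the Schouten tensor with `∇_M e_P`. -/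
lemma schouten_second_fundamental (H : IsNullInfinityChart G V W ι r O) {t : ℝ} {y : Coord 2}
    (hξ : (t, y) ∈ O) (M N P : Fin 2) :
    schoutenForm G (ι (t, y)) (fderiv ℝ ι (t, y) (svec N))
        (nablaAlong (connection G) ι (fun x => fderiv ℝ ι x (svec P)) (t, y) (svec M)) =
      ∑ L, christoffel (fun z => inducedMetric G ι (t, z)) y L M P *
        schoutenForm G (ι (t, y)) (fderiv ℝ ι (t, y) (svec N)) (fderiv ℝ ι (t, y) (svec L)) := by
  set ξ : Param := (t, y) with hξdef
  set Z : Fin 2 → Fin 2 → Coord 4 := fun M P =>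
    nablaAlong (connection G) ι (fun x => fderiv ℝ ι x (svec P)) ξ (svec M) with hZ
  have hsymm : ∀ M P, Z M P = Z P M := fun M P => H.nablaAlong_tangent_symm hξ _ _
  have dT := H.tangent_differentiableAt hξ
  -- Differentiating `g(n, e_P) = 0` with `∇n = 0` shows that `∇_M e_P` is tangent to null infinity.
  have hn : metricForm G (ι ξ) (fderiv ℝ ι ξ tvec) (Z M P) = 0 := by
    have h1 := H.fderiv_eq_zero_of_const hξ (fun x hx => H.normal_tangent hx (svec P)) (svec M)
    rw [H.fderiv_metric hξ (dT _) (dT _), H.nablaAlong_normal hξ] at h1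
    simpa using h1
  obtain ⟨c, hc⟩ := H.exists_tangent hξ hn
  have hd : ∀ A B C, pd A (fun z => inducedMetric G ι (t, z) B C) y =
      metricForm G (ι ξ) (Z A B) (fderiv ℝ ι ξ (svec C)) +
        metricForm G (ι ξ) (Z A C) (fderiv ℝ ι ξ (svec B)) := by
    intro A B C
    have := ((H.inducedMetric_smooth B C).contDiffAt (H.isOpen.mem_nhds hξ)).differentiableAt
      (by simp)
    rw [hasFDerivAt_slice this]
    simp only [inducedMetric, Matrix.of_apply]
    rw [H.fderiv_metric hξ (dT _) (dT _),
      H.metricForm_symm hξ (fderiv ℝ ι ξ (svec B))]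
  have hq := H.isUnit_det_inducedMetric hξ
  have hΓ := fun m => sum_mul_christoffel (G := fun z => inducedMetric G ι (t, z)) (y := y) hq m M P
  -- This is the Koszul formula for `q`; the component of `∇_M e_P` along `n` drops out because `n`
  -- is orthogonal to the sections.
  have hcL : ∀ m, ∑ L, inducedMetric G ι ξ m L * c.2 L = (1 / 2) *
      (pd M (fun z => inducedMetric G ι (t, z) P m) y
        + pd P (fun z => inducedMetric G ι (t, z) M m) y
        - pd m (fun z => inducedMetric G ι (t, z) M P) y) := by
    intro m
    rw [hd, hd, hd, hsymm P M, hsymm m M, hsymm m P, hc]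
    conv_rhs => rw [param_eq c]
    simp only [map_add, map_smul, add_apply, smul_apply, smul_eq_mul, Fin.sum_univ_two,
      inducedMetric, Matrix.of_apply, H.normal_tangent hξ,
      H.metricForm_symm hξ (fderiv ℝ ι ξ (svec m))]
    ring
  have hcΓ : ∀ L, c.2 L = christoffel (fun z => inducedMetric G ι (t, z)) y L M P := by
    have h1 : (inducedMetric G ι ξ).mulVec (fun L => c.2 L) = (inducedMetric G ι ξ).mulVec
        fun L => christoffel (fun z => inducedMetric G ι (t, z)) y L M P := by
      ext m
      simp only [Matrix.mulVec, dotProduct, hcL]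
      exact (hΓ m).symm
    exact congrFun (Matrix.mulVec_injective_of_isUnit
      ((Matrix.isUnit_iff_isUnit_det _).2 hq) h1)
  -- This makes the undetermined `n`-component of `∇_M e_P` irrelevant in the contraction with `S`.
  have hS0 : schoutenForm G (ι ξ) (fderiv ℝ ι ξ (svec N)) (fderiv ℝ ι ξ tvec) = 0 := by
    rw [(H.boundary ξ hξ).schouten_symm, H.schouten_normal_tangent hξ]
  change schoutenForm G (ι ξ) _ (Z M P) = _
  rw [hc]
  conv_lhs => rw [param_eq c]
  simp only [map_add, map_smul, smul_eq_mul, hS0, Fin.sum_univ_two, hcΓ]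
  ring

/-- The trace of an endomorphism in the frame `(n, e_M, ℓ)`, when `C` are the tangential
coordinates. -/
lemma trace_frame (H : IsNullInfinityChart G V W ι r O) (hξ : ξ ∈ O) {C : Coord 4 →ₗ[ℝ] Param}
    (hC : ∀ v, v = fderiv ℝ ι ξ (C v) + metricForm G (ι ξ) (fderiv ℝ ι ξ tvec) v • r ξ)
    (T : Coord 4 →ₗ[ℝ] Coord 4) :
    LinearMap.trace ℝ (Coord 4) T = metricForm G (ι ξ) (T (fderiv ℝ ι ξ tvec)) (r ξ)
      + ((C (T (fderiv ℝ ι ξ (svec 0)))).2 0 + (C (T (fderiv ℝ ι ξ (svec 1)))).2 1)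
      + metricForm G (ι ξ) (T (r ξ)) (fderiv ℝ ι ξ tvec) := by
  have hC1 : ∀ v, (C v).1 = metricForm G (ι ξ) v (r ξ) := by
    intro v
    rw [H.metricForm_symm hξ]
    conv_rhs => rw [hC v, param_eq (C v)]
    simp [H.rigging_normal ξ hξ, H.rigging_section ξ hξ, H.rigging_null ξ hξ]
  let p : Fin 2 → Coord 4 →ₗ[ℝ] ℝ := fun M =>
    (EuclideanSpace.proj M : Coord 2 →L[ℝ] ℝ).toLinearMap ∘ₗ LinearMap.snd ℝ ℝ (Coord 2) ∘ₗ C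
  -- Inserting the frame decomposition of the identity writes `T` as a sum of rank-one maps; the
  -- coframe dual to `(n, e_M, ℓ)` is `(g(·,ℓ), C_M, g(·,n))`.
  have hid : T = ((metricForm G (ι ξ)).flip (r ξ) : Coord 4 →ₗ[ℝ] ℝ).smulRight
        (T (fderiv ℝ ι ξ tvec))
      + ((p 0).smulRight (T (fderiv ℝ ι ξ (svec 0))) + (p 1).smulRight (T (fderiv ℝ ι ξ (svec 1))))
      + ((metricForm G (ι ξ)).flip (fderiv ℝ ι ξ tvec) : Coord 4 →ₗ[ℝ] ℝ).smulRight (T (r ξ)) := by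
    ext1 v
    conv_lhs => rw [hC v, param_eq (C v)]
    simp only [map_add, map_smul, LinearMap.add_apply, LinearMap.smulRight_apply, hC1,
      ContinuousLinearMap.coe_coe, ContinuousLinearMap.flip_apply, p, LinearMap.comp_apply,
      LinearMap.snd_apply, PiLp.proj_apply]
    rw [H.metricForm_symm hξ (fderiv ℝ ι ξ tvec)]
  conv_lhs => rw [hid]
  simp only [map_add, LinearMap.trace_smulRight, ContinuousLinearMap.coe_coe,
    ContinuousLinearMap.flip_apply, p, LinearMap.comp_apply, LinearMap.snd_apply, PiLp.proj_apply]

lemma cotton_swap (Γ : Coord 4 → Coord 4 →L[ℝ] Coord 4 →L[ℝ] Coord 4)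
    (S : Coord 4 → Coord 4 →L[ℝ] Coord 4 →L[ℝ] ℝ) (z u v w : Coord 4) :
    cotton Γ S z u v w = -cotton Γ S z v u w := by
  simp [cotton]

/-- The tangential components of the Cotton tensor. -/
lemma cotton_tangential (H : IsNullInfinityChart G V W ι r O) (hξ : ξ ∈ O) (M N P : Fin 2) :
    cotton (connection G) (schoutenForm G) (ι ξ) (fderiv ℝ ι ξ (svec M)) (fderiv ℝ ι ξ (svec N))
        (fderiv ℝ ι ξ (svec P))
      + inducedMetric G ι ξ N P * cotton (connection G) (schoutenForm G) (ι ξ)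
        (fderiv ℝ ι ξ (svec M)) (fderiv ℝ ι ξ tvec) (r ξ)
      - inducedMetric G ι ξ M P * cotton (connection G) (schoutenForm G) (ι ξ)
        (fderiv ℝ ι ξ (svec N)) (fderiv ℝ ι ξ tvec) (r ξ) = 0 := by
  set Y := cotton (connection G) (schoutenForm G) (ι ξ) with hY
  set e : Fin 2 → Coord 4 := fun M => fderiv ℝ ι ξ (svec M) with he
  set n := fderiv ℝ ι ξ tvec with hn
  obtain ⟨C, hC⟩ := H.exists_frame_repr hξ
  have hsw : ∀ u v w, Y u v w = -Y v u w := cotton_swap _ _ _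
  have hYn : ∀ u v, Y u v n = 0 := fun u v => by
    rw [hn, H.null_eq ξ hξ]
    exact (H.boundary ξ hξ).cotton_gradient u v
  have hT : ∀ v, ∃ T : Coord 4 →ₗ[ℝ] Coord 4, ∀ u w, metricForm G (ι ξ) (T u) w = Y u v w := by
    intro v
    obtain ⟨T, hT⟩ := H.metric.exists_sharp (H.mapsTo hξ)
      (cottonForm (connection G) (schoutenForm G) (ι ξ) v)
    exact ⟨T, fun u w => by rw [hT, cottonForm_apply]⟩
  choose T hT using hT
  have hext := fun {a b : Coord 4} (h : ∀ v, metricForm G (ι ξ) a v = metricForm G (ι ξ) b v) =>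
    H.metric.isLeviCivitaOn.ext_metric (H.mapsTo hξ) h
  have hTT : ∀ u, T u u = 0 := fun u => hext fun w => by
    rw [hT, map_zero, zero_apply]
    linarith [hsw u u w]
  have hTs : T (e 0) (e 1) = -T (e 1) (e 0) := hext fun w => by
    rw [hT, map_neg, neg_apply, hT, hsw]
  have htr : ∀ v, LinearMap.trace ℝ (Coord 4) (T v) = 0 := fun v =>
    (H.boundary ξ hξ).trace_cotton v (T v) (hT v)
  -- By antisymmetry on a two-dimensional section only the vector `T (e 1) (e 0)`, dual to `Y(e_0,
  -- e_1, ·)`, is unknown. The two vanishing traces give its two components along the section, as `±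
  -- Y(e_M, n, ℓ)`.
  have k0 := H.trace_frame hξ hC (T (e 0))
  have k1 := H.trace_frame hξ hC (T (e 1))
  rw [htr, hT, hT, ← hn, hYn] at k0 k1
  change 0 = Y n (e 0) (r ξ) + ((C (T (e 0) (e 0))).2 0 + (C (T (e 0) (e 1))).2 1) + 0 at k0
  change 0 = Y n (e 1) (r ξ) + ((C (T (e 1) (e 0))).2 0 + (C (T (e 1) (e 1))).2 1) + 0 at k1
  rw [hTT, hTs, hsw n] at k0
  rw [hTT, hsw n] at k1
  simp only [map_neg, map_zero, Prod.snd_zero, Prod.snd_neg, PiLp.zero_apply, PiLp.neg_apply] at k0 k1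
  have hq : ∀ P, Y (e 0) (e 1) (e P) = inducedMetric G ι ξ 0 P * (C (T (e 1) (e 0))).2 0
      + inducedMetric G ι ξ 1 P * (C (T (e 1) (e 0))).2 1 := by
    intro P
    rw [← hT]
    conv_lhs => rw [hC (T (e 1) (e 0)), param_eq (C _)]
    have h2 : metricForm G (ι ξ) n (T (e 1) (e 0)) = 0 := by
      rw [H.metricForm_symm hξ, hT, hYn]
    rw [h2]
    simp only [map_add, map_smul, add_apply, smul_apply, smul_eq_mul, he,
      inducedMetric, Matrix.of_apply, zero_smul, ← hn]
    rw [hn, H.normal_tangent hξ]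
    simp
    ring
  have main : ∀ P, Y (e 0) (e 1) (e P) + inducedMetric G ι ξ 1 P * Y (e 0) n (r ξ)
      - inducedMetric G ι ξ 0 P * Y (e 1) n (r ξ) = 0 := by
    intro P
    rw [hq]
    linear_combination inducedMetric G ι ξ 1 P * k0 + (-inducedMetric G ι ξ 0 P) * k1
  change Y (e M) (e N) (e P) + _ * Y (e M) n (r ξ) - _ * Y (e N) n (r ξ) = 0
  have hself : ∀ u w, Y u u w = 0 := fun u w => by linarith [hsw u u w]
  have m := main P
  fin_cases M <;> fin_cases N
  · simp [hself]
  · exact m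
  · have := hsw (e 1) (e 0) (e P)
    simp only [Fin.mk_one, Fin.zero_eta] at *
    linarith
  · simp [hself]

lemma fderiv_schouten (H : IsNullInfinityChart G V W ι r O) (hξ : ξ ∈ O) {A C : Param → Coord 4}
    (hA : DifferentiableAt ℝ A ξ) (hC : DifferentiableAt ℝ C ξ) (a : Param) :
    fderiv ℝ (fun x => schoutenForm G (ι x) (A x) (C x)) ξ a =
      nablaForm (connection G) (schoutenForm G) (ι ξ) (fderiv ℝ ι ξ a) (A ξ) (C ξ)
      + schoutenForm G (ι ξ) (nablaAlong (connection G) ι A ξ a) (C ξ)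
      + schoutenForm G (ι ξ) (A ξ) (nablaAlong (connection G) ι C ξ a) :=
  fderiv_form_along _ (H.schouten_differentiableAt hξ) (H.differentiableAt hξ) hA hC a

/-- The identity that propagates the constraint along null infinity. -/
theorem propagation (H : IsNullInfinityChart G V W ι r O) {t : ℝ} {y : Coord 2}
    (hξ : (t, y) ∈ O) (M N P : Fin 2) :
    (fderiv ℝ (fun x => schoutenForm G (ι x) (fderiv ℝ ι x (svec N)) (fderiv ℝ ι x (svec P)))
          (t, y) (svec M)
        - ∑ L, christoffel (fun z => inducedMetric G ι (t, z)) y L M P *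
          schoutenForm G (ι (t, y)) (fderiv ℝ ι (t, y) (svec N)) (fderiv ℝ ι (t, y) (svec L)))
      - (fderiv ℝ (fun x => schoutenForm G (ι x) (fderiv ℝ ι x (svec M)) (fderiv ℝ ι x (svec P)))
          (t, y) (svec N)
        - ∑ L, christoffel (fun z => inducedMetric G ι (t, z)) y L N P *
          schoutenForm G (ι (t, y)) (fderiv ℝ ι (t, y) (svec M)) (fderiv ℝ ι (t, y) (svec L)))
      + inducedMetric G ι (t, y) N P *
        (fderiv ℝ (fun x => schoutenForm G (ι x) (fderiv ℝ ι x tvec) (r x)) (t, y) (svec M)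
          - fderiv ℝ (fun x => schoutenForm G (ι x) (fderiv ℝ ι x (svec M)) (r x)) (t, y) tvec)
      - inducedMetric G ι (t, y) M P *
        (fderiv ℝ (fun x => schoutenForm G (ι x) (fderiv ℝ ι x tvec) (r x)) (t, y) (svec N)
          - fderiv ℝ (fun x => schoutenForm G (ι x) (fderiv ℝ ι x (svec N)) (r x)) (t, y) tvec)
      = 0 := by
  have dT := H.tangent_differentiableAt hξ
  have dr := H.rigging_differentiableAt hξ
  -- The Leibniz rule produces `Y(e_A, n, ℓ)` with no correction: `n`, `e_A` and `ℓ` are parallel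
  -- along `n`, `∇_A n = 0`, and `S(n, ∇_A ℓ) = 0` because `∇_A ℓ` is tangent to null infinity.
  have h1 : ∀ A, fderiv ℝ (fun x => schoutenForm G (ι x) (fderiv ℝ ι x tvec) (r x)) (t, y) (svec A)
      - fderiv ℝ (fun x => schoutenForm G (ι x) (fderiv ℝ ι x (svec A)) (r x)) (t, y) tvec =
      cotton (connection G) (schoutenForm G) (ι (t, y)) (fderiv ℝ ι (t, y) (svec A))
        (fderiv ℝ ι (t, y) tvec) (r (t, y)) := by
    intro A
    have hr : metricForm G (ι (t, y)) (fderiv ℝ ι (t, y) tvec)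
        (nablaAlong (connection G) ι r (t, y) (svec A)) = 0 := by
      have h1 := H.fderiv_eq_zero_of_const hξ H.rigging_normal (svec A)
      rw [H.fderiv_metric hξ dr (dT _), H.nablaAlong_normal hξ, map_zero, add_zero] at h1
      rw [H.metricForm_symm hξ, h1]
    obtain ⟨c, hc⟩ := H.exists_tangent hξ hr
    rw [H.fderiv_schouten hξ (dT _) dr, H.fderiv_schouten hξ (dT _) dr, H.nablaAlong_normal hξ,
      H.nablaAlong_tangent_null hξ, H.nablaAlong_rigging_null hξ, hc,
      H.schouten_normal_tangent hξ]
    simp [cotton]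
  rw [h1, h1, H.fderiv_schouten hξ (dT _) (dT _), H.fderiv_schouten hξ (dT _) (dT _),
    H.schouten_second_fundamental hξ, H.schouten_second_fundamental hξ,
    H.nablaAlong_tangent_symm hξ (svec M) (svec N)]
  have := H.cotton_tangential hξ M N P
  rw [cotton] at this
  linarith

end IsNullInfinityChart

/-! ### The derivative of the constraint defect along the generators -/

namespace IsNullInfinityChart

variable {G : Coord 4 → Matrix (Fin 4) (Fin 4) ℝ} {V : Set (Coord 4)}
    {W : Coord 4 → ℝ} {ι r : Param → Coord 4} {O : Set Param}

lemma differentiableAt_schouten (H : IsNullInfinityChart G V W ι r O) {ξ : Param} (hξ : ξ ∈ O)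
    {A C : Param → Coord 4} (hA : DifferentiableAt ℝ A ξ) (hC : DifferentiableAt ℝ C ξ) :
    DifferentiableAt ℝ (fun x => schoutenForm G (ι x) (A x) (C x)) ξ :=
  (DifferentiableAt.clm_apply (DifferentiableAt.comp (g := schoutenForm G) ξ
    (H.schouten_differentiableAt hξ) (H.differentiableAt hξ)) hA).clm_apply hC

lemma hasDerivAt_time {F : Param → ℝ} {t : ℝ} {y : Coord 2} (hF : DifferentiableAt ℝ F (t, y)) :
    HasDerivAt (fun s => F (s, y)) (fderiv ℝ F (t, y) tvec) t := by
  have h1 : HasDerivAt (fun s : ℝ => ((s, y) : Param)) tvec t :=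
    (hasDerivAt_id t).prodMk (hasDerivAt_const t y)
  exact hF.hasFDerivAt.comp_hasDerivAt t h1

/-- Along null infinity the evolution equation preserves the constraint. -/
theorem hasDerivAt_constraint (H : IsNullInfinityChart G V W ι r O) {t : ℝ} {y : Coord 2}
    (hξ : (t, y) ∈ O) {K : Fin 2 → Fin 2 → Param → ℝ} (hK : ∀ M N, ContDiffOn ℝ ∞ (K M N) O)
    (hev : ∀ M N, ∀ x ∈ O, fderiv ℝ (K M N) x tvec = -(1 / 2) *
      (schoutenForm G (ι x) (fderiv ℝ ι x (svec M)) (fderiv ℝ ι x (svec N))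
        + schoutenForm G (ι x) (fderiv ℝ ι x tvec) (r x) * inducedMetric G ι x M N))
    (M N P : Fin 2) :
    HasDerivAt (fun s =>
      (fderiv ℝ (K N P) (s, y) (svec M)
          - ∑ l, christoffel (fun z => inducedMetric G ι (t, z)) y l M N * K l P (s, y)
          - ∑ l, christoffel (fun z => inducedMetric G ι (t, z)) y l M P * K N l (s, y))
        - (fderiv ℝ (K M P) (s, y) (svec N)
          - ∑ l, christoffel (fun z => inducedMetric G ι (t, z)) y l N M * K l P (s, y)
          - ∑ l, christoffel (fun z => inducedMetric G ι (t, z)) y l N P * K M l (s, y))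
        - (1 / 2) * (inducedMetric G ι (t, y) P M *
            schoutenForm G (ι (s, y)) (fderiv ℝ ι (s, y) (svec N)) (r (s, y))
          - inducedMetric G ι (t, y) P N *
            schoutenForm G (ι (s, y)) (fderiv ℝ ι (s, y) (svec M)) (r (s, y)))) 0 t := by
  have dT := H.tangent_differentiableAt hξ
  have dr := H.rigging_differentiableAt hξ
  have hnhds := H.isOpen.mem_nhds hξ
  have dK : ∀ A B, DifferentiableAt ℝ (K A B) (t, y) := fun A B =>
    ((hK A B).contDiffAt hnhds).differentiableAt (by simp)
  have dDK : ∀ A B C, DifferentiableAt ℝ (fun x => fderiv ℝ (K A B) x (svec C)) (t, y) :=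
    fun A B C => ((((hK A B).contDiffAt hnhds).fderiv_right (m := ∞) (by simp)).differentiableAt
      (by simp)).clm_apply (differentiableAt_const _)
  have dS := fun A B => H.differentiableAt_schouten hξ (dT (svec A)) (dT (svec B))
  have ds := H.differentiableAt_schouten hξ (dT tvec) dr
  have dq : ∀ A B, DifferentiableAt ℝ (fun x => inducedMetric G ι x A B) (t, y) := fun A B =>
    ((H.inducedMetric_smooth A B).contDiffAt hnhds).differentiableAt (by simp)
  -- The derivatives along the generator and along the section commute, so the evolution equation
  -- can be differentiated along the section.
  have hmix : ∀ A B C, fderiv ℝ (fun x => fderiv ℝ (K A B) x (svec C)) (t, y) tvec =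
      -(1 / 2) * (fderiv ℝ (fun x => schoutenForm G (ι x) (fderiv ℝ ι x (svec A))
          (fderiv ℝ ι x (svec B))) (t, y) (svec C)
        + (schoutenForm G (ι (t, y)) (fderiv ℝ ι (t, y) tvec) (r (t, y)) *
          pd C (fun z => inducedMetric G ι (t, z) A B) y
        + inducedMetric G ι (t, y) A B * fderiv ℝ (fun x => schoutenForm G (ι x)
          (fderiv ℝ ι x tvec) (r x)) (t, y) (svec C))) := by
    intro A B C
    have e : (fun x => fderiv ℝ (K A B) x tvec) =ᶠ[nhds (t, y)] fun x => -(1 / 2) *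
      (schoutenForm G (ι x) (fderiv ℝ ι x (svec A)) (fderiv ℝ ι x (svec B))
        + schoutenForm G (ι x) (fderiv ℝ ι x tvec) (r x) * inducedMetric G ι x A B) := by
      filter_upwards [hnhds] with x hx using hev A B x hx
    rw [fderiv_fderiv_symm H.isOpen (hK A B) hξ, e.fderiv_eq,
      fderiv_const_mul ((dS A B).fun_add (ds.fun_mul (dq A B))),
      fderiv_fun_add (dS A B) (ds.fun_mul (dq A B)), fderiv_fun_mul ds (dq A B),
      hasFDerivAt_slice (dq A B)]
    simp only [smul_apply, add_apply, smul_eq_mul]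
  have hKt : ∀ A B, HasDerivAt (fun s => K A B (s, y)) (-(1 / 2) *
      (schoutenForm G (ι (t, y)) (fderiv ℝ ι (t, y) (svec A)) (fderiv ℝ ι (t, y) (svec B))
        + schoutenForm G (ι (t, y)) (fderiv ℝ ι (t, y) tvec) (r (t, y)) *
          inducedMetric G ι (t, y) A B)) t := fun A B => by
    rw [← hev A B _ hξ]
    exact hasDerivAt_time (dK A B)
  have hcov : ∀ A B, HasDerivAt (fun s => fderiv ℝ (K B P) (s, y) (svec A)
      - ∑ l, christoffel (fun z => inducedMetric G ι (t, z)) y l A B * K l P (s, y)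
      - ∑ l, christoffel (fun z => inducedMetric G ι (t, z)) y l A P * K B l (s, y)) _ t :=
    fun A B => ((hasDerivAt_time (dDK B P A)).sub (HasDerivAt.fun_sum fun l _ =>
      (hKt l P).const_mul _)).sub (HasDerivAt.fun_sum fun l _ => (hKt B l).const_mul _)
  have hS := fun A B => ((hasDerivAt_time (H.differentiableAt_schouten hξ (dT (svec A)) dr)).const_mul
    (inducedMetric G ι (t, y) P B))
  have main := ((hcov M N).sub (hcov N M)).sub (((hS N M).sub (hS M N)).const_mul (1 / 2))
  refine main.congr_deriv ?_
  have hsymm : ∀ᶠ z in nhds y, ∀ i j, inducedMetric G ι (t, z) i j = inducedMetric G ι (t, z) j i := by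
    have hc : Filter.Tendsto (fun z => ((t, z) : Param)) (nhds y) (nhds (t, y)) :=
      (continuous_const.prodMk continuous_id).tendsto _
    filter_upwards [hc hnhds] with z hz using H.inducedMetric_symm hz
  have hpd : ∀ A B C, pd A (fun z => inducedMetric G ι (t, z) B C) y =
      pd A (fun z => inducedMetric G ι (t, z) C B) y := fun A B C => by
    have e : (fun z => inducedMetric G ι (t, z) B C) =ᶠ[nhds y]
        fun z => inducedMetric G ι (t, z) C B := by
      filter_upwards [hsymm] with z hz using hz B C
    simp only [pd, e.fderiv_eq]
  have hΓ := fun l => christoffel_symm (G := fun z => inducedMetric G ι (t, z)) hsymm l N M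
  have hq := fun m i j => sum_mul_christoffel (G := fun z => inducedMetric G ι (t, z)) (y := y)
    (H.isUnit_det_inducedMetric hξ) m i j
  -- These express `D q = 0`: they cancel the terms in which the section derivative falls on `q` in
  -- `S_{nℓ} q_{MN}`. The rest is `-½` times `propagation`.
  have q1 := hq N M P
  have q2 := hq M N P
  have k := H.propagation hξ M N P
  rw [hmix, hmix]
  simp only [hΓ, Fin.sum_univ_two, hpd M P N, hpd P N M, hpd N P M,
    H.inducedMetric_symm hξ P M, H.inducedMetric_symm hξ P N] at *
  linear_combination (-1 / 2) * k +
    (1 / 2) * schoutenForm G (ι (t, y)) (fderiv ℝ ι (t, y) tvec) (r (t, y)) * (q1 - q2)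

end IsNullInfinityChart

/-! ### Derivatives of immersions are injective -/

section Immersion

variable {E H M E' H' N : Type*} [NormedAddCommGroup E] [NormedSpace ℝ E] [TopologicalSpace H]
  [NormedAddCommGroup E'] [NormedSpace ℝ E'] [TopologicalSpace H']
  {I : ModelWithCorners ℝ E H} {I' : ModelWithCorners ℝ E' H'} [I.Boundaryless]
  [TopologicalSpace M] [ChartedSpace H M] [TopologicalSpace N] [ChartedSpace H' N]

/-- In the immersion charts, undoing the linear equivalence and projecting away the complement gives
a local left inverse `k` of `f`; the chain rule then gives a left inverse of the derivative. -/
lemma mfderiv_injective_of_isImmersionAt {f : M → N} {x : M}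
    (h : Manifold.IsImmersionAt I I' ∞ f x) : Function.Injective (mfderiv I I' f x) := by
  set e := h.domChart
  set e' := h.codChart
  let p : E' → E := fun v => (h.equiv.symm v).1
  let k : N → M := (e.extend I).symm ∘ p ∘ e'.extend I'
  have hx : x ∈ e.source := h.mem_domChart_source
  have hfx : f x ∈ e'.source := h.mem_codChart_source
  have hp : ∀ z ∈ e.source, p (e'.extend I' (f z)) = e.extend I z := by
    intro z hz
    have hmem : e.extend I z ∈ (e.extend I).target := by
      apply (e.extend I).map_source
      rwa [e.extend_source]
    have h1 := h.writtenInCharts hmem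
    simp only [Function.comp_apply] at h1
    rw [e.extend_left_inv hz] at h1
    simp only [p]
    rw [h1]
    simp
  have hk : (k ∘ f) =ᶠ[nhds x] id := by
    filter_upwards [e.open_source.mem_nhds hx] with z hz
    simp only [k, Function.comp_apply, hp z hz, e.extend_left_inv hz, id]
  have hf : MDifferentiableAt I I' f x := h.contMDiffAt.mdifferentiableAt (by simp)
  have h1 : MDifferentiableAt I' 𝓘(ℝ, E') (e'.extend I') (f x) :=
    (e'.contMDiffAt_extend h.codChart_mem_maximalAtlas hfx).mdifferentiableAt (by simp)
  have h2 : MDifferentiableAt 𝓘(ℝ, E') 𝓘(ℝ, E) p (e'.extend I' (f x)) := by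
    refine DifferentiableAt.mdifferentiableAt ?_
    exact (ContinuousLinearMap.differentiableAt
      ((ContinuousLinearMap.fst ℝ E h.complement).comp h.equiv.symm.toContinuousLinearMap))
  have h3 : MDifferentiableAt 𝓘(ℝ, E) I (e.extend I).symm (p (e'.extend I' (f x))) := by
    rw [hp x hx]
    have h4 : ContMDiffOn 𝓘(ℝ, E) I ∞ (e.extend I).symm (I '' e.target) :=
      contMDiffOn_extend_symm h.domChart_mem_maximalAtlas
    have h5 := e.extend_image_target_mem_nhds (I := I) hx
    rw [I.range_eq_univ, nhdsWithin_univ] at h5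
    exact (h4.contMDiffAt h5).mdifferentiableAt (by simp)
  have hkd : MDifferentiableAt I' I k (f x) := h3.comp (f x) (h2.comp (f x) h1)
  have h5 := mfderiv_comp x hkd hf
  rw [hk.mfderiv_eq, mfderiv_id] at h5
  refine Function.LeftInverse.injective (g := mfderiv I' I k (f x)) fun v => ?_
  exact (congrArg (fun L : TangentSpace I x →L[ℝ] TangentSpace I x => L v) h5).symm

end Immersion

/-! ### Null infinity in a chart of the unphysical spacetime -/

section Parametrization

variable {X : Type*} [TopologicalSpace X] [ChartedSpace (Coord 4) X]
  {φ : OpenPartialHomeomorph X (Coord 4)} {c : OpenPartialHomeomorph Sphere2 (Coord 2)}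
  {Φ : ℝ × Sphere2 → X}

/-- The parametrisation of null infinity in coordinates. -/
def scriMap (φ : OpenPartialHomeomorph X (Coord 4)) (c : OpenPartialHomeomorph Sphere2 (Coord 2))
    (Φ : ℝ × Sphere2 → X) (ξ : Param) : Coord 4 := φ (Φ (ξ.1, c.symm ξ.2))

/-- The components of the rigging in coordinates. -/
def riggingMap (φ : OpenPartialHomeomorph X (Coord 4)) (c : OpenPartialHomeomorph Sphere2 (Coord 2))
    (Φ : ℝ × Sphere2 → X) (ℓ : ∀ (t : ℝ) (p : Sphere2), TangentSpace (𝓡 4) (Φ (t, p)))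
    (ξ : Param) : Coord 4 := dchart φ (Φ (ξ.1, c.symm ξ.2)) (ℓ ξ.1 (c.symm ξ.2))

/-- The set of parameters where the coordinate expressions are valid. -/
def scriDomain (φ : OpenPartialHomeomorph X (Coord 4))
    (c : OpenPartialHomeomorph Sphere2 (Coord 2)) (Φ : ℝ × Sphere2 → X) : Set Param :=
  {ξ | ξ.2 ∈ c.target ∧ Φ (ξ.1, c.symm ξ.2) ∈ φ.source}

/-- The derivative of `Φ`. -/
def dscri (Φ : ℝ × Sphere2 → X) (t : ℝ) (p : Sphere2) : Param →L[ℝ] Coord 4 :=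
  mfderiv (𝓘(ℝ, ℝ).prod (𝓡 2)) (𝓡 4) Φ (t, p)

lemma contMDiffOn_sphere_param (hc : c ∈ IsManifold.maximalAtlas (𝓡 2) ∞ Sphere2) :
    ContMDiffOn 𝓘(ℝ, Param) (𝓘(ℝ, ℝ).prod (𝓡 2)) ∞ (fun ξ : Param => (ξ.1, c.symm ξ.2))
      (Set.univ ×ˢ c.target) :=
  (contDiff_fst.contMDiff.contMDiffOn).prodMk ((contMDiffOn_symm_of_mem_maximalAtlas hc).comp
    (contDiff_snd.contMDiff.contMDiffOn) fun _ hx => hx.2)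

lemma isOpen_sphere_param (c : OpenPartialHomeomorph Sphere2 (Coord 2)) :
    IsOpen (Set.univ ×ˢ c.target : Set Param) := isOpen_univ.prod c.open_target

lemma isOpen_scriDomain (hΦ : ContMDiff (𝓘(ℝ, ℝ).prod (𝓡 2)) (𝓡 4) ∞ Φ)
    (hc : c ∈ IsManifold.maximalAtlas (𝓡 2) ∞ Sphere2) : IsOpen (scriDomain φ c Φ) := by
  have h1 : ContinuousOn (fun ξ : Param => Φ (ξ.1, c.symm ξ.2)) (Set.univ ×ˢ c.target) :=
    hΦ.continuous.comp_continuousOn (contMDiffOn_sphere_param hc).continuousOn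
  have := h1.isOpen_inter_preimage (isOpen_sphere_param c) φ.open_source
  convert this using 1
  ext ξ
  simp [scriDomain]

lemma scriMap_smooth (hΦ : ContMDiff (𝓘(ℝ, ℝ).prod (𝓡 2)) (𝓡 4) ∞ Φ)
    (hφ : φ ∈ IsManifold.maximalAtlas (𝓡 4) ∞ X)
    (hc : c ∈ IsManifold.maximalAtlas (𝓡 2) ∞ Sphere2) :
    ContDiffOn ℝ ∞ (scriMap φ c Φ) (scriDomain φ c Φ) := by
  refine contMDiffOn_iff_contDiffOn.1 ?_
  exact (contMDiffOn_of_mem_maximalAtlas hφ).comp (hΦ.comp_contMDiffOn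
    ((contMDiffOn_sphere_param hc).mono fun ξ hξ => ⟨Set.mem_univ _, hξ.1⟩)) fun ξ hξ => hξ.2

lemma fderiv_scriMap (hΦ : ContMDiff (𝓘(ℝ, ℝ).prod (𝓡 2)) (𝓡 4) ∞ Φ)
    (hφ : φ ∈ IsManifold.maximalAtlas (𝓡 4) ∞ X)
    (hc : c ∈ IsManifold.maximalAtlas (𝓡 2) ∞ Sphere2) {ξ : Param}
    (hξ : ξ ∈ scriDomain φ c Φ) (a : Param) :
    fderiv ℝ (scriMap φ c Φ) ξ a = dchart φ (Φ (ξ.1, c.symm ξ.2))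
      (dscri Φ ξ.1 (c.symm ξ.2) (a.1, dchartSymm c ξ.2 a.2)) := by
  have d1 : MDifferentiableAt 𝓘(ℝ, Param) 𝓘(ℝ, ℝ) (fun ξ : Param => ξ.1) ξ :=
    (differentiableAt_fst).mdifferentiableAt
  have d2' : MDifferentiableAt 𝓘(ℝ, Param) (𝓡 2) (fun ξ : Param => ξ.2) ξ :=
    (differentiableAt_snd).mdifferentiableAt
  have d3 := chart_symm_mdifferentiableAt hc hξ.1
  have d2 : MDifferentiableAt 𝓘(ℝ, Param) (𝓡 2) (fun ξ : Param => c.symm ξ.2) ξ := d3.comp ξ d2'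
  have dκ : MDifferentiableAt 𝓘(ℝ, Param) (𝓘(ℝ, ℝ).prod (𝓡 2))
      (fun ξ : Param => (ξ.1, c.symm ξ.2)) ξ := d1.prodMk d2
  have dΦ : MDifferentiableAt (𝓘(ℝ, ℝ).prod (𝓡 2)) (𝓡 4) Φ (ξ.1, c.symm ξ.2) :=
    hΦ.mdifferentiableAt (by simp)
  have dφ := chart_mdifferentiableAt hφ hξ.2
  have e1 : mfderiv 𝓘(ℝ, Param) (𝓡 2) (fun ξ : Param => c.symm ξ.2) ξ =
      (mfderiv (𝓡 2) (𝓡 2) c.symm ξ.2).comp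
        (mfderiv 𝓘(ℝ, Param) (𝓡 2) (fun ξ : Param => ξ.2) ξ) := mfderiv_comp ξ d3 d2'
  have e2 := mfderiv_prodMk d1 d2
  have e3 : mfderiv 𝓘(ℝ, Param) (𝓡 4) (fun ξ : Param => Φ (ξ.1, c.symm ξ.2)) ξ =
      (mfderiv (𝓘(ℝ, ℝ).prod (𝓡 2)) (𝓡 4) Φ (ξ.1, c.symm ξ.2)).comp
        (mfderiv 𝓘(ℝ, Param) (𝓘(ℝ, ℝ).prod (𝓡 2)) (fun ξ : Param => (ξ.1, c.symm ξ.2)) ξ) :=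
    mfderiv_comp ξ dΦ dκ
  have e4 : mfderiv 𝓘(ℝ, Param) (𝓡 4) (scriMap φ c Φ) ξ =
      (mfderiv (𝓡 4) (𝓡 4) φ (Φ (ξ.1, c.symm ξ.2))).comp
        (mfderiv 𝓘(ℝ, Param) (𝓡 4) (fun ξ : Param => Φ (ξ.1, c.symm ξ.2)) ξ) :=
    mfderiv_comp ξ dφ (dΦ.comp ξ dκ)
  rw [e3, e2, e1, mfderiv_eq_fderiv, mfderiv_eq_fderiv, mfderiv_eq_fderiv, fderiv_fst, fderiv_snd]
    at e4
  rw [e4]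
  rfl

lemma scriMap_tvec (hΦ : ContMDiff (𝓘(ℝ, ℝ).prod (𝓡 2)) (𝓡 4) ∞ Φ)
    (hφ : φ ∈ IsManifold.maximalAtlas (𝓡 4) ∞ X)
    (hc : c ∈ IsManifold.maximalAtlas (𝓡 2) ∞ Sphere2) {ξ : Param} (hξ : ξ ∈ scriDomain φ c Φ) :
    fderiv ℝ (scriMap φ c Φ) ξ tvec =
      dchart φ (Φ (ξ.1, c.symm ξ.2)) (nullVec Φ ξ.1 (c.symm ξ.2)) := by
  rw [fderiv_scriMap hΦ hφ hc hξ]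
  simp only [tvec, map_zero]
  rfl

lemma scriMap_svec (hΦ : ContMDiff (𝓘(ℝ, ℝ).prod (𝓡 2)) (𝓡 4) ∞ Φ)
    (hφ : φ ∈ IsManifold.maximalAtlas (𝓡 4) ∞ X)
    (hc : c ∈ IsManifold.maximalAtlas (𝓡 2) ∞ Sphere2) {ξ : Param} (hξ : ξ ∈ scriDomain φ c Φ)
    (M : Fin 2) : fderiv ℝ (scriMap φ c Φ) ξ (svec M) =
      dchart φ (Φ (ξ.1, c.symm ξ.2)) (sectionVec Φ ξ.1 (c.symm ξ.2) (coordVec c ξ.2 M)) := by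
  rw [fderiv_scriMap hΦ hφ hc hξ]
  rfl

lemma dchart_injective {φ : OpenPartialHomeomorph X (Coord 4)}
    (hφ : φ ∈ IsManifold.maximalAtlas (𝓡 4) ∞ X) {x : X} (hx : x ∈ φ.source) :
    Function.Injective (dchart φ x) :=
  Function.LeftInverse.injective (g := dchartSymm φ (φ x)) (dchartSymm_dchart_of_mem hφ hx)

lemma dchartSymm_injective (hc : c ∈ IsManifold.maximalAtlas (𝓡 2) ∞ Sphere2) {y : Coord 2}
    (hy : y ∈ c.target) : Function.Injective (dchartSymm c y) :=
  Function.LeftInverse.injective (g := dchart c (c.symm y)) (dchart_dchartSymm hc hy)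

lemma scriMap_injective (hΦ : Manifold.IsImmersion (𝓘(ℝ, ℝ).prod (𝓡 2)) (𝓡 4) ∞ Φ)
    (hφ : φ ∈ IsManifold.maximalAtlas (𝓡 4) ∞ X)
    (hc : c ∈ IsManifold.maximalAtlas (𝓡 2) ∞ Sphere2) {ξ : Param} (hξ : ξ ∈ scriDomain φ c Φ) :
    Function.Injective (fderiv ℝ (scriMap φ c Φ) ξ) := by
  intro a b hab
  rw [fderiv_scriMap hΦ.contMDiff hφ hc hξ, fderiv_scriMap hΦ.contMDiff hφ hc hξ] at hab
  have h1 := dchart_injective hφ hξ.2 hab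
  have h2 : Function.Injective (dscri Φ ξ.1 (c.symm ξ.2)) :=
    mfderiv_injective_of_isImmersionAt (hΦ.isImmersionAt (ξ.1, c.symm ξ.2))
  have h3 := h2 h1
  simp only [Prod.mk.injEq] at h3
  exact Prod.ext h3.1 (dchartSymm_injective hc hξ.1 h3.2)

variable {g : LorentzMetric X} {Ω : X → ℝ} {I O : Set X}
  {ℓ : ∀ (t : ℝ) (p : Sphere2), TangentSpace (𝓡 4) (Φ (t, p))}

lemma IsAdaptedFrame.riggingMap_smooth (h : IsAdaptedFrame g Ω I Φ ℓ)
    (hφ : φ ∈ IsManifold.maximalAtlas (𝓡 4) ∞ X)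
    (hc : c ∈ IsManifold.maximalAtlas (𝓡 2) ∞ Sphere2) :
    ContDiffOn ℝ ∞ (riggingMap φ c Φ ℓ) (scriDomain φ c Φ) := by
  rw [contDiffOn_euclidean]
  intro μ
  refine contMDiffOn_iff_contDiffOn.1 ?_
  exact (h.rigging_smooth φ hφ μ).comp
    ((contMDiffOn_sphere_param hc).mono fun ξ hξ => ⟨Set.mem_univ _, hξ.1⟩) fun ξ hξ => hξ.2

lemma gradVec_eq_nullVec (h : IsAdaptedFrame g Ω I Φ ℓ) (hΩ : ContMDiff (𝓡 4) 𝓘(ℝ, ℝ) ∞ Ω)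
    (hφ : φ ∈ IsManifold.maximalAtlas (𝓡 4) ∞ X) {t : ℝ} {p : Sphere2}
    (hx : Φ (t, p) ∈ φ.source) :
    dchart φ (Φ (t, p)) (nullVec Φ t p) =
      gradVec (g.inChart φ) (Ω ∘ φ.symm) (φ (Φ (t, p))) := by
  have hz := φ.map_source hx
  refine (g.isMetricOn hφ).isLeviCivitaOn.ext_metric hz fun w => ?_
  rw [(g.isMetricOn hφ).metricForm_gradVec hz]
  have hw := dchart_dchartSymm hφ hz w
  rw [φ.left_inv hx] at hw
  conv_lhs => rw [← hw]
  refine (metricForm_dchart g hφ hx _ _).trans ?_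
  have h1 : g.formAt (Φ (t, p)) (nullVec Φ t p) (dchartSymm φ (φ (Φ (t, p))) w) =
      mfderiv (𝓡 4) 𝓘(ℝ, ℝ) Ω (Φ (t, p)) (dchartSymm φ (φ (Φ (t, p))) w) := h.nullVec_eq t p _
  rw [h1]
  have h2 : mfderiv (𝓡 4) 𝓘(ℝ, ℝ) (Ω ∘ φ.symm) (φ (Φ (t, p))) =
      (mfderiv (𝓡 4) 𝓘(ℝ, ℝ) Ω (φ.symm (φ (Φ (t, p))))).comp
        (mfderiv (𝓡 4) (𝓡 4) φ.symm (φ (Φ (t, p)))) :=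
    mfderiv_comp _ (hΩ.mdifferentiableAt (by simp)) (chart_symm_mdifferentiableAt hφ hz)
  rw [mfderiv_eq_fderiv] at h2
  rw [h2]
  -- The base points `φ.symm (φ x)` and `x` are equal but not definitionally, so the derivative is
  -- transported between them.
  have h3 : ∀ x, x = Φ (t, p) → ∀ v : Coord 4,
      (mfderiv (𝓡 4) 𝓘(ℝ, ℝ) Ω (Φ (t, p)) v : ℝ) = (mfderiv (𝓡 4) 𝓘(ℝ, ℝ) Ω x v : ℝ) := by
    rintro x rfl v; rfl
  exact h3 _ (φ.left_inv hx) _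

theorem IsAdaptedFrame.isNullInfinityChart (h : IsAdaptedFrame g Ω I Φ ℓ)
    (hΩ : ContMDiff (𝓡 4) 𝓘(ℝ, ℝ) ∞ Ω) (hΩI : ∀ x ∈ I, Ω x = 0)
    (hgauge : DivergenceFreeGauge g Ω I) (hO : IsOpen O) (hcl : I ⊆ closure O)
    (hflat : ∀ φ ∈ IsManifold.maximalAtlas (𝓡 4) ∞ X,
      ∀ z ∈ φ.target ∩ φ.symm ⁻¹' O, IsConformallyRicciFlatAt (g.inChart φ) (Ω ∘ φ.symm) z)
    (hφ : φ ∈ IsManifold.maximalAtlas (𝓡 4) ∞ X)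
    (hc : c ∈ IsManifold.maximalAtlas (𝓡 2) ∞ Sphere2) :
    IsNullInfinityChart (g.inChart φ) φ.target (Ω ∘ φ.symm) (scriMap φ c Φ) (riggingMap φ c Φ ℓ)
      (scriDomain φ c Φ) := by
  have hΦ := h.embedding.contMDiff
  have hI : ∀ x, Φ x ∈ I := fun x => h.range_eq ▸ Set.mem_range_self x
  have hmet := g.isMetricOn hφ
  have hform := fun {ξ : Param} (hξ : ξ ∈ scriDomain φ c Φ) (u v : Coord 4) =>
    metricForm_dchart g hφ hξ.2 u v
  exact
  { metric := hmet
    smooth_factor := contDiffOn_factor hΩ hφ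
    isOpen := isOpen_scriDomain hΦ hc
    smooth := scriMap_smooth hΦ hφ hc
    rigging_smooth := h.riggingMap_smooth hφ hc
    mapsTo := fun ξ hξ => φ.map_source hξ.2
    factor_eq_zero := fun ξ hξ => by
      rw [Function.comp_apply, scriMap, φ.left_inv hξ.2]
      exact hΩI _ (hI _)
    gauge := fun ξ hξ u => by
      change nablaLin (connection (g.inChart φ)) (gradVec (g.inChart φ) (Ω ∘ φ.symm)) _ u = 0
      rw [← sum_smul_cvec u, map_sum]
      refine Finset.sum_eq_zero fun ν _ => ?_
      rw [map_smul, nablaLin_apply]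
      have : nabla (connection (g.inChart φ)) (gradVec (g.inChart φ) (Ω ∘ φ.symm))
          (scriMap φ c Φ ξ) (cvec ν) = 0 := by
        ext μ
        exact (hmet.nabla_gradVec (contDiffOn_factor hΩ hφ) (φ.map_source hξ.2) ν μ).trans
          (hgauge φ hφ _ hξ.2 (hI _) ν μ)
      rw [this, smul_zero]
    boundary := fun ξ hξ => isVacuumBoundaryPoint hΩ hO hflat hφ hξ.2 (hcl (hI _))
    null_eq := fun ξ hξ => by
      rw [scriMap_tvec hΦ hφ hc hξ]
      exact gradVec_eq_nullVec h hΩ hφ hξ.2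
    injective := fun ξ hξ => scriMap_injective h.embedding.isImmersion hφ hc hξ
    rigging_null := fun ξ hξ => (hform hξ _ _).trans (h.rigging_null _ _)
    rigging_normal := fun ξ hξ => by
      rw [scriMap_tvec hΦ hφ hc hξ]
      exact (hform hξ _ _).trans (h.rigging_nullVec _ _)
    rigging_section := fun ξ hξ M => by
      rw [scriMap_svec hΦ hφ hc hξ]
      exact (hform hξ _ _).trans (h.rigging_section _ _ _) }

end Parametrization

/-! ### Propagation of the constraint -/

lemma christoffel_congr {n : ℕ} {G G' : Coord n → Matrix (Fin n) (Fin n) ℝ} {y : Coord n}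
    (h : G =ᶠ[nhds y] G') : christoffel G y = christoffel G' y := by
  have hpd : ∀ i j k, pd i (fun z => G z j k) y = pd i (fun z => G' z j k) y := fun i j k => by
    have e : (fun z => G z j k) =ᶠ[nhds y] fun z => G' z j k := by
      filter_upwards [h] with z hz
      rw [hz]
    rw [pd, pd, e.fderiv_eq]
  funext k i j
  simp only [christoffel, hpd, h.eq_of_nhds]

section Propagation

variable {Y : Type*} [TopologicalSpace Y] [ChartedSpace (Coord 4) Y]
  {X : Type*} [TopologicalSpace X] [ChartedSpace (Coord 4) X]
  {g' : LorentzMetric Y} {g : LorentzMetric X} {Ψ : Y → X} {Ω : X → ℝ} {Φ : ℝ × Sphere2 → X}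
  {ℓ : ∀ (t : ℝ) (p : Sphere2), TangentSpace (𝓡 4) (Φ (t, p))}
  {φ : OpenPartialHomeomorph X (Coord 4)} {c : OpenPartialHomeomorph Sphere2 (Coord 2)}

lemma inducedMetric_scriMap (hΦ : ContMDiff (𝓘(ℝ, ℝ).prod (𝓡 2)) (𝓡 4) ∞ Φ)
    (hφ : φ ∈ IsManifold.maximalAtlas (𝓡 4) ∞ X)
    (hc : c ∈ IsManifold.maximalAtlas (𝓡 2) ∞ Sphere2) {ξ : Param} (hξ : ξ ∈ scriDomain φ c Φ) :
    inducedMetric (g.inChart φ) (scriMap φ c Φ) ξ = sectionMetricInChart g Φ ξ.1 c ξ.2 := by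
  ext M N
  rw [inducedMetric, Matrix.of_apply, scriMap_svec hΦ hφ hc hξ, scriMap_svec hΦ hφ hc hξ]
  exact metricForm_dchart g hφ hξ.2 _ _

variable [IsManifold (𝓡 4) ∞ Y] [IsManifold (𝓡 4) ∞ X]

/-- A generator need not stay in a single chart of the spacetime, so the chart is chosen around each
point `Φ (t, p)`. Only derivatives at `t` are computed in it. -/
lemma IsConformalCompletion.exists_isNullInfinityChart (hflat : IsConformalCompletion g' g Ψ Ω)
    (hgauge : DivergenceFreeGauge g Ω (frontier (Set.range Ψ)))
    (hframe : IsAdaptedFrame g Ω (frontier (Set.range Ψ)) Φ ℓ)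
    (hc : c ∈ IsManifold.maximalAtlas (𝓡 2) ∞ Sphere2) {y : Coord 2} (hy : y ∈ c.target) (t : ℝ) :
    ∃ φ ∈ IsManifold.maximalAtlas (𝓡 4) ∞ X, (t, y) ∈ scriDomain φ c Φ ∧
      IsNullInfinityChart (g.inChart φ) φ.target (Ω ∘ φ.symm) (scriMap φ c Φ) (riggingMap φ c Φ ℓ)
        (scriDomain φ c Φ) ∧
      ∀ ξ ∈ scriDomain φ c Φ, ∀ u v : Coord 4, g.schoutenAt (Φ (ξ.1, c.symm ξ.2)) u v =
        schoutenForm (g.inChart φ) (scriMap φ c Φ ξ) (dchart φ (Φ (ξ.1, c.symm ξ.2)) u)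
          (dchart φ (Φ (ξ.1, c.symm ξ.2)) v) := by
  obtain ⟨O, hO, hcl, hOflat⟩ := hflat.exists_bulk
  have hφ := IsManifold.chart_mem_maximalAtlas (I := 𝓡 4) (n := ∞) (Φ (t, c.symm y))
  refine ⟨_, hφ, ⟨hy, mem_chart_source _ _⟩, hframe.isNullInfinityChart hflat.smooth_factor
    hflat.factor_eq_zero hgauge hO hcl hOflat hφ hc, fun ξ hξ u v => ?_⟩
  exact schoutenAt_eq_schoutenForm hflat.smooth_factor hO hOflat hφ hξ.2
    (hcl (hframe.range_eq ▸ Set.mem_range_self _)) u v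

/-- The derivative along the generator vanishes at every `t`, each time in a suitable chart, and the
null coordinate ranges over all of `ℝ`. -/
lemma sectionMetricInChart_const (hflat : IsConformalCompletion g' g Ψ Ω)
    (hgauge : DivergenceFreeGauge g Ω (frontier (Set.range Ψ)))
    (hframe : IsAdaptedFrame g Ω (frontier (Set.range Ψ)) Φ ℓ)
    (hc : c ∈ IsManifold.maximalAtlas (𝓡 2) ∞ Sphere2) {y : Coord 2} (hy : y ∈ c.target)
    (t s : ℝ) : sectionMetricInChart g Φ t c y = sectionMetricInChart g Φ s c y := by
  ext M N
  have hd : ∀ t, HasDerivAt (fun s => sectionMetricInChart g Φ s c y M N) 0 t := by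
    intro t
    obtain ⟨φ, hφ, hξ, H, -⟩ := hflat.exists_isNullInfinityChart hgauge hframe hc hy t
    have h1 := IsNullInfinityChart.hasDerivAt_time (((H.inducedMetric_smooth M N).contDiffAt
      (H.isOpen.mem_nhds hξ)).differentiableAt (by simp))
    rw [H.fderiv_inducedMetric_null hξ] at h1
    refine h1.congr_of_eventuallyEq ?_
    have hcont : Filter.Tendsto (fun s : ℝ => ((s, y) : Param)) (nhds t) (nhds (t, y)) :=
      (continuous_id.prodMk continuous_const).tendsto _
    filter_upwards [hcont (H.isOpen.mem_nhds hξ)] with s hs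
    rw [inducedMetric_scriMap hframe.embedding.contMDiff hφ hc hs]
  exact is_const_of_deriv_eq_zero (fun t => (hd t).differentiableAt) (fun t => (hd t).deriv) t s

/-- The defect of the constraint is constant along the generators of null infinity. -/
lemma hasDerivAt_constraint_defect (hflat : IsConformalCompletion g' g Ψ Ω)
    (hgauge : DivergenceFreeGauge g Ω (frontier (Set.range Ψ)))
    (hframe : IsAdaptedFrame g Ω (frontier (Set.range Ψ)) Φ ℓ) {Ξ : SectionTensor}
    (hsmooth : Ξ.IsSmooth) (hevol : EvolutionEquation g Φ ℓ Ξ)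
    (hc : c ∈ IsManifold.maximalAtlas (𝓡 2) ∞ Sphere2) {y : Coord 2} (hy : y ∈ c.target)
    (M N P : Fin 2) (t : ℝ) :
    HasDerivAt (fun s => covDeriv (sectionMetricInChart g Φ s c) (Ξ.inChart s c) y M N P
        - covDeriv (sectionMetricInChart g Φ s c) (Ξ.inChart s c) y N M P
      - (1 / 2) *
        (sectionMetricInChart g Φ s c y P M
            * g.schoutenAt (Φ (s, c.symm y)) (sectionVec Φ s (c.symm y) (coordVec c y N))
              (ℓ s (c.symm y))
          - sectionMetricInChart g Φ s c y P N
            * g.schoutenAt (Φ (s, c.symm y)) (sectionVec Φ s (c.symm y) (coordVec c y M))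
              (ℓ s (c.symm y)))) 0 t := by
  obtain ⟨φ, hφ, hξ, H, hS⟩ := hflat.exists_isNullInfinityChart hgauge hframe hc hy t
  have hΦ := hframe.embedding.contMDiff
  let K : Fin 2 → Fin 2 → Param → ℝ := fun A B ξ => Ξ.inChart ξ.1 c ξ.2 A B
  have hK : ∀ A B, ContDiffOn ℝ ∞ (K A B) (Set.univ ×ˢ c.target) := hsmooth c hc
  have dK : ∀ A B, ∀ ξ : Param, ξ.2 ∈ c.target → DifferentiableAt ℝ (K A B) ξ :=
    fun A B ξ hξ => ((hK A B).contDiffAt ((isOpen_sphere_param c).mem_nhds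
      ⟨Set.mem_univ _, hξ⟩)).differentiableAt (by simp)
  have hev : ∀ A B, ∀ x ∈ scriDomain φ c Φ, fderiv ℝ (K A B) x tvec = -(1 / 2) *
      (schoutenForm (g.inChart φ) (scriMap φ c Φ x) (fderiv ℝ (scriMap φ c Φ) x (svec A))
          (fderiv ℝ (scriMap φ c Φ) x (svec B))
        + schoutenForm (g.inChart φ) (scriMap φ c Φ x) (fderiv ℝ (scriMap φ c Φ) x tvec)
          (riggingMap φ c Φ ℓ x) * inducedMetric (g.inChart φ) (scriMap φ c Φ) x A B) := by
    intro A B x hx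
    rw [scriMap_svec hΦ hφ hc hx, scriMap_svec hΦ hφ hc hx, scriMap_tvec hΦ hφ hc hx,
      inducedMetric_scriMap hΦ hφ hc hx]
    refine (IsNullInfinityChart.hasDerivAt_time (dK A B x hx.1)).unique ?_
    refine (hevol x.1 (c.symm x.2) (coordVec c x.2 A) (coordVec c x.2 B)).congr_deriv ?_
    exact congrArg₂ (fun a b => -(1 / 2) * (a + b * sectionMetricInChart g Φ x.1 c x.2 A B))
      (hS x hx _ _) (hS x hx _ _)
  refine (H.hasDerivAt_constraint hξ (fun A B => (hK A B).mono fun x hx => ⟨Set.mem_univ _, hx.1⟩)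
    hev M N P).congr_of_eventuallyEq ?_
  have hcont : Filter.Tendsto (fun s : ℝ => ((s, y) : Param)) (nhds t) (nhds (t, y)) :=
    (continuous_id.prodMk continuous_const).tendsto _
  filter_upwards [hcont (H.isOpen.mem_nhds hξ)] with s hs
  -- As `q` is independent of the null coordinate, its connection may be frozen at `t`, which is the
  -- form that `hasDerivAt_constraint` requires.
  have hΓ : christoffel (sectionMetricInChart g Φ s c) y =
      christoffel (fun z => inducedMetric (g.inChart φ) (scriMap φ c Φ) (t, z)) y := by
    have hcont' : Filter.Tendsto (fun z => ((t, z) : Param)) (nhds y) (nhds (t, y)) :=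
      (continuous_const.prodMk continuous_id).tendsto _
    refine christoffel_congr ?_
    filter_upwards [hcont' (H.isOpen.mem_nhds hξ)] with z hz
    rw [inducedMetric_scriMap hΦ hφ hc hz]
    exact sectionMetricInChart_const hflat hgauge hframe hc hz.1 s t
  have hq : sectionMetricInChart g Φ s c y =
      inducedMetric (g.inChart φ) (scriMap φ c Φ) (t, y) := by
    rw [inducedMetric_scriMap hΦ hφ hc hξ]
    exact sectionMetricInChart_const hflat hgauge hframe hc hy s t
  have hpd : ∀ A B C, pd A (fun z => Ξ.inChart s c z B C) y =
      fderiv ℝ (K B C) (s, y) (svec A) := fun A B C =>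
    IsNullInfinityChart.hasFDerivAt_slice (dK B C (s, y) hy) A
  have hSℓ : ∀ A, g.schoutenAt (Φ (s, c.symm y)) (sectionVec Φ s (c.symm y) (coordVec c y A))
      (ℓ s (c.symm y)) = schoutenForm (g.inChart φ) (scriMap φ c Φ (s, y))
        (fderiv ℝ (scriMap φ c Φ) (s, y) (svec A)) (riggingMap φ c Φ ℓ (s, y)) := fun A => by
    rw [scriMap_svec hΦ hφ hc hs]
    exact hS (s, y) hs _ _
  simp only [covDeriv, hΓ, hq, hpd, hSℓ]
  rfl

end Propagation

end NullInfinity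

end

theorem mainTheorem9
    {Y : Type*} [TopologicalSpace Y] [ChartedSpace (NullInfinity.Coord 4) Y]
    [IsManifold (𝓡 4) ∞ Y]
    {X : Type*} [TopologicalSpace X] [ChartedSpace (NullInfinity.Coord 4) X]
    [IsManifold (𝓡 4) ∞ X]
    (g' : NullInfinity.LorentzMetric Y) (g : NullInfinity.LorentzMetric X)
    (Ψ : Y → X) (Ω : X → ℝ)
    (hflat : NullInfinity.IsConformalCompletion g' g Ψ Ω)
    (hgauge : NullInfinity.DivergenceFreeGauge g Ω (frontier (Set.range Ψ)))
    (Φ : ℝ × NullInfinity.Sphere2 → X)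
    (ℓ : ∀ (t : ℝ) (p : NullInfinity.Sphere2), TangentSpace (𝓡 4) (Φ (t, p)))
    (hframe : NullInfinity.IsAdaptedFrame g Ω (frontier (Set.range Ψ)) Φ ℓ)
    (Ξ : NullInfinity.SectionTensor) (hsmooth : Ξ.IsSmooth)
    (hevol : NullInfinity.EvolutionEquation g Φ ℓ Ξ)
    (t₀ : ℝ) (h₀ : NullInfinity.ConstraintOnSection g Φ ℓ Ξ t₀) :
    ∀ t : ℝ, NullInfinity.ConstraintOnSection g Φ ℓ Ξ t := by
  intro t c hc y hy M N P
  have hd := NullInfinity.hasDerivAt_constraint_defect hflat hgauge hframe hsmooth hevol hc hy M N P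
  -- At a fixed point of the sphere and for fixed indices the defect depends on the null coordinate
  -- alone, so its values at `t` and `t₀` agree.
  have h1 := is_const_of_deriv_eq_zero (fun s => (hd s).differentiableAt) (fun s => (hd s).deriv) t t₀
  exact sub_eq_zero.1 (h1.trans (sub_eq_zero.2 (h₀ c hc y hy M N P)))
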